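/- Let $(W,S)$ be a Coxeter system with length function $l$ and Bruhat order $\le$, let $\mathcal A=\mathbb Z[q,q^{-1}]$, and let $\mathcal H$ be the Hecke algebra of $(W,S)$: the associative $\mathcal A$-algebra with generators $T_s$ ($s\in S$), subject to the braid relations and to $T_s^2=1+(q-q^{-1})T_s$. For $w\in W$ let $T_w$ be the product of the $T_s$ along a reduced expression of $w$. Let $h\mapsto\overline h$ be the involution of $\mathcal H$ with $\overline q=q^{-1}$ and $\overline{T_s}=T_s^{-1}$. Let $J\subseteq S$, let $W_J$ be the subgroup generated by $J$, let $D_J=\{w\in W: l(ws)>l(w)\text{ for all }s\in J\}$, let $\mathcal H_J$ be the subalgebra generated by the $T_s$ with $s\in J$, and let $\mathcal A_\phi$ be $\mathcal A$ made into an $\mathcal H_J$-module through the homomorphism $\phi\colon\mathcal H_J\to\mathcal A$ with $\phi(T_u)=(-q)^{-l(u)}$ for $u\in W_J$. Put $\mathscr S_\phi=\mathcal H\otimes_{\mathcal H_J}\mathcal A_\phi$ and $b_w=T_w\otimes1$ for $w\in D_J$. For $w\in D_J$ let $D_J(w)=\{s\in S: sw<w\}\cup\{s\in S: sw>w,\ sw\notin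 D_J\}$. For an ideal $\mathscr I\ni 1$ of the left weak order on $W$ (a set containing all suffixes of its elements) with $\mathscr I\subseteq D_J$, one calls $\mathscr I$ a *$W$-graph ideal with respect to $J$* if there is an $\mathcal A$-free $\mathcal H$-module with an $\mathcal A$-basis $(b_w)_{w\in\mathscr I}$ such that, for $s\in S$ and $w\in\mathscr I$, $$T_sb_w=\begin{cases}b_{sw}&\text{if } sw>w,\ sw\in\mathscr I,\\ b_{sw}+(q-q^{-1})b_w&\text{if } sw<w,\\ -q^{-1}b_w&\text{if } sw>w,\ sw\notin D_J,\\ qb_w-\sum_{y\in\mathscr I,\,y<sw}r^s_{y,w}b_y&\text{if } sw>w,\ sw\in D_J\setminus\mathscr I,\end{cases}$$ for some $r^s_{y,w}\in q\mathbb Z[q]$, and an $\mathcal A$-semilinear involution $\alpha\mapsto\overline\alpha$ of the module with $\overline{b_1}=b_1$ and $\overline{h\alpha}=\overline h\,\overline\alpha$ for all $h\in\mathcal H$ and all $\alpha$. A *$W$-graph basis* of an $\mathcal H$-module, for a function $\mu\colon V\times V\to\mathbb Z$ and a function $\tau$ from $V$ to subsets of $S$, is an $\mathcal A$-basis $(c_v)_{v\in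 V}$ such that $T_sc_v=-q^{-1}c_v$ if $s\in\tau(v)$ and $T_sc_v=qc_v+\sum_{u:\,s\in\tau(u)}\mu(u,v)c_u$ (a finite sum) if $s\notin\tau(v)$. *Deodhar's polynomials* in the case $u=-1$ are the polynomials $P^J_{y,w}\in\mathbb Z[q]$ ($y,w\in D_J$) such that $P^J_{w,w}=1$; $P^J_{y,w}=0$ unless $y\le w$; $\deg P^J_{y,w}\le\frac12(l(w)-l(y)-1)$ if $y<w$; and $q^{l(w)-l(y)}P^J_{y,w}(q^{-1})=\sum_{z\in D_J,\,y\le z\le w}R^J_{y,z}P^J_{z,w}$ if $y\le w$. Here the polynomials $R^J_{y,w}\in\mathbb Z[q]$ are given by $R^J_{w,w}=1$; $R^J_{y,w}=0$ unless $y\le w$; and, for $y<w$ and $s\in S$ with $sw<w$: $R^J_{y,w}=R^J_{sy,sw}$ if $sy<y$; $R^J_{y,w}=(q-1)R^J_{y,sw}+qR^J_{sy,sw}$ if $sy>y$ and $sy\in D_J$; and $R^J_{y,w}=(q-1-u)R^J_{y,sw}$ (with $u=-1$) if $sy\notin D_J$. **Proposition.** The set $D_J$ is a $W$-graph ideal with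 respect to $J$. More precisely, $(b_w)_{w\in D_J}$ is an $\mathcal A$-basis of $\mathscr S_\phi$, and there is an $\mathcal A$-semilinear involution $\alpha\mapsto\overline\alpha$ of $\mathscr S_\phi$, such that all the requirements above hold for $\mathscr I=D_J$. Moreover, $\mathscr S_\phi$ has an $\mathcal A$-basis $(c_w)_{w\in D_J}$ and there are polynomials $p^J_{y,w}\in\mathbb Z[q]$ ($y,w\in D_J$, $y<w$) such that for all $w\in D_J$ $$\overline{c_w}=c_w,\qquad c_w=b_w-\sum_{y\in D_J,\,y<w}q\,p^J_{y,w}\,b_y,\qquad \deg p^J_{y,w}\le l(w)-l(y)-1,$$ and $(c_w)_{w\in D_J}$ is a $W$-graph basis of $\mathscr S_\phi$ for $\tau(w)=D_J(w)$ and $\mu(y,w)=\mu_{y,w}$ if $y<w$, $\mu(y,w)=\mu_{w,y}$ if $w<y$, $\mu(y,w)=0$ otherwise, where $\mu_{y,w}$ is the constant term of $p^J_{y,w}$. Finally, Deodhar's polynomials $P^J_{y,w}$ in the case $u=-1$ exist and are unique, and for all $y<w$ in $D_J$ $$p^J_{y,w}=(-q)^{l(w)-l(y)-1}P^*_{y,w},$$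 where $P^*_{y,w}$ is obtained from $P^J_{y,w}$ by replacing $q$ by $q^{-2}$. -/

import Mathlib

namespace HeckeWGraph

open CoxeterSystem TensorProduct

/-! ## The ground ring and the Hecke algebra -/

/-- The ring `ℤ[q, q⁻¹]` of Laurent polynomials in `q` with integer coefficients. -/
abbrev LaurentZ : Type := LaurentPolynomial ℤ

/-- The indeterminate `q`. -/
noncomputable def q : LaurentZ := LaurentPolynomial.T 1

/-- The element `q⁻¹`. -/
noncomputable def qInv : LaurentZ := LaurentPolynomial.T (-1)

theorem q_mul_qInv : q * qInv = 1 := by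
  rw [q, qInv, ← LaurentPolynomial.T_add]; exact LaurentPolynomial.T_zero

/-- The involution of `ℤ[q, q⁻¹]` that interchanges `q` and `q⁻¹`. -/
noncomputable def barA : LaurentZ →+* LaurentZ :=
  (LaurentPolynomial.invert : LaurentZ ≃ₐ[ℤ] LaurentZ).toRingEquiv.toRingHom

theorem barA_q : barA q = qInv := LaurentPolynomial.invert_T 1

theorem barA_qInv : barA qInv = q := LaurentPolynomial.invert_T (-1)

universe u v

variable {B : Type u} {W : Type v} [Group W]

/-- The defining relations of the Hecke algebra: the quadratic relations
`T_s² = 1 + (q - q⁻¹) T_s` and the braid relations, with `m(s,s')` factors on each side.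
(`m(s,s') = ∞` is encoded as `M i i' = 0`, and then both words are empty.) -/
inductive HeckeRel (M : CoxeterMatrix B) :
    FreeAlgebra LaurentZ B → FreeAlgebra LaurentZ B → Prop
  | quadratic (i : B) :
      HeckeRel M (FreeAlgebra.ι LaurentZ i * FreeAlgebra.ι LaurentZ i)
        (1 + algebraMap LaurentZ _ (q - qInv) * FreeAlgebra.ι LaurentZ i)
  | braid (i i' : B) :
      HeckeRel M ((alternatingWord i i' (M i i')).map (FreeAlgebra.ι LaurentZ)).prod
        ((alternatingWord i' i (M i i')).map (FreeAlgebra.ι LaurentZ)).prod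

/-- The Hecke algebra of the Coxeter group with Coxeter matrix `M`: the associative
`ℤ[q, q⁻¹]`-algebra with generators `T_s` and the quadratic and braid relations. -/
def Hecke (M : CoxeterMatrix B) : Type u := RingQuot (HeckeRel M)

noncomputable instance (M : CoxeterMatrix B) : Ring (Hecke M) :=
  inferInstanceAs (Ring (RingQuot (HeckeRel M)))

noncomputable instance (M : CoxeterMatrix B) : Algebra LaurentZ (Hecke M) :=
  inferInstanceAs (Algebra LaurentZ (RingQuot (HeckeRel M)))

/-- The universal property of the Hecke algebra. -/
noncomputable def Hecke.lift (M : CoxeterMatrix B) {R : Type*} [Ring R] [Algebra LaurentZ R]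
    (f : B → R)
    (hquad : ∀ i, f i * f i = 1 + algebraMap LaurentZ R (q - qInv) * f i)
    (hbraid : ∀ i i', ((alternatingWord i i' (M i i')).map f).prod =
      ((alternatingWord i' i (M i i')).map f).prod) : Hecke M →ₐ[LaurentZ] R :=
  RingQuot.liftAlgHom LaurentZ ⟨FreeAlgebra.lift LaurentZ f, by
    intro x y h
    cases h with
    | quadratic i =>
      simp only [map_mul, map_add, map_one, FreeAlgebra.lift_ι_apply, AlgHom.commutes, hquad]
    | braid i i' =>
      simpa [map_list_prod, List.map_map, Function.comp_def] using hbraid i i'⟩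

/-- The generator `T_s` of the Hecke algebra. -/
noncomputable def heckeGen (M : CoxeterMatrix B) (i : B) : Hecke M :=
  RingQuot.mkAlgHom LaurentZ (HeckeRel M) (FreeAlgebra.ι LaurentZ i)

theorem Hecke.lift_heckeGen (M : CoxeterMatrix B) {R : Type*} [Ring R] [Algebra LaurentZ R]
    (f : B → R) (hquad) (hbraid) (i : B) :
    Hecke.lift M f hquad hbraid (heckeGen M i) = f i := by
  refine (RingQuot.liftAlgHom_mkAlgHom_apply LaurentZ (FreeAlgebra.lift LaurentZ f) _ _).trans ?_
  simp

theorem heckeGen_sq (M : CoxeterMatrix B) (i : B) :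
    heckeGen M i * heckeGen M i =
      1 + algebraMap LaurentZ (Hecke M) (q - qInv) * heckeGen M i := by
  have h := RingQuot.mkAlgHom_rel LaurentZ (HeckeRel.quadratic (M := M) i)
  simp only [map_mul, map_add, map_one, AlgHom.commutes] at h
  exact h

theorem heckeGen_braid (M : CoxeterMatrix B) (i i' : B) :
    ((alternatingWord i i' (M i i')).map (heckeGen M)).prod =
      ((alternatingWord i' i (M i i')).map (heckeGen M)).prod := by
  have h := RingQuot.mkAlgHom_rel LaurentZ (HeckeRel.braid (M := M) i i')
  simp only [map_list_prod, List.map_map] at h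
  exact h

/-- The generator `T_s` as a unit, with inverse `T_s - (q - q⁻¹)`. -/
noncomputable def heckeUnit (M : CoxeterMatrix B) (i : B) : (Hecke M)ˣ where
  val := heckeGen M i
  inv := heckeGen M i - algebraMap LaurentZ (Hecke M) (q - qInv)
  val_inv := by
    rw [mul_sub, heckeGen_sq, ← Algebra.commutes]; abel
  inv_val := by
    rw [sub_mul, heckeGen_sq]; abel

theorem reverse_alternatingWord (i i' : B) (m : ℕ) :
    (alternatingWord i i' m).reverse =
      if Even m then alternatingWord i' i m else alternatingWord i i' m := by
  induction m generalizing i i' with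
  | zero => simp [alternatingWord]
  | succ m ih =>
    rw [alternatingWord_succ, List.concat_eq_append, List.reverse_append, ih]
    by_cases hm : Even m
    · simp only [hm, Nat.even_add_one, if_true, not_true, if_false, List.reverse_singleton,
        List.singleton_append]
      rw [← List.concat_eq_append, ← alternatingWord_succ, alternatingWord_succ', if_pos hm]
    · simp [hm, Nat.even_add_one, alternatingWord_succ' i' i m]

theorem heckeUnit_braid_inv (M : CoxeterMatrix B) (i i' : B) :
    ((alternatingWord i i' (M i i')).map fun j => (heckeUnit M j)⁻¹).prod =
      ((alternatingWord i' i (M i i')).map fun j => (heckeUnit M j)⁻¹).prod := by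
  have key : ∀ ω : List B, (ω.map fun j => (heckeUnit M j)⁻¹).prod =
      ((ω.reverse.map (heckeUnit M)).prod)⁻¹ := by
    intro ω
    rw [List.prod_inv_reverse, List.map_map, ← List.map_reverse, List.reverse_reverse]
    rfl
  have hu : ((alternatingWord i i' (M i i')).map (heckeUnit M)).prod =
      ((alternatingWord i' i (M i i')).map (heckeUnit M)).prod := by
    apply Units.ext
    have hval : ∀ ω : List B, (((ω.map (heckeUnit M)).prod : (Hecke M)ˣ) : Hecke M) =
        (ω.map (heckeGen M)).prod := by
      intro ω
      rw [← Units.coeHom_apply, map_list_prod, List.map_map]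
      rfl
    rw [hval, hval]
    exact heckeGen_braid M i i'
  rw [key, key, reverse_alternatingWord, reverse_alternatingWord]
  split_ifs
  · rw [hu]
  · rw [hu]

/-- The ring `Hecke M`, viewed as a `ℤ[q, q⁻¹]`-algebra through `barA`. -/
def HeckeTwist (M : CoxeterMatrix B) : Type u := Hecke M

noncomputable instance (M : CoxeterMatrix B) : Ring (HeckeTwist M) :=
  inferInstanceAs (Ring (Hecke M))

noncomputable instance (M : CoxeterMatrix B) : Algebra LaurentZ (HeckeTwist M) :=
  RingHom.toAlgebra' (S := HeckeTwist M) ((algebraMap LaurentZ (Hecke M)).comp barA)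
    (fun c x => Algebra.commutes (A := Hecke M) (barA c) x)

/-- The bar involution of the Hecke algebra: the ring homomorphism that extends
`q ↦ q⁻¹` and sends `T_s` to `T_s⁻¹ = T_s - (q - q⁻¹)`. -/
noncomputable def barH (M : CoxeterMatrix B) : Hecke M →+* Hecke M :=
  (Hecke.lift M (R := HeckeTwist M)
    (fun i => ((heckeUnit M i)⁻¹ : (Hecke M)ˣ).val)
    (by
      intro i
      have h1 := heckeGen_sq M i
      have hc : algebraMap LaurentZ (HeckeTwist M) (q - qInv) =
          - algebraMap LaurentZ (Hecke M) (q - qInv) := by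
        change algebraMap LaurentZ (Hecke M) (barA (q - qInv)) = _
        rw [map_sub, barA_q, barA_qInv, ← map_neg, neg_sub]
      rw [hc]
      change (heckeGen M i - algebraMap LaurentZ (Hecke M) (q - qInv)) *
          (heckeGen M i - algebraMap LaurentZ (Hecke M) (q - qInv)) =
        1 + (- algebraMap LaurentZ (Hecke M) (q - qInv)) *
          (heckeGen M i - algebraMap LaurentZ (Hecke M) (q - qInv))
      rw [sub_mul, mul_sub, h1, ← Algebra.commutes]
      noncomm_ring)
    (by
      intro i i'
      have h := congrArg (Units.val) (heckeUnit_braid_inv M i i')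
      rw [← Units.coeHom_apply, ← Units.coeHom_apply, map_list_prod, map_list_prod,
        List.map_map, List.map_map] at h
      exact h)).toRingHom

theorem barH_heckeGen (M : CoxeterMatrix B) (i : B) :
    barH M (heckeGen M i) = heckeGen M i - algebraMap LaurentZ (Hecke M) (q - qInv) :=
  Hecke.lift_heckeGen M (R := HeckeTwist M) _ _ _ i

theorem barH_algebraMap (M : CoxeterMatrix B) (a : LaurentZ) :
    barH M (algebraMap LaurentZ (Hecke M) a) = algebraMap LaurentZ (Hecke M) (barA a) :=
  AlgHom.commutes (Hecke.lift M (R := HeckeTwist M) _ _ _) a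

/-- The element `T_w = T_{s₁} ⋯ T_{sₖ}`, where `s₁ ⋯ sₖ` is a reduced expression of `w`.
(Two reduced expressions of `w` are linked by braid moves, so any of them may be used.) -/
noncomputable def heckeT {M : CoxeterMatrix B} (cs : CoxeterSystem M W) (w : W) : Hecke M :=
  ((cs.exists_isReduced w).choose.map (heckeGen M)).prod

/-! ## Coxeter groups: Bruhat order, weak order, minimal coset representatives -/

/-- The Bruhat order: the transitive closure of the relation `l(u) ≤ l(w)` and `w = t u` for
some `t` that is a reflection or `1`. -/
def BruhatLE {M : CoxeterMatrix B} (cs : CoxeterSystem M W) : W → W → Prop :=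
  Relation.TransGen fun u w =>
    cs.length u ≤ cs.length w ∧ ∃ t : W, (cs.IsReflection t ∨ t = 1) ∧ w = t * u

/-- The strict Bruhat order. -/
def BruhatLT {M : CoxeterMatrix B} (cs : CoxeterSystem M W) (u w : W) : Prop :=
  BruhatLE cs u w ∧ u ≠ w

/-- The left weak order: the transitive closure of the relation `l(u) ≤ l(w)` and `w = s u` for
some `s` that is a simple reflection or `1`. -/
def WeakLE {M : CoxeterMatrix B} (cs : CoxeterSystem M W) : W → W → Prop :=
  Relation.TransGen fun u w =>
    cs.length u ≤ cs.length w ∧ ∃ s : W, ((∃ i, s = cs.simple i) ∨ s = 1) ∧ w = s * u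

/-- The set `D_J` of distinguished (minimal) left coset representatives of `W_J` in `W`. -/
def minReps {M : CoxeterMatrix B} (cs : CoxeterSystem M W) (J : Set B) : Set W :=
  {w | ∀ s ∈ J, cs.length w < cs.length (w * cs.simple s)}

/-- `Pos(X)`, the set of `s` with `l(xs) > l(x)` for all `x ∈ X`. -/
def pos {M : CoxeterMatrix B} (cs : CoxeterSystem M W) (X : Set W) : Set B :=
  {s | ∀ x ∈ X, cs.length x < cs.length (x * cs.simple s)}

/-! ## `W`-graphs -/

/-- Given a module over the Hecke algebra with an `ℤ[q, q⁻¹]`-basis `c` indexed by `V`, the triple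
`(V, μ, τ)` is a `W`-graph, with `c` as the corresponding `W`-graph basis of the module. -/
def IsWGraphBasis (M : CoxeterMatrix B) {V S : Type*} [AddCommGroup S] [Module LaurentZ S]
    [Module (Hecke M) S] (c : Module.Basis V LaurentZ S) (μ : V → V → ℤ) (τ : V → Set B) : Prop :=
  ∀ (s : B) (v : V),
    (s ∈ τ v → heckeGen M s • c v = -(qInv • c v)) ∧
    (s ∉ τ v → {u | s ∈ τ u ∧ μ u v ≠ 0}.Finite ∧
      heckeGen M s • c v = q • c v + ∑ᶠ (u : V) (_ : s ∈ τ u), μ u v • c u)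

/-! ## `W`-graph ideals -/

section Ideals

variable {M : CoxeterMatrix B} (cs : CoxeterSystem M W) (I : Set W) (J : Set B)

/-- Strong ascents of `w` relative to `I`. -/
def strongAscents (w : W) : Set B :=
  {s | BruhatLT cs w (cs.simple s * w) ∧ cs.simple s * w ∈ I}

/-- Strong descents of `w`. -/
def strongDescents (w : W) : Set B :=
  {s | BruhatLT cs (cs.simple s * w) w}

/-- Weak ascents of `w` relative to `I` and `J`. -/
def weakAscents (w : W) : Set B :=
  {s | BruhatLT cs w (cs.simple s * w) ∧ cs.simple s * w ∈ minReps cs J \ I}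

/-- Weak descents of `w` relative to `J`. -/
def weakDescents (w : W) : Set B :=
  {s | BruhatLT cs w (cs.simple s * w) ∧ cs.simple s * w ∉ minReps cs J}

/-- The set `D_J(w)` of all descents of `w`, strong or weak. -/
def descents (w : W) : Set B :=
  strongDescents cs w ∪ weakDescents cs J w

/-- `b` is an `ℤ[q, q⁻¹]`-basis of the module `S` over the Hecke algebra, and `bar` is a map
`S → S`, which satisfy the two requirements on `S(I, J)` in the definition of a `W`-graph ideal.
The polynomial `r s w y` is the `r^s_{y,w}` of the weak ascents. -/
structure IsIdealModule {S : Type*} [AddCommGroup S] [Module LaurentZ S] [Module (Hecke M) S]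
    (b : Module.Basis I LaurentZ S) (bar : S →ₛₗ[barA] S) : Prop where
  strongAscent : ∀ (s : B) (w x : I), s ∈ strongAscents cs I w → (x : W) = cs.simple s * w →
    heckeGen M s • b w = b x
  strongDescent : ∀ (s : B) (w x : I), s ∈ strongDescents cs (w : W) →
    (x : W) = cs.simple s * w → heckeGen M s • b w = b x + (q - qInv) • b w
  weakDescent : ∀ (s : B) (w : I), s ∈ weakDescents cs J (w : W) →
    heckeGen M s • b w = -(qInv • b w)
  weakAscent : ∃ r : B → I → I →₀ Polynomial ℤ,
    ∀ (s : B) (w : I), s ∈ weakAscents cs I J w →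
      (∀ y : I, (r s w y).coeff 0 = 0) ∧
      (∀ y ∈ (r s w).support, BruhatLT cs (y : W) (cs.simple s * w)) ∧
      heckeGen M s • b w =
        q • b w - (r s w).sum fun y f => Polynomial.toLaurent f • b y
  bar_bar : ∀ x : S, bar (bar x) = x
  bar_one : ∃ h : (1 : W) ∈ I, bar (b ⟨1, h⟩) = b ⟨1, h⟩
  bar_smul : ∀ (h : Hecke M) (x : S), bar (h • x) = barH M h • bar x

/-- `I` is a `W`-graph ideal with respect to `J`: it is an ideal of the left weak order, `J` is a
subset of `Pos(I)`, and there is a module over the Hecke algebra with the required basis and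
semilinear involution. -/
def IsWGraphIdeal : Prop :=
  (∀ u w : W, w ∈ I → WeakLE cs u w → u ∈ I) ∧ J ⊆ pos cs I ∧
  ∃ (S : Type u) (_ : AddCommGroup S) (_ : Module LaurentZ S) (_ : Module (Hecke M) S)
    (_ : IsScalarTower LaurentZ (Hecke M) S)
    (b : Module.Basis I LaurentZ S) (bar : S →ₛₗ[barA] S), IsIdealModule cs I J b bar

open Classical in
/-- The edge weights of the `W`-graph attached to a family of polynomials `p_{y,w}`
(written `p w y`): with `μ_{y,w}` the constant term of `p_{y,w}` for `y < w`, the weight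
`μ(y,w)` is `μ_{y,w}` if `y < w`, it is `μ_{w,y}` if `w < y`, and it is `0` otherwise. -/
noncomputable def edgeWeight (p : I → I →₀ Polynomial ℤ) (y w : I) : ℤ :=
  if BruhatLT cs (y : W) w then (p w y).coeff 0
  else if BruhatLT cs (w : W) y then (p y w).coeff 0
  else 0

end Ideals

/-! ## The induced module `ℋ ⊗_{ℋ_J} 𝒜_φ` -/

section Induced

variable (M : CoxeterMatrix B) (J : Set B)

/-- The algebra homomorphism `ℋ → 𝒜` with `T_s ↦ -q⁻¹` for all `s`. -/
noncomputable def signHom : Hecke M →ₐ[LaurentZ] LaurentZ :=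
  Hecke.lift M (fun _ => -qInv)
    (by
      intro i
      have h := q_mul_qInv
      simp only [Algebra.algebraMap_self, RingHom.id_apply]
      linear_combination h)
    (by intro i i'; simp)

/-- The Hecke algebra `ℋ_J` of `W_J`, as the subalgebra of `ℋ` generated by the `T_s`, `s ∈ J`. -/
noncomputable def HeckeJ : Subalgebra LaurentZ (Hecke M) :=
  Algebra.adjoin LaurentZ (heckeGen M '' J)

/-- The homomorphism `φ : ℋ_J → 𝒜` with `φ(T_u) = (-q)^{-l(u)}` for `u ∈ W_J`; it is the
restriction of `signHom` (compare `signHom_heckeT`). -/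
noncomputable def phi : HeckeJ M J →ₐ[LaurentZ] LaurentZ :=
  (signHom M).comp (HeckeJ M J).val

/-- The relations that make the tensor product `ℋ ⊗_𝒜 𝒜_φ` balanced over `ℋ_J`: the `ℋ`-submodule
generated by the elements `h k ⊗ a - h ⊗ φ(k) a` with `k ∈ ℋ_J`. -/
noncomputable def balancing : Submodule (Hecke M) (Hecke M ⊗[LaurentZ] LaurentZ) :=
  Submodule.span (Hecke M)
    {x | ∃ (h : Hecke M) (k : HeckeJ M J) (a : LaurentZ),
      x = (h * (k : Hecke M)) ⊗ₜ[LaurentZ] a - h ⊗ₜ[LaurentZ] (phi M J k * a)}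

/-- The induced module `S_φ = ℋ ⊗_{ℋ_J} 𝒜_φ`. -/
abbrev SPhi : Type u := (Hecke M ⊗[LaurentZ] LaurentZ) ⧸ balancing M J

/-- The pure tensor `h ⊗ a` in `S_φ`. -/
noncomputable def SPhi.tmul (h : Hecke M) (a : LaurentZ) : SPhi M J :=
  (balancing M J).mkQ (h ⊗ₜ[LaurentZ] a)

theorem signHom_heckeGen (i : B) : signHom M (heckeGen M i) = -qInv :=
  Hecke.lift_heckeGen M _ _ _ i

theorem signHom_heckeT (cs : CoxeterSystem M W) (w : W) :
    signHom M (heckeT cs w) * (-q) ^ cs.length w = 1 := by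
  have hl : cs.length w = (cs.exists_isReduced w).choose.length := by
    have h := (cs.exists_isReduced w).choose_spec
    rw [← h.1.eq, ← h.2]
  have h1 : signHom M (heckeT cs w) = (-qInv) ^ (cs.exists_isReduced w).choose.length := by
    rw [heckeT, map_list_prod, List.map_map]
    have : (⇑(signHom M) ∘ heckeGen M) = fun _ => -qInv :=
      funext fun i => signHom_heckeGen M i
    rw [this]
    simp
  rw [h1, hl, ← mul_pow, neg_mul_neg, mul_comm, q_mul_qInv, one_pow]

end Induced

/-! ## Deodhar's parabolic Kazhdan-Lusztig polynomials -/

section Deodhar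

variable {M : CoxeterMatrix B} (cs : CoxeterSystem M W) (J : Set B)

/-- Deodhar's parabolic `R`-polynomials `R^J_{y,w}` (`y, w ∈ D_J`) in the case of the parameter
`u`, where `u` is a root `-1` or `q` of `u² = q + (q - 1) u`. They are determined by `R_{w,w} = 1`,
by `R_{y,w} = 0` unless `y ≤ w`, and by the usual recursion for `y < w` and `s` with `sw < w`.
The indeterminate is the `q` of the traditional relation `T_s² = q + (q - 1) T_s`. -/
structure IsParabolicR (u : Polynomial ℤ)
    (R : minReps cs J → minReps cs J → Polynomial ℤ) : Prop where
  self : ∀ w, R w w = 1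
  zero : ∀ y w : minReps cs J, ¬ BruhatLE cs (y : W) w → R y w = 0
  /-- The case `sy < y`. -/
  desc : ∀ (s : B) (y w y' w' : minReps cs J), BruhatLT cs (y : W) w →
    (w' : W) = cs.simple s * w → cs.length (w' : W) < cs.length (w : W) →
    (y' : W) = cs.simple s * y → cs.length (y' : W) < cs.length (y : W) →
    R y w = R y' w'
  /-- The case `sy > y` and `sy ∈ D_J`. -/
  asc : ∀ (s : B) (y w y' w' : minReps cs J), BruhatLT cs (y : W) w →
    (w' : W) = cs.simple s * w → cs.length (w' : W) < cs.length (w : W) →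
    (y' : W) = cs.simple s * y → cs.length (y : W) < cs.length (y' : W) →
    R y w = (Polynomial.X - 1) * R y w' + Polynomial.X * R y' w'
  /-- The case `sy > y` and `sy ∉ D_J`. -/
  asc_not_mem : ∀ (s : B) (y w w' : minReps cs J), BruhatLT cs (y : W) w →
    (w' : W) = cs.simple s * w → cs.length (w' : W) < cs.length (w : W) →
    cs.simple s * (y : W) ∉ minReps cs J →
    R y w = (Polynomial.X - 1 - u) * R y w'

/-- `P` is the family of Deodhar's parabolic Kazhdan-Lusztig polynomials `P^J_{y,w}`
(`y, w ∈ D_J`) in the case of the parameter `u`: `P_{w,w} = 1`, `P_{y,w} = 0` unless `y ≤ w`,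
`deg P_{y,w} ≤ (l(w) - l(y) - 1) / 2` if `y < w`, and
`q^{l(w) - l(y)} P_{y,w}(q⁻¹) = ∑_{y ≤ z ≤ w} R_{y,z} P_{z,w}` if `y ≤ w`.
(Bruhat intervals are finite, so the sum is a finite one.) -/
def IsDeodharP (u : Polynomial ℤ) (P : minReps cs J → minReps cs J → Polynomial ℤ) : Prop :=
  (∀ w, P w w = 1) ∧
  (∀ y w : minReps cs J, ¬ BruhatLE cs (y : W) w → P y w = 0) ∧
  (∀ y w : minReps cs J, BruhatLT cs (y : W) w →
    2 * (P y w).natDegree + cs.length (y : W) + 1 ≤ cs.length (w : W)) ∧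
  ∃ R : minReps cs J → minReps cs J → Polynomial ℤ, IsParabolicR cs J u R ∧
    ∀ y w : minReps cs J, BruhatLE cs (y : W) w →
      LaurentPolynomial.T ((cs.length (w : W) : ℤ) - cs.length (y : W)) *
          barA (Polynomial.toLaurent (P y w)) =
        Polynomial.toLaurent
          (∑ᶠ (z : minReps cs J) (_ : BruhatLE cs (y : W) z ∧ BruhatLE cs (z : W) w),
            R y z * P z w)

/-- `P^*`: the Laurent polynomial obtained from `P` by replacing `q` by `q⁻²`. -/
noncomputable def starP (P : Polynomial ℤ) : LaurentZ :=
  Polynomial.aeval (LaurentPolynomial.T (-2) : LaurentZ) P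

end Deodhar

end HeckeWGraph

open HeckeWGraph

/-!
The proof is elementary and follows the construction of the Kazhdan-Lusztig basis.

*Coxeter groups.* The action of `W` on `W × ℤ/2` gives the strong exchange condition
(`mem_rightInvSeq`), and the geometric representation gives the exact order of `s_i s_j`
(`dvd_of_simple_mul_simple_pow`). From these come Matsumoto's theorem (`prod_map_eq_of_isReduced`),
the unique representatives of the cosets of `W_J` (`eq_of_mem_minReps`), Deodhar's lemma, that a
product `sw` outside `D_J` equals `wt` for some `t ∈ J` (`exists_simple_mul_eq`), and the lifting
property of the Bruhat order (`simple_mul_bruhatLE_or`).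

*The basis `b_w`.* The free module with basis `W` carries commuting left and right multiplications
by the generators, and so it is the regular representation. Its projection onto the free module with
basis `D_J`, which sends `d u` to `(-q)^{-l(u)} d`, has a kernel stable under the left
multiplications, so that the Hecke algebra acts on the free module with basis `D_J` (`inducedRep`).
Mapping `S_φ` to this model shows that the `b_w` are linearly independent. Deodhar's lemma gives the
formula for `T_s b_w`, hence that they span, and that the semilinear map with `b_w ↦ (bar T_w) b_1`
commutes with the bar involution of the Hecke algebra (`isIdealModule_inducedBasis`). There are no
weak ascents, since `I = D_J`.

*The basis `c_w`.* By the triangularity of the bar involution, a nonzero bar invariant vector has a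
nonzero bar invariant coordinate of maximal length, so that bar invariant vectors with coordinates
in `q ℤ[q]` vanish (`IsIdealModule.eq_zero_of_repr_mem_posPart`). This gives the uniqueness of
`c_w`, and its existence comes from `c_{sv} = (T_s - q) c_v + ∑ n_x c_x`, where `n_x` is the
coefficient of `q` in the coordinate of `c_v` at `x` and the sum is over the `x < v` with descent
`s` (`IsIdealModule.isCanonical_step`). The same formula is the `W`-graph relation for the `s` that
are not descents of `v`; the relation for descents holds because `(T_s + q⁻¹) c_v` is bar invariant
with coordinates of maximal length in `q ℤ[q]` (`IsIdealModule.gen_smul_of_mem_descents`). An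
induction on the length keeps track of the parity and of the degree: the coordinate of `c_w` at
`b_y` lies in `q^{l(w) - l(y)} ℤ[q⁻²]`.

*Deodhar's polynomials.* After normalization by `(-q)^{l(w) - l(y)}` the matrix of the bar
involution satisfies, in `q²`, the recursion of the polynomials `R`, and the coordinates of `c_w`
become polynomials in `q⁻²`, for which the bar invariance of `c_w` is the functional equation that
defines the polynomials `P` (`IsIdealModule.isDeodharP_of_repr_eq`). The uniqueness of the `R`
follows from their recursion, and that of the `P` from the bound on the degree (`IsDeodharP.eq`).
-/

namespace HeckeWGraph

open CoxeterSystem TensorProduct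

universe u v

variable {B : Type u} {W : Type v} [Group W]

/-! ### The geometric representation and the order of a product of two simple reflections -/

/-- The linear form `2 ⟨e_i, ·⟩` of the geometric representation on `ℝ^(B)`, with
`2 ⟨e_i, e_j⟩ = -2 cos (π / m(i,j))`. For `m(i,j) = ∞`, encoded as `0`, division by zero gives the
correct value `-2`. -/
noncomputable def geomForm (M : CoxeterMatrix B) (i : B) : Module.Dual ℝ (B →₀ ℝ) :=
  Finsupp.linearCombination ℝ fun j => -2 * Real.cos (Real.pi / M i j)

theorem geomForm_single (M : CoxeterMatrix B) (i j : B) :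
    geomForm M i (Finsupp.single j 1) = -2 * Real.cos (Real.pi / M i j) := by
  simp [geomForm]

theorem geomForm_self (M : CoxeterMatrix B) (i : B) :
    geomForm M i (Finsupp.single i 1) = 2 := by
  simp [geomForm_single]

/-- The reflection `v ↦ v - 2 ⟨e_i, v⟩ e_i` of the geometric representation. -/
noncomputable def geomReflection (M : CoxeterMatrix B) (i : B) : (B →₀ ℝ) ≃ₗ[ℝ] (B →₀ ℝ) :=
  Module.reflection (geomForm_self M i)

/-- Mathlib expresses the powers of a product of two reflections by the Chebyshev polynomials `S`
in the parameter `t = 2⟨e_i, e_j⟩ 2⟨e_j, e_i⟩ - 2`. Here `t = 2 cos (2π / m(i,j))`, so that the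
values of `S` are quotients of sines. -/
theorem chebyshev_param (M : CoxeterMatrix B) (i j : B) :
    2 * Real.cos (2 * (Real.pi / M i j)) =
      geomForm M i (Finsupp.single j 1) * geomForm M j (Finsupp.single i 1) - 2 := by
  rw [geomForm_single, geomForm_single, M.symmetric j i, Real.cos_two_mul]; ring

theorem sin_two_mul_pi_div_ne_zero {m : ℕ} (hm : 3 ≤ m) :
    Real.sin (2 * (Real.pi / m)) ≠ 0 := by
  have hm' : (3 : ℝ) ≤ m := by exact_mod_cast hm
  apply ne_of_gt
  apply Real.sin_pos_of_pos_of_lt_pi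
  · have := Real.pi_pos; positivity
  · rw [← mul_div_assoc, div_lt_iff₀ (by linarith)]
    nlinarith [Real.pi_pos]

theorem geomReflection_pow (M : CoxeterMatrix B) (i j : B) :
    (geomReflection M i * geomReflection M j) ^ M i j = 1 := by
  by_cases hij : i = j
  · subst hij
    rw [M.diagonal, pow_one]
    exact LinearEquiv.ext (Module.involutive_reflection (geomForm_self M i))
  have h1 : M i j ≠ 1 := M.off_diagonal i j hij
  rcases Nat.lt_or_ge (M i j) 3 with h3 | h3
  · interval_cases h : M i j
    · simp
    · exact absurd rfl h1
    · apply LinearEquiv.ext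
      intro z
      have key := Module.reflection_mul_reflection_pow_apply (geomForm_self M i)
        (geomForm_self M j) 2 z
      have e1 : geomForm M i (Finsupp.single j 1) = 0 := by simp [geomForm_single, h]
      have e2 : geomForm M j (Finsupp.single i 1) = 0 := by
        simp [geomForm_single, M.symmetric j i, h]
      refine key.trans ?_
      norm_num [e1, e2]
      module
  · apply LinearEquiv.ext
    intro z
    have hs := sin_two_mul_pi_div_ne_zero h3
    refine (Module.reflection_mul_reflection_pow_apply (geomForm_self M i)
        (geomForm_self M j) (M i j) z _ (chebyshev_param M i j)).trans ?_
    set m := M i j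
    set θ := Real.pi / m with hθ
    have hmθ : m * θ = Real.pi := by
      rw [hθ]; field_simp
    have S (k : ℤ) := Polynomial.Chebyshev.S_two_mul_real_cos (2 * θ) k
    rcases Nat.even_or_odd' m with ⟨p, hp | hp⟩
    · have a1 : ((m : ℤ) - 2) / 2 = p - 1 := by omega
      have a2 : ((m : ℤ) - 1) / 2 = p - 1 := by omega
      have z0 : (Polynomial.Chebyshev.S ℝ (p - 1)).eval (2 * Real.cos (2 * θ)) = 0 := by
        have := S (p - 1)
        have e : (((p : ℤ) - 1 : ℤ) + 1 : ℝ) * (2 * θ) = Real.pi := by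
          rw [← hmθ, hp]; push_cast; ring
        rw [e, Real.sin_pi] at this
        exact (mul_eq_zero.1 this).resolve_right hs
      rw [a1, a2, z0]; simp
    · have a1 : ((m : ℤ) - 2) / 2 = p - 1 := by omega
      have a2 : ((m : ℤ) - 1) / 2 = p := by omega
      have a3 : ((m : ℤ) - 3) / 2 = p - 1 := by omega
      have a4 : (m : ℤ) / 2 = p := by omega
      have z0 : (Polynomial.Chebyshev.S ℝ p).eval (2 * Real.cos (2 * θ)) +
          (Polynomial.Chebyshev.S ℝ (p - 1)).eval (2 * Real.cos (2 * θ)) = 0 := by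
        have e1 := S p
        have e2 := S (p - 1)
        have f1 : (((p : ℤ) : ℝ) + 1) * (2 * θ) = Real.pi + θ := by
          rw [← hmθ, hp]; push_cast; ring
        have f2 : (((p : ℤ) - 1 : ℤ) + 1 : ℝ) * (2 * θ) = Real.pi - θ := by
          rw [← hmθ, hp]; push_cast; ring
        rw [f1] at e1
        rw [f2, Real.sin_pi_sub] at e2
        rw [add_comm Real.pi, Real.sin_add_pi] at e1
        refine mul_right_cancel₀ hs ?_
        rw [add_mul, e1, e2]; ring
      rw [a1, a2, a3, a4, z0]; simp

/-- The coordinates of `(s_i s_j)^n e_i` show that `2πn / m(i,j)` is a multiple of `2π` if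
`(s_i s_j)^n = 1`. For `m(i,j) = ∞` the parameter of the Chebyshev polynomials is `2`, where
`S_{n-1}` takes the value `n`. -/
theorem dvd_of_geomReflection_pow (M : CoxeterMatrix B) (i j : B) (n : ℕ)
    (h : (geomReflection M i * geomReflection M j) ^ n = 1) : M i j ∣ n := by
  by_cases hij : i = j
  · subst hij; simp
  have h1 : M i j ≠ 1 := M.off_diagonal i j hij
  have key := Module.reflection_mul_reflection_pow_apply_self (geomForm_self M i)
    (geomForm_self M j) n _ (chebyshev_param M i j)
  have h' : ((Module.reflection (geomForm_self M i) * Module.reflection (geomForm_self M j)) ^ n)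
      (Finsupp.single i 1) = Finsupp.single i 1 := by
    have := LinearEquiv.congr_fun h (Finsupp.single i 1)
    exact this
  rw [h'] at key
  have ki := DFunLike.congr_fun key i
  have kj := DFunLike.congr_fun key j
  have sij : (Finsupp.single i (1 : ℝ)) j = 0 := Finsupp.single_eq_of_ne (Ne.symm hij)
  have sji : (Finsupp.single j (1 : ℝ)) i = 0 := Finsupp.single_eq_of_ne hij
  simp only [Finsupp.add_apply, Finsupp.smul_apply, Finsupp.single_eq_same, sij, sji,
    smul_eq_mul, mul_one, mul_zero, zero_add, add_zero,
    geomForm_single, M.symmetric j i] at ki kj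
  rcases Nat.lt_or_ge (M i j) 3 with h3 | h3
  · interval_cases hm : M i j
    · simp [Polynomial.Chebyshev.S_eval_two] at kj
      simp [kj]
    · exact absurd rfl h1
    · have e : 2 * Real.cos (2 * (Real.pi / (2 : ℕ))) = -2 := by
        rw [show 2 * (Real.pi / (2 : ℕ)) = Real.pi by push_cast; ring]; simp
      rw [e, Polynomial.Chebyshev.S_eval_neg_two, Polynomial.Chebyshev.S_eval_neg_two,
        Int.negOnePow_sub] at ki
      rcases Nat.even_or_odd n with hn | hn
      · exact hn.two_dvd
      · rw [Int.negOnePow_odd n (by exact_mod_cast hn)] at ki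
        norm_num at ki
  · have hs := sin_two_mul_pi_div_ne_zero h3
    set m := M i j
    set θ := Real.pi / m with hθ
    have hm0 : (m : ℝ) ≠ 0 := by positivity
    have hc : Real.cos θ ≠ 0 := by
      intro h0
      apply hs
      rw [Real.sin_two_mul, h0, mul_zero]
    have z1 : (Polynomial.Chebyshev.S ℝ (n - 1)).eval (2 * Real.cos (2 * θ)) = 0 := by
      rcases mul_eq_zero.1 kj.symm with h0 | h0
      · exact h0
      · exact absurd (by linarith) hc
    rw [z1, add_zero] at ki
    have e1 := Polynomial.Chebyshev.S_two_mul_real_cos (2 * θ) n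
    have e2 := Polynomial.Chebyshev.S_two_mul_real_cos (2 * θ) (n - 1)
    rw [z1, zero_mul] at e2
    rw [← ki, one_mul] at e1
    push_cast at e1 e2
    rw [sub_add_cancel] at e2
    rw [add_mul, one_mul, Real.sin_add, ← e2, zero_mul, zero_add] at e1
    have e3 : Real.cos (n * (2 * θ)) = 1 :=
      mul_right_cancel₀ hs (by rw [← e1, one_mul])
    obtain ⟨k, hk⟩ := (Real.cos_eq_one_iff _).1 e3
    have : (n : ℝ) = k * m := by
      have hp := Real.pi_ne_zero
      rw [hθ] at hk
      field_simp at hk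
      linarith
    have h' : (n : ℤ) = k * m := by exact_mod_cast this
    exact Int.natCast_dvd_natCast.1 ⟨k, by rw [h', mul_comm]⟩

/-- The order of `s_i s_j` is exactly `m(i,j)`: it is so in the geometric representation. -/
theorem dvd_of_simple_mul_simple_pow {M : CoxeterMatrix B} (cs : CoxeterSystem M W) (i j : B)
    (n : ℕ) (h : (cs.simple i * cs.simple j) ^ n = 1) : M i j ∣ n := by
  have hl : M.IsLiftable (geomReflection M) := geomReflection_pow M
  have := congrArg (cs.lift ⟨_, hl⟩) h
  rw [map_pow, map_mul, cs.lift_apply_simple hl, cs.lift_apply_simple hl, map_one] at this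
  exact dvd_of_geomReflection_pow M i j n this

/-! ### The strong exchange condition -/

section Exchange

variable {M : CoxeterMatrix B} (cs : CoxeterSystem M W)

open Classical in
/-- The permutation `(t, ε) ↦ (s t s, ε + [t = s])` of `W × ℤ/2`. -/
noncomputable def signedConj (i : B) : Equiv.Perm (W × ZMod 2) :=
  Function.Involutive.toPerm
    (fun x => (cs.simple i * x.1 * cs.simple i, x.2 + if x.1 = cs.simple i then 1 else 0)) (by
      intro x
      have h : cs.simple i * x.1 * cs.simple i = cs.simple i ↔ x.1 = cs.simple i := by
        rw [mul_assoc, mul_eq_left, ← eq_inv_iff_mul_eq_one, cs.inv_simple]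
      refine Prod.ext (by simp [mul_assoc]) ?_
      simp only [if_congr h rfl rfl, add_assoc, CharTwo.add_self_eq_zero, add_zero])

open Classical in
theorem signedConj_apply (i : B) (x : W × ZMod 2) :
    signedConj cs i x =
      (cs.simple i * x.1 * cs.simple i, x.2 + if x.1 = cs.simple i then 1 else 0) := rfl

open Classical in
theorem signedConj_prod_apply (ω : List B) (x : W × ZMod 2) :
    (ω.map (signedConj cs)).prod x =
      (cs.wordProd ω * x.1 * (cs.wordProd ω)⁻¹,
        x.2 + ((cs.rightInvSeq ω).count x.1 : ZMod 2)) := by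
  induction ω generalizing x with
  | nil => simp
  | cons i ω ih =>
    rw [List.map_cons, List.prod_cons, Equiv.Perm.mul_apply, ih]
    have h : cs.wordProd ω * x.1 * (cs.wordProd ω)⁻¹ = cs.simple i ↔
        (cs.wordProd ω)⁻¹ * cs.simple i * cs.wordProd ω = x.1 := by
      constructor
      · intro h; rw [← h]; group
      · intro h; rw [← h]; group
    simp only [signedConj_apply, rightInvSeq, cs.wordProd_cons, mul_inv_rev,
      cs.inv_simple, List.count_cons, beq_iff_eq, if_congr h rfl rfl]
    refine Prod.ext (by simp [mul_assoc]) ?_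
    push_cast
    split_ifs <;> simp [add_assoc]

open Classical in
/-- The permutations `signedConj cs i` satisfy the relations of the Coxeter group, so that they
define an action of `W` on `W × ℤ/2`. -/
theorem signedConj_isLiftable : M.IsLiftable (signedConj cs) := by
  intro i j
  set m := M i j
  have hprod : ∀ k : ℕ, ((alternatingWord i j (2 * k)).map (signedConj cs)).prod =
      (signedConj cs i * signedConj cs j) ^ k := by
    intro k
    induction k with
    | zero => simp [alternatingWord]
    | succ k ih =>
      rw [show 2 * (k + 1) = 2 * k + 1 + 1 by ring, alternatingWord_succ, alternatingWord_succ]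
      simp [ih, pow_succ]
  rw [← hprod]
  have hw : cs.wordProd (alternatingWord i j (2 * m)) = 1 := by
    rw [cs.prod_alternatingWord_eq_mul_pow]
    simp [m]
  apply Equiv.ext
  intro x
  rw [signedConj_prod_apply, hw]
  suffices h : (((cs.rightInvSeq (alternatingWord i j (2 * m))).count x.1 : ℕ) : ZMod 2) = 0 by
    rw [h]; simp
  -- The inversion sequence of `(s_i s_j)^m` runs twice through the same `m` reflections.
  have hrev : alternatingWord i j (2 * m) = (alternatingWord j i (2 * m)).reverse := by
    rw [reverse_alternatingWord, if_pos (even_two_mul m)]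
  rw [hrev, rightInvSeq_reverse, List.count_reverse]
  have hl : cs.leftInvSeq (alternatingWord j i (2 * m)) =
      (List.range m).map (fun k => cs.wordProd (alternatingWord i j (2 * k + 1))) ++
      (List.range m).map (fun k => cs.wordProd (alternatingWord i j (2 * k + 1))) := by
    apply List.ext_getElem
    · simp; ring
    · intro n h1 h2
      have hn : n < 2 * m := by simpa using h1
      rw [getElem_leftInvSeq_alternatingWord _ _ _ _ _ hn]
      by_cases hnm : n < m
      · rw [List.getElem_append_left (by simpa using hnm)]; simp
      · rw [List.getElem_append_right (by simpa using hnm)]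
        simp only [List.length_map, List.length_range, List.getElem_map, List.getElem_range]
        have h3 : (2 * n + 1) / 2 = m + (2 * (n - m) + 1) / 2 := by omega
        rw [cs.prod_alternatingWord_eq_mul_pow, cs.prod_alternatingWord_eq_mul_pow, h3, pow_add,
          cs.simple_mul_simple_pow, one_mul]
        simp
  rw [hl, List.count_append]
  push_cast
  exact CharTwo.add_self_eq_zero _

open Classical in
theorem lift_signedConj_wordProd (ω : List B) (x : W × ZMod 2) :
    cs.lift ⟨_, signedConj_isLiftable cs⟩ (cs.wordProd ω) x =
      (cs.wordProd ω * x.1 * (cs.wordProd ω)⁻¹,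
        x.2 + ((cs.rightInvSeq ω).count x.1 : ZMod 2)) := by
  rw [← signedConj_prod_apply, wordProd, map_list_prod, List.map_map]
  congr 3
  funext i
  exact cs.lift_apply_simple (signedConj_isLiftable cs) i

/-- The number of times, modulo `2`, that `t` occurs in the right inversion sequence of any word
for `w`. -/
noncomputable def inversionParity (w t : W) : ZMod 2 :=
  (cs.lift ⟨_, signedConj_isLiftable cs⟩ w (t, 0)).2

open Classical in
theorem inversionParity_wordProd (ω : List B) (t : W) :
    inversionParity cs (cs.wordProd ω) t = ((cs.rightInvSeq ω).count t : ZMod 2) := by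
  rw [inversionParity, lift_signedConj_wordProd]; simp

theorem lift_signedConj_apply (w : W) (x : W × ZMod 2) :
    cs.lift ⟨_, signedConj_isLiftable cs⟩ w x =
      (w * x.1 * w⁻¹, x.2 + inversionParity cs w x.1) := by
  classical
  obtain ⟨ω, rfl⟩ := cs.wordProd_surjective w
  rw [lift_signedConj_wordProd, inversionParity_wordProd]

theorem inversionParity_mul (w w' t : W) :
    inversionParity cs (w * w') t =
      inversionParity cs w' t + inversionParity cs w (w' * t * w'⁻¹) := by
  have h := lift_signedConj_apply cs (w * w') (t, 0)
  rw [map_mul, Equiv.Perm.mul_apply, lift_signedConj_apply cs w', lift_signedConj_apply cs w] at h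
  simpa using (congrArg Prod.snd h).symm

theorem inversionParity_simple (i : B) : inversionParity cs (cs.simple i) (cs.simple i) = 1 := by
  classical
  rw [← cs.wordProd_singleton, inversionParity_wordProd]
  simp

theorem inversionParity_one (t : W) : inversionParity cs 1 t = 0 := by
  simp [inversionParity]

theorem inversionParity_self {t : W} (ht : cs.IsReflection t) : inversionParity cs t t = 1 := by
  obtain ⟨w, i, rfl⟩ := ht
  have h2 (a : ZMod 2) : a + a = 0 := CharTwo.add_self_eq_zero a
  have h0 := inversionParity_mul cs w w⁻¹ (w * cs.simple i * w⁻¹)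
  rw [mul_inv_cancel, inversionParity_one] at h0
  have e : w⁻¹ * (w * cs.simple i * w⁻¹) * w⁻¹⁻¹ = cs.simple i := by group
  rw [inversionParity_mul cs (w * cs.simple i), inversionParity_mul cs w, e, mul_inv_cancel_right,
    inversionParity_simple]
  rw [e] at h0
  linear_combination -h0

theorem isRightInversion_of_inversionParity {w t : W} (h : inversionParity cs w t ≠ 0) :
    cs.IsRightInversion w t := by
  classical
  obtain ⟨ω, hω, rfl⟩ := cs.exists_isReduced w
  rw [inversionParity_wordProd] at h
  apply cs.isRightInversion_of_mem_rightInvSeq hω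
  by_contra h'
  rw [List.count_eq_zero_of_not_mem h'] at h
  simp at h

/-- If the parity were even for `w`, it would be odd for `w t`, and then `t` would be a right
inversion of `w t` as well as of `w`. -/
theorem inversionParity_ne_zero {w t : W} (h : cs.IsRightInversion w t) :
    inversionParity cs w t ≠ 0 := by
  intro h0
  have h1 := inversionParity_mul cs w t t
  rw [inversionParity_self cs h.1, mul_inv_cancel_right, h0, add_zero] at h1
  have h2 := (isRightInversion_of_inversionParity cs (w := w * t) (t := t) (by rw [h1]; simp)).2
  rw [mul_assoc, h.1.mul_self, mul_one] at h2
  exact absurd h.2 (by omega)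

/-- The strong exchange condition: for any word `ω`, reduced or not, a right inversion of its
product occurs in its right inversion sequence. -/
theorem mem_rightInvSeq {ω : List B} {t : W} (h : cs.IsRightInversion (cs.wordProd ω) t) :
    t ∈ cs.rightInvSeq ω := by
  classical
  have := inversionParity_ne_zero cs h
  rw [inversionParity_wordProd] at this
  by_contra h'
  rw [List.count_eq_zero_of_not_mem h'] at this
  simp at this

/-- The strong exchange condition in terms of words: multiplication by a right inversion deletes
a letter. -/
theorem exists_eraseIdx {ω : List B} {t : W} (h : cs.IsRightInversion (cs.wordProd ω) t) :
    ∃ j < ω.length, cs.wordProd ω * t = cs.wordProd (ω.eraseIdx j) := by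
  obtain ⟨j, hj, rfl⟩ := List.mem_iff_getElem.mp (mem_rightInvSeq cs h)
  refine ⟨j, by simpa using hj, ?_⟩
  rw [← List.getD_eq_getElem _ 1 hj, wordProd_mul_getD_rightInvSeq]

theorem rightInvSeq_append (ω ω' : List B) :
    cs.rightInvSeq (ω ++ ω') =
      (cs.rightInvSeq ω).map (fun t => (cs.wordProd ω')⁻¹ * t * cs.wordProd ω') ++
        cs.rightInvSeq ω' := by
  induction ω with
  | nil => simp
  | cons i ω ih =>
    simp [rightInvSeq, ih, cs.wordProd_append, mul_assoc]

/-- If `sw > w` and `wt > w` but `swt < sw`, then `sw = wt`. -/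
theorem simple_mul_eq_mul_simple {w : W} {i j : B}
    (h1 : cs.length w < cs.length (w * cs.simple j))
    (h2 : cs.length (cs.simple i * w * cs.simple j) < cs.length (cs.simple i * w)) :
    cs.simple i * w = w * cs.simple j := by
  obtain ⟨ω, hω, rfl⟩ := cs.exists_isReduced w
  have h := mem_rightInvSeq cs (ω := i :: ω) (t := cs.simple j)
    ⟨cs.isReflection_simple j, by rwa [cs.wordProd_cons]⟩
  rw [rightInvSeq, List.mem_cons] at h
  rcases h with h | h
  · rw [h]; group
  · exact absurd (cs.isRightInversion_of_mem_rightInvSeq hω h).2 (by omega)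

end Exchange

/-! ### Alternating words and Matsumoto's theorem -/

section Matsumoto

variable {M : CoxeterMatrix B} (cs : CoxeterSystem M W)

theorem isReduced_alternatingWord (i j : B) {k : ℕ} (hk : M i j = 0 ∨ k ≤ M i j) :
    cs.IsReduced (alternatingWord i j k) := by
  induction k generalizing i j with
  | zero => simp [alternatingWord, CoxeterSystem.IsReduced]
  | succ k ih =>
    have hr : cs.IsReduced (alternatingWord j i k) := by
      apply ih; rw [M.symmetric j i]; omega
    rw [alternatingWord_succ, List.concat_eq_append, CoxeterSystem.IsReduced, cs.wordProd_append,
      cs.wordProd_singleton, List.length_append, List.length_singleton]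
    rcases cs.length_mul_simple (cs.wordProd (alternatingWord j i k)) j with h | h
    · rw [h, hr.eq]
    exfalso
    -- A failure makes `s_j` one of the reflections `s_i (s_j s_i)^r`, `r < k`, of the inversion
    -- sequence, and so the order of `s_j s_i` is at most `k`.
    have hmem := mem_rightInvSeq cs (ω := alternatingWord j i k) (t := cs.simple j)
      ⟨cs.isReflection_simple j, by omega⟩
    have hform : ∀ (i j : B) (k : ℕ) (t : W), t ∈ cs.rightInvSeq (alternatingWord j i k) →
        ∃ r < k, t = cs.simple i * (cs.simple j * cs.simple i) ^ r := by
      intro i j k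
      induction k generalizing i j with
      | zero => simp [alternatingWord]
      | succ k ih =>
        intro t ht
        rw [alternatingWord_succ, rightInvSeq_concat, List.concat_eq_append, List.mem_append] at ht
        rcases ht with ht | ht
        · obtain ⟨t', ht', rfl⟩ := List.mem_map.1 ht
          obtain ⟨r, hr, rfl⟩ := ih j i t' ht'
          refine ⟨r + 1, by omega, ?_⟩
          have hc : ∀ r : ℕ, cs.simple i * (cs.simple j * (cs.simple i * cs.simple j) ^ r) *
              cs.simple i = cs.simple i * (cs.simple j * cs.simple i) ^ (r + 1) := by
            intro r
            have hs : SemiconjBy (cs.simple i) (cs.simple j * cs.simple i)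
              (cs.simple i * cs.simple j) := (mul_assoc _ _ _).symm
            rw [(hs.pow_right (r + 1)).eq, pow_succ']
            simp only [mul_assoc]
          rw [MulAut.conj_apply, cs.inv_simple, hc]
        · exact ⟨0, by omega, by simpa using ht⟩
    obtain ⟨r, hrk, hr'⟩ := hform i j k _ hmem
    have h1 : (cs.simple j * cs.simple i) ^ (r + 1) = 1 := by
      rw [pow_succ', mul_assoc, ← hr']; simp
    have hd := Nat.le_of_dvd (by omega) (dvd_of_simple_mul_simple_pow cs j i _ h1)
    have hz := dvd_of_simple_mul_simple_pow cs j i _ h1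
    rw [M.symmetric j i] at hd hz
    rcases hk with hk | hk
    · rw [hk] at hz; simp at hz
    · omega

theorem wordProd_append_singleton_lt {ω : List B} {i : B} (h : cs.IsReduced (ω ++ [i])) :
    cs.length (cs.wordProd (ω ++ [i]) * cs.simple i) < cs.length (cs.wordProd (ω ++ [i])) := by
  rw [h.eq, cs.wordProd_append, cs.wordProd_singleton, cs.simple_mul_simple_cancel_right]
  have := cs.length_wordProd_le ω
  simp; omega

theorem isReduced_of_append_left {ω ω' : List B} (h : cs.IsReduced (ω ++ ω')) :
    cs.IsReduced ω := by
  simpa using CoxeterSystem.IsReduced.take h ω.length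

theorem isReduced_of_append_right {ω ω' : List B} (h : cs.IsReduced (ω ++ ω')) :
    cs.IsReduced ω' := by
  simpa using CoxeterSystem.IsReduced.drop h ω.length

/-- Matsumoto's theorem: a map from the simple reflections to a monoid that satisfies the braid
relations has the same product along any two reduced words of the same element. -/
theorem prod_map_eq_of_isReduced {G : Type*} [Monoid G] (f : B → G)
    (hf : ∀ i j, ((alternatingWord i j (M i j)).map f).prod =
      ((alternatingWord j i (M i j)).map f).prod)
    {ω ω' : List B} (hω : cs.IsReduced ω) (hω' : cs.IsReduced ω')
    (h : cs.wordProd ω = cs.wordProd ω') : (ω.map f).prod = (ω'.map f).prod := by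
  obtain ⟨n, hn⟩ : ∃ n, ω.length = n := ⟨_, rfl⟩
  induction n generalizing ω ω' with
  | zero =>
    have h2 : ω'.length = 0 := by rw [← hω'.eq, ← h, hω.eq, hn]
    rw [List.length_eq_zero_iff.1 hn, List.length_eq_zero_iff.1 h2]
  | succ n ih =>
    have hlen : ∀ {α β : List B}, cs.IsReduced α → cs.IsReduced β →
        cs.wordProd α = cs.wordProd β → α.length = β.length := by
      intro α β ha hb hab
      rw [← ha.eq, ← hb.eq, hab]
    -- Two words that share their last, or their first, letter are covered by the induction.
    have last : ∀ {α β : List B} {i : B}, cs.IsReduced (α ++ [i]) → cs.IsReduced (β ++ [i]) →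
        cs.wordProd (α ++ [i]) = cs.wordProd (β ++ [i]) → (α ++ [i]).length = n + 1 →
        ((α ++ [i]).map f).prod = ((β ++ [i]).map f).prod := by
      intro α β i ha hb hab hl
      rw [List.map_append, List.map_append, List.prod_append, List.prod_append,
        ih (isReduced_of_append_left cs ha) (isReduced_of_append_left cs hb) _ (by simpa using hl)]
      simpa [cs.wordProd_append] using hab
    have first : ∀ {α β : List B} {i : B}, cs.IsReduced (i :: α) → cs.IsReduced (i :: β) →
        cs.wordProd (i :: α) = cs.wordProd (i :: β) → (i :: α).length = n + 1 →
        ((i :: α).map f).prod = ((i :: β).map f).prod := by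
      intro α β i ha hb hab hl
      rw [List.map_cons, List.map_cons, List.prod_cons, List.prod_cons,
        ih (isReduced_of_append_right cs (ω := [i]) ha)
          (isReduced_of_append_right cs (ω := [i]) hb) _ (by simpa using hl)]
      simpa [cs.wordProd_cons] using hab
    -- If the products along `α`, and along a word that ends in `i`, differ, then exchanging the
    -- last letter `i` into `α` has to delete the first letter of `α`.
    have step : ∀ {α β : List B} {i : B}, cs.IsReduced α → cs.IsReduced (β ++ [i]) →
        cs.wordProd α = cs.wordProd (β ++ [i]) → α.length = n + 1 →
        (α.map f).prod ≠ ((β ++ [i]).map f).prod →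
        cs.IsReduced (α.tail ++ [i]) ∧ cs.wordProd (α.tail ++ [i]) = cs.wordProd α ∧
        ((α.tail ++ [i]).map f).prod ≠ (α.map f).prod := by
      intro α β i ha hb hab hl hne
      obtain ⟨e, he, hprod⟩ := exists_eraseIdx cs (ω := α) (t := cs.simple i)
        ⟨cs.isReflection_simple i, by rw [hab]; exact wordProd_append_singleton_lt cs hb⟩
      have hp : cs.wordProd (α.eraseIdx e ++ [i]) = cs.wordProd α := by
        rw [cs.wordProd_append, ← hprod]; simp
      have hred : cs.IsReduced (α.eraseIdx e ++ [i]) := by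
        rw [CoxeterSystem.IsReduced, hp, ha.eq]
        simp [← List.length_eraseIdx_add_one he]
      have h1 : ((α.eraseIdx e ++ [i]).map f).prod = ((β ++ [i]).map f).prod :=
        last hred hb (hp.trans hab) (by rw [hlen hred ha hp, hl])
      rcases α with _ | ⟨a, α⟩
      · simp at hl
      rcases e with _ | e
      · simp only [List.eraseIdx_zero] at hred hp h1
        exact ⟨hred, hp, by rw [h1]; exact hne.symm⟩
      · exfalso
        apply hne
        rw [← h1]
        exact first ha hred hp.symm hl
    by_contra hne
    rcases ω.eq_nil_or_concat with rfl | ⟨α, j, rfl⟩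
    · simp at hn
    rcases ω'.eq_nil_or_concat with rfl | ⟨β, i, rfl⟩
    · have := hlen hω hω' h
      simp at this
    simp only [List.concat_eq_append] at hω hω' h hn hne
    -- Repeating the exchange produces words that end in longer and longer alternating words.
    have main : ∀ k ≤ n, ∃ (i j : B) (x y : List B),
        cs.IsReduced (x ++ alternatingWord i j (k + 1)) ∧
        cs.IsReduced (y ++ [i]) ∧
        cs.wordProd (x ++ alternatingWord i j (k + 1)) = cs.wordProd (y ++ [i]) ∧
        (x ++ alternatingWord i j (k + 1)).length = n + 1 ∧
        ((x ++ alternatingWord i j (k + 1)).map f).prod ≠ ((y ++ [i]).map f).prod := by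
      intro k
      induction k with
      | zero => exact fun _ => ⟨i, j, α, β, hω, hω', h, hn, hne⟩
      | succ k ihk =>
        intro hk
        obtain ⟨i, j, x, y, h1, h2, h3, h4, h5⟩ := ihk (by omega)
        obtain ⟨s1, s2, s3⟩ := step h1 h2 h3 h4 h5
        rcases x with _ | ⟨a, x⟩
        · simp at h4; omega
        have e1 : (a :: x ++ alternatingWord i j (k + 1)).tail ++ [i] =
            x ++ alternatingWord j i (k + 1 + 1) := by
          rw [alternatingWord_succ j i (k + 1)]; simp
        have e2 : a :: x ++ alternatingWord i j (k + 1) =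
            (a :: x ++ alternatingWord j i k) ++ [j] := by
          rw [alternatingWord_succ i j k]; simp
        rw [e1] at s1 s2 s3
        refine ⟨j, i, x, a :: x ++ alternatingWord j i k, s1, ?_, ?_, ?_, ?_⟩
        · rw [← e2]; exact h1
        · rw [← e2]; exact s2
        · simp at h4 ⊢; omega
        · rw [← e2]; exact s3
    obtain ⟨i, j, x, y, h1, h2, h3, h4, h5⟩ := main n le_rfl
    obtain ⟨s1, s2, s3⟩ := step h1 h2 h3 h4 h5
    have hx : x = [] := by
      simpa using h4
    subst hx
    rw [List.nil_append] at h1 s1 s2 s3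
    have e1 : (alternatingWord i j (n + 1)).tail ++ [i] = alternatingWord j i (n + 1) := by
      rw [alternatingWord_succ' i j, alternatingWord_succ j i]; simp
    rw [e1] at s1 s2 s3
    have hpow : (cs.simple i * cs.simple j) ^ (n + 1) = 1 := by
      rw [cs.prod_alternatingWord_eq_mul_pow, cs.prod_alternatingWord_eq_mul_pow] at s2
      have hinv : cs.simple j * cs.simple i = (cs.simple i * cs.simple j)⁻¹ := by simp
      rw [hinv, inv_pow] at s2
      rcases Nat.even_or_odd' (n + 1) with ⟨p, hp | hp⟩
      · rw [hp] at s2 ⊢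
        simp only [even_two, Even.mul_right, if_true, one_mul, Nat.mul_div_cancel_left,
          Nat.zero_lt_two] at s2
        rw [two_mul, pow_add]
        nth_rw 1 [← s2]
        simp
      · rw [hp] at s2 ⊢
        have hodd : ¬ Even (2 * p + 1) := by simp
        have hdiv : (2 * p + 1) / 2 = p := by omega
        rw [if_neg hodd, if_neg hodd, hdiv] at s2
        have s2' := congrArg (fun w => cs.simple j * w) s2
        simp only [cs.simple_mul_simple_cancel_left, ← mul_assoc] at s2'
        rw [hinv] at s2'
        rw [pow_succ, two_mul, pow_add]
        nth_rw 1 [← s2']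
        group
    have hd := dvd_of_simple_mul_simple_pow cs i j _ hpow
    have hle := Nat.le_of_dvd (by omega) hd
    have h0 : M i j ≠ 0 := by
      intro h0; rw [h0] at hd; simp at hd
    have hM : n + 1 = M i j := by
      by_contra hne'
      exact cs.not_isReduced_alternatingWord i j h0 (by omega) h1
    apply s3
    rw [hM]
    exact (hf i j).symm

end Matsumoto

/-! ### Distinguished coset representatives -/

section MinReps

variable {M : CoxeterMatrix B} (cs : CoxeterSystem M W) {J : Set B}

theorem one_mem_minReps : (1 : W) ∈ minReps cs J := by
  intro s _; simp

theorem exists_of_notMem_minReps {w : W} (h : w ∉ minReps cs J) :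
    ∃ t ∈ J, cs.length (w * cs.simple t) + 1 = cs.length w := by
  simp only [minReps, Set.mem_ofPred_eq, not_forall] at h
  obtain ⟨t, ht, h⟩ := h
  refine ⟨t, ht, ?_⟩
  have := cs.length_mul_simple w t
  omega

/-- The set `D_J` is stable under left descents. -/
theorem simple_mul_mem_minReps {w : W} (hw : w ∈ minReps cs J) {s : B}
    (h : cs.length (cs.simple s * w) < cs.length w) : cs.simple s * w ∈ minReps cs J := by
  intro t ht
  have h1 := hw t ht
  have h2 := cs.length_simple_mul (w * cs.simple t) s
  have h3 := cs.length_simple_mul w s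
  have h4 := cs.length_mul_simple (cs.simple s * w) t
  rw [mul_assoc] at h4 ⊢
  omega

/-- Deodhar's lemma: a left multiplication that leaves `D_J` is a right multiplication by an
element of `J`. -/
theorem exists_simple_mul_eq {w : W} (hw : w ∈ minReps cs J) {s : B}
    (h : cs.simple s * w ∉ minReps cs J) : ∃ t ∈ J, cs.simple s * w = w * cs.simple t := by
  obtain ⟨t, ht, h'⟩ := exists_of_notMem_minReps cs h
  exact ⟨t, ht, simple_mul_eq_mul_simple cs (hw t ht) (by omega)⟩

theorem length_lt_of_notMem_minReps {w : W} (hw : w ∈ minReps cs J) {s : B}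
    (h : cs.simple s * w ∉ minReps cs J) : cs.length w < cs.length (cs.simple s * w) := by
  by_contra h'
  have := cs.length_simple_mul_ne w s
  exact h (simple_mul_mem_minReps cs hw (by omega))

theorem mem_minReps_of_weakLE {u w : W} (hw : w ∈ minReps cs J) (h : WeakLE cs u w) :
    u ∈ minReps cs J := by
  have step : ∀ {u w : W}, w ∈ minReps cs J → (cs.length u ≤ cs.length w ∧
      ∃ s : W, ((∃ i, s = cs.simple i) ∨ s = 1) ∧ w = s * u) → u ∈ minReps cs J := by
    rintro u w hw ⟨hl, s, ⟨i, rfl⟩ | rfl, rfl⟩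
    · have h1 := cs.length_simple_mul_ne u i
      have h2 := simple_mul_mem_minReps cs hw (s := i)
      rw [cs.simple_mul_simple_cancel_left] at h2
      exact h2 (by omega)
    · simpa using hw
  induction h with
  | single h => exact step hw h
  | tail _ h ih => exact ih (step hw h)

/-- Every left coset of `W_J` contains an element of `D_J`. -/
theorem exists_mem_minReps (w : W) :
    ∃ d ∈ minReps cs J, d⁻¹ * w ∈ Subgroup.closure (cs.simple '' J) := by
  obtain ⟨n, hn⟩ : ∃ n, cs.length w = n := ⟨_, rfl⟩
  induction n using Nat.strong_induction_on generalizing w with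
  | _ n ih =>
    by_cases hw : w ∈ minReps cs J
    · exact ⟨w, hw, by simp⟩
    obtain ⟨t, ht, h⟩ := exists_of_notMem_minReps cs hw
    obtain ⟨d, hd, h'⟩ := ih _ (by omega) (w * cs.simple t) rfl
    refine ⟨d, hd, ?_⟩
    have := mul_mem h' (Subgroup.subset_closure (Set.mem_image_of_mem cs.simple ht))
    simpa [mul_assoc] using this

theorem wordProd_mem_closure {ω : List B} (hω : ∀ i ∈ ω, i ∈ J) :
    cs.wordProd ω ∈ Subgroup.closure (cs.simple '' J) := by
  induction ω with
  | nil => simp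
  | cons i ω ih =>
    rw [cs.wordProd_cons]
    exact mul_mem (Subgroup.subset_closure (Set.mem_image_of_mem _ (hω i (by simp))))
      (ih fun j hj => hω j (by simp [hj]))

theorem exists_word_of_mem_closure {u : W} (hu : u ∈ Subgroup.closure (cs.simple '' J)) :
    ∃ ω : List B, (∀ i ∈ ω, i ∈ J) ∧ cs.wordProd ω = u := by
  induction hu using Subgroup.closure_induction with
  | mem x hx =>
    obtain ⟨i, hi, rfl⟩ := hx
    exact ⟨[i], by simpa using hi, by simp⟩
  | one => exact ⟨[], by simp, by simp⟩
  | mul x y _ _ hx hy =>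
    obtain ⟨ω, h1, rfl⟩ := hx
    obtain ⟨ω', h2, rfl⟩ := hy
    exact ⟨ω ++ ω', by simpa [or_imp, forall_and] using ⟨h1, h2⟩, cs.wordProd_append _ _⟩
  | inv x _ hx =>
    obtain ⟨ω, h1, rfl⟩ := hx
    exact ⟨ω.reverse, by simpa using h1, cs.wordProd_reverse _⟩

/-- An element `d'` of `D_J` equals any element `d` of minimal length of its coset: in a shortest
word over `J` that leads from `d` to `d'`, the last letter could be exchanged, either into the word
or into `d`. -/
theorem eq_of_forall_length_le {d d' : W} (hd' : d' ∈ minReps cs J)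
    (h : d⁻¹ * d' ∈ Subgroup.closure (cs.simple '' J))
    (hmin : ∀ u ∈ Subgroup.closure (cs.simple '' J), cs.length d ≤ cs.length (d * u)) :
    d = d' := by
  classical
  have hex : ∃ n, ∃ ω : List B, (∀ i ∈ ω, i ∈ J) ∧ cs.wordProd ω = d⁻¹ * d' ∧ ω.length = n := by
    obtain ⟨ω, h1, h2⟩ := exists_word_of_mem_closure cs h
    exact ⟨_, ω, h1, h2, rfl⟩
  obtain ⟨ω, hJ, hω, hlen⟩ := Nat.find_spec hex
  have hshort : ∀ ω' : List B, (∀ i ∈ ω', i ∈ J) → cs.wordProd ω' = d⁻¹ * d' →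
      ω.length ≤ ω'.length := by
    intro ω' h1 h2
    rw [hlen]
    exact Nat.find_min' hex ⟨ω', h1, h2, rfl⟩
  rcases ω.eq_nil_or_concat with rfl | ⟨ω₁, t, rfl⟩
  · exact inv_mul_eq_one.1 (by simpa using hω.symm)
  exfalso
  rw [List.concat_eq_append] at *
  have hd'e : d' = d * cs.wordProd ω₁ * cs.simple t := by
    rw [cs.wordProd_append, cs.wordProd_singleton] at hω
    rw [mul_assoc, hω]; group
  have ht : t ∈ J := hJ t (by simp)
  have hJ₁ : ∀ i ∈ ω₁, i ∈ J := fun i hi => hJ i (by simp [hi])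
  obtain ⟨α, hα, rfl⟩ := cs.exists_isReduced d
  have hlt := hd' t ht
  rw [hd'e, cs.simple_mul_simple_cancel_right] at hlt
  have hmem := mem_rightInvSeq cs (ω := α ++ ω₁) (t := cs.simple t)
    ⟨cs.isReflection_simple t, by rwa [cs.wordProd_append]⟩
  rw [rightInvSeq_append, List.mem_append] at hmem
  rcases hmem with hmem | hmem
  · obtain ⟨r, hr, hrt⟩ := List.mem_map.1 hmem
    have hr' : r = cs.wordProd ω₁ * cs.simple t * (cs.wordProd ω₁)⁻¹ := by rw [← hrt]; group
    have hrJ : r ∈ Subgroup.closure (cs.simple '' J) := by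
      rw [hr']
      have := wordProd_mem_closure cs hJ₁
      exact mul_mem (mul_mem this (Subgroup.subset_closure (Set.mem_image_of_mem _ ht)))
        (inv_mem this)
    exact absurd (cs.isRightInversion_of_mem_rightInvSeq hα hr).2 (hmin r hrJ).not_gt
  · obtain ⟨j, hj, hjt⟩ := List.mem_iff_getElem.mp hmem
    have h1 : cs.wordProd (ω₁.eraseIdx j) = (cs.wordProd α)⁻¹ * d' := by
      rw [← wordProd_mul_getD_rightInvSeq, List.getD_eq_getElem _ 1 hj, hjt, hd'e]; group
    have h2 := hshort _ (fun i hi => hJ₁ i (List.mem_of_mem_eraseIdx hi)) h1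
    have h3 : j < ω₁.length := by simpa using hj
    have h4 := List.length_eraseIdx_add_one h3
    simp at h2
    omega

/-- Every left coset of `W_J` contains at most one element of `D_J`. -/
theorem eq_of_mem_minReps {d d' : W} (hd : d ∈ minReps cs J) (hd' : d' ∈ minReps cs J)
    (h : d⁻¹ * d' ∈ Subgroup.closure (cs.simple '' J)) : d = d' := by
  set H := Subgroup.closure (cs.simple '' J)
  let u₀ : H := Function.argmin fun u : H => cs.length (d * u)
  have hu₀ : ∀ u ∈ H, cs.length (d * u₀) ≤ cs.length (d * u₀ * u) := by
    intro u hu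
    have := Function.argmin_le (fun u : H => cs.length (d * u)) (u₀ * ⟨u, hu⟩)
    simpa [mul_assoc] using this
  have e1 := eq_of_forall_length_le cs hd (d := d * u₀) (by simp [H]) hu₀
  have e2 := eq_of_forall_length_le cs hd' (d := d * u₀)
    (by simpa [mul_assoc] using mul_mem (inv_mem u₀.2) h) hu₀
  exact e1.symm.trans e2

end MinReps

/-! ### The Bruhat order -/

section Bruhat

variable {M : CoxeterMatrix B} (cs : CoxeterSystem M W)

theorem bruhatLE_refl (w : W) : BruhatLE cs w w :=
  Relation.TransGen.single ⟨le_rfl, 1, Or.inr rfl, by simp⟩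

variable {cs} in
theorem BruhatLE.trans {u v w : W} (h1 : BruhatLE cs u v) (h2 : BruhatLE cs v w) :
    BruhatLE cs u w := Relation.TransGen.trans h1 h2

variable {cs} in
theorem BruhatLE.length_le {u w : W} (h : BruhatLE cs u w) : cs.length u ≤ cs.length w := by
  induction h with
  | single h => exact h.1
  | tail _ h ih => exact ih.trans h.1

variable {cs} in
theorem BruhatLE.eq_of_length_le {u w : W} (h : BruhatLE cs u w)
    (hl : cs.length w ≤ cs.length u) : u = w := by
  have step : ∀ {u w : W}, (cs.length u ≤ cs.length w ∧
      ∃ t : W, (cs.IsReflection t ∨ t = 1) ∧ w = t * u) → cs.length w ≤ cs.length u → u = w := by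
    rintro u w ⟨hl, t, ht | rfl, rfl⟩ hl'
    · exact absurd (le_antisymm hl' hl) (ht.length_mul_right_ne u)
    · simp
  induction h with
  | single h => exact step h hl
  | tail h1 h2 ih =>
    have h3 := BruhatLE.length_le (cs := cs) h1
    have h4 := step h2 (hl.trans h3)
    subst h4
    exact ih hl

variable {cs} in
theorem BruhatLT.length_lt {u w : W} (h : BruhatLT cs u w) : cs.length u < cs.length w := by
  by_contra h'
  exact h.2 (h.1.eq_of_length_le (by omega))

theorem bruhatLT_iff {u w : W} : BruhatLT cs u w ↔ BruhatLE cs u w ∧ cs.length u < cs.length w :=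
  ⟨fun h => ⟨h.1, h.length_lt⟩, fun h => ⟨h.1, by rintro rfl; exact lt_irrefl _ h.2⟩⟩

theorem bruhatLE_simple_mul {w : W} {s : B} (h : cs.length w < cs.length (cs.simple s * w)) :
    BruhatLE cs w (cs.simple s * w) :=
  Relation.TransGen.single ⟨h.le, _, Or.inl (cs.isReflection_simple s), rfl⟩

theorem simple_mul_bruhatLE {w : W} {s : B} (h : cs.length (cs.simple s * w) < cs.length w) :
    BruhatLE cs (cs.simple s * w) w := by
  have := bruhatLE_simple_mul cs (w := cs.simple s * w) (s := s)
  rw [cs.simple_mul_simple_cancel_left] at this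
  exact this h

theorem bruhatLT_simple_mul_iff {w : W} {s : B} :
    BruhatLT cs w (cs.simple s * w) ↔ cs.length w < cs.length (cs.simple s * w) :=
  ⟨fun h => h.length_lt, fun h => (bruhatLT_iff cs).2 ⟨bruhatLE_simple_mul cs h, h⟩⟩

theorem simple_mul_bruhatLT_iff {w : W} {s : B} :
    BruhatLT cs (cs.simple s * w) w ↔ cs.length (cs.simple s * w) < cs.length w :=
  ⟨fun h => h.length_lt, fun h => (bruhatLT_iff cs).2 ⟨simple_mul_bruhatLE cs h, h⟩⟩

/-- If multiplication by `s` reverses a step `u < tu` of the Bruhat order, then `tu = su`. -/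
theorem eq_simple_mul_of_reflection {u t : W} (ht : cs.IsReflection t) {s : B}
    (h : cs.length u < cs.length (t * u))
    (h' : cs.length (cs.simple s * (t * u)) < cs.length (cs.simple s * u)) :
    t * u = cs.simple s * u := by
  have h1 := cs.length_simple_mul u s
  have h2 := cs.length_simple_mul (t * u) s
  have hp : cs.length (t * u) ≠ cs.length (cs.simple s * (t * u)) :=
    (cs.length_simple_mul_ne _ s).symm
  -- Take a word `s :: ω` for `tu`; exchanging `t` into it can only delete the letter `s`.
  obtain ⟨ω, hω, hw⟩ := cs.exists_isReduced (cs.simple s * (t * u))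
  have htu : t * u = cs.wordProd (s :: ω) := by
    rw [cs.wordProd_cons, ← hw, cs.simple_mul_simple_cancel_left]
  have hinv : cs.IsRightInversion (cs.wordProd (s :: ω)) (u⁻¹ * t * u) := by
    refine ⟨by simpa using ht.conj u⁻¹, ?_⟩
    rw [← htu]
    have : t * u * (u⁻¹ * t * u) = u := by
      rw [show t * u * (u⁻¹ * t * u) = t * t * u by group, ht.mul_self, one_mul]
    rwa [this]
  obtain ⟨j, hj, hjt⟩ := exists_eraseIdx cs hinv
  have hu : u = cs.wordProd ((s :: ω).eraseIdx j) := by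
    rw [← hjt, ← htu, show t * u * (u⁻¹ * t * u) = t * t * u by group, ht.mul_self, one_mul]
  rcases j with _ | j
  · rw [htu, cs.wordProd_cons, hu]; simp
  · exfalso
    have h3 : cs.simple s * u = cs.wordProd (ω.eraseIdx j) := by
      rw [hu, List.eraseIdx_cons_succ, cs.wordProd_cons, cs.simple_mul_simple_cancel_left]
    have h4 : j < ω.length := by simpa using hj
    have h5 := cs.length_wordProd_le (ω.eraseIdx j)
    have h6 := List.length_eraseIdx_add_one h4
    have h7 := hω.eq
    rw [← hw] at h7
    rw [← h3] at h5
    omega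

/-- Left multiplication by `s` preserves a step of the Bruhat order, except for the step from `u`
to `su`, which it reverses. -/
theorem bruhat_step {u w : W} (s : B) (h : cs.length u ≤ cs.length w ∧
    ∃ t : W, (cs.IsReflection t ∨ t = 1) ∧ w = t * u) :
    BruhatLE cs (cs.simple s * u) (cs.simple s * w) ∨ w = cs.simple s * u := by
  obtain ⟨hl, t, ht | rfl, rfl⟩ := h
  · rcases le_or_gt (cs.length (cs.simple s * u)) (cs.length (cs.simple s * (t * u))) with h1 | h1
    · left
      refine Relation.TransGen.single ⟨h1, cs.simple s * t * (cs.simple s)⁻¹,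
        Or.inl (ht.conj _), ?_⟩
      simp [mul_assoc]
    · right
      exact eq_simple_mul_of_reflection cs ht
        (lt_of_le_of_ne hl (ht.length_mul_right_ne u).symm) h1
  · left; rw [one_mul]; exact bruhatLE_refl cs _

/-- A lifting property: if `u ≤ w`, then `su ≤ sw` or `su ≤ w`. -/
theorem simple_mul_bruhatLE_or {u w : W} (s : B) (h : BruhatLE cs u w) :
    BruhatLE cs (cs.simple s * u) (cs.simple s * w) ∨ BruhatLE cs (cs.simple s * u) w := by
  induction h with
  | single h =>
    rcases bruhat_step cs s h with h' | h'
    · exact Or.inl h'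
    · right; rw [h']; exact bruhatLE_refl cs _
  | tail _ h2 ih =>
    rcases ih with h' | h'
    · rcases bruhat_step cs s h2 with h3 | h3
      · exact Or.inl (h'.trans h3)
      · right; rw [h3]; exact h'
    · exact Or.inr (h'.trans (Relation.TransGen.single h2))

/-- A lifting property: if `u ≤ w`, then `su ≤ sw` or `u ≤ sw`. -/
theorem bruhatLE_simple_mul_or {u w : W} (s : B) (h : BruhatLE cs u w) :
    BruhatLE cs (cs.simple s * u) (cs.simple s * w) ∨ BruhatLE cs u (cs.simple s * w) := by
  induction h using Relation.TransGen.head_induction_on with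
  | single h =>
    rcases bruhat_step cs s h with h' | h'
    · exact Or.inl h'
    · right; rw [h', cs.simple_mul_simple_cancel_left]; exact bruhatLE_refl cs _
  | head h2 _ ih =>
    rcases ih with h' | h'
    · rcases bruhat_step cs s h2 with h3 | h3
      · exact Or.inl (h3.trans h')
      · right
        rw [h3, cs.simple_mul_simple_cancel_left] at h'
        exact h'
    · exact Or.inr (BruhatLE.trans (Relation.TransGen.single h2) h')

theorem simple_mul_bruhatLE_of_lt {u w : W} {s : B} (h : BruhatLE cs u w)
    (hs : cs.length w < cs.length (cs.simple s * w)) :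
    BruhatLE cs (cs.simple s * u) (cs.simple s * w) :=
  (simple_mul_bruhatLE_or cs s h).elim id fun h' => h'.trans (bruhatLE_simple_mul cs hs)

/-- Bruhat intervals are finite: if `sw < w`, then every `u ≤ w` has `u ≤ sw` or `su ≤ sw`. -/
theorem finite_setOf_bruhatLE (w : W) : {u | BruhatLE cs u w}.Finite := by
  obtain ⟨n, hn⟩ : ∃ n, cs.length w = n := ⟨_, rfl⟩
  induction n generalizing w with
  | zero =>
    refine (Set.finite_singleton w).subset fun u hu => ?_
    exact BruhatLE.eq_of_length_le hu (by omega)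
  | succ n ih =>
    have hw : w ≠ 1 := by rintro rfl; simp at hn
    obtain ⟨s, hs⟩ := cs.exists_leftDescent_of_ne_one hw
    have hs' := (cs.isLeftDescent_iff).1 hs
    have hf := ih (cs.simple s * w) (by omega)
    refine (hf.union (hf.image fun u => cs.simple s * u)).subset fun u hu => ?_
    rcases bruhatLE_simple_mul_or cs s hu with h | h
    · exact Or.inr ⟨_, h, by simp⟩
    · exact Or.inl h

end Bruhat

/-! ### The elements `T_w` and the regular representation -/

section Regular

variable {M : CoxeterMatrix B} (cs : CoxeterSystem M W)

@[elab_as_elim]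
theorem Hecke.induction {motive : Hecke M → Prop}
    (algebraMap : ∀ a, motive (algebraMap LaurentZ _ a))
    (gen : ∀ i, motive (heckeGen M i)) (mul : ∀ x y, motive x → motive y → motive (x * y))
    (add : ∀ x y, motive x → motive y → motive (x + y)) (x : Hecke M) : motive x := by
  obtain ⟨y, rfl⟩ := RingQuot.mkAlgHom_surjective LaurentZ (HeckeRel M) x
  induction y using FreeAlgebra.induction with
  | grade0 a =>
    rw [AlgHom.commutes]
    exact algebraMap a
  | grade1 i => exact gen i
  | mul a b ha hb => rw [map_mul]; exact mul _ _ ha hb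
  | add a b ha hb => rw [map_add]; exact add _ _ ha hb

/-- By Matsumoto's theorem, `T_w` is the product of the `T_s` along any reduced word of `w`. -/
theorem heckeT_wordProd {ω : List B} (hω : cs.IsReduced ω) :
    heckeT cs (cs.wordProd ω) = (ω.map (heckeGen M)).prod :=
  have h := (cs.exists_isReduced (cs.wordProd ω)).choose_spec
  prod_map_eq_of_isReduced cs _ (heckeGen_braid M) h.1 hω h.2.symm

theorem heckeT_one : heckeT cs 1 = 1 := by
  have := heckeT_wordProd cs (ω := []) (by simp [CoxeterSystem.IsReduced])
  simpa using this

theorem heckeGen_mul_heckeT_of_lt {w : W} {s : B} (h : cs.length w < cs.length (cs.simple s * w)) :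
    heckeGen M s * heckeT cs w = heckeT cs (cs.simple s * w) := by
  obtain ⟨ω, hω, rfl⟩ := cs.exists_isReduced w
  have h1 := cs.length_simple_mul (cs.wordProd ω) s
  have hred : cs.IsReduced (s :: ω) := by
    rw [CoxeterSystem.IsReduced, cs.wordProd_cons, List.length_cons, ← hω.eq]; omega
  rw [← cs.wordProd_cons, heckeT_wordProd cs hω, heckeT_wordProd cs hred]
  simp

theorem heckeT_mul_heckeGen_of_lt {w : W} {t : B} (h : cs.length w < cs.length (w * cs.simple t)) :
    heckeT cs w * heckeGen M t = heckeT cs (w * cs.simple t) := by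
  obtain ⟨ω, hω, rfl⟩ := cs.exists_isReduced w
  have h1 := cs.length_mul_simple (cs.wordProd ω) t
  have hw : cs.wordProd (ω ++ [t]) = cs.wordProd ω * cs.simple t := by
    rw [cs.wordProd_append, cs.wordProd_singleton]
  have hred : cs.IsReduced (ω ++ [t]) := by
    rw [CoxeterSystem.IsReduced, hw, List.length_append, List.length_singleton, ← hω.eq]; omega
  rw [← hw, heckeT_wordProd cs hω, heckeT_wordProd cs hred]
  simp

theorem heckeGen_mul_heckeT_of_gt {w : W} {s : B} (h : cs.length (cs.simple s * w) < cs.length w) :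
    heckeGen M s * heckeT cs w = heckeT cs (cs.simple s * w) + (q - qInv) • heckeT cs w := by
  have h1 := heckeGen_mul_heckeT_of_lt cs (w := cs.simple s * w) (s := s)
  rw [cs.simple_mul_simple_cancel_left] at h1
  rw [← h1 h, ← mul_assoc, heckeGen_sq, add_mul, one_mul, mul_assoc, Algebra.smul_def]

/-- Multiplication by `s` on the left and by `t` on the right change the length independently,
unless `sw = wt`. -/
theorem simple_mul_eq_or_length (w : W) (s t : B) :
    cs.simple s * w = w * cs.simple t ∨
      cs.length (cs.simple s * w * cs.simple t) + cs.length w =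
        cs.length (cs.simple s * w) + cs.length (w * cs.simple t) := by
  by_contra! h
  obtain ⟨hne, h⟩ := h
  have h1 := cs.length_simple_mul w s
  have h2 := cs.length_mul_simple w t
  have h3 := cs.length_mul_simple (cs.simple s * w) t
  have h4 := cs.length_simple_mul (w * cs.simple t) s
  rw [← mul_assoc] at h4
  rcases lt_or_gt_of_ne (cs.length_mul_simple_ne w t) with h5 | h5
  · refine hne ?_
    have h6 := simple_mul_eq_mul_simple cs (w := cs.simple s * w) (i := s) (j := t)
    simp only [cs.simple_mul_simple_cancel_left] at h6
    have h7 := congrArg (fun x => x * cs.simple t) (h6 (by omega) (by omega))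
    simpa using h7.symm
  · exact hne (simple_mul_eq_mul_simple cs (by omega) (by omega))

/-- Left multiplication by `T_s` in the regular representation, on the free module with the basis
`W`. -/
noncomputable def leftOp (s : B) : Module.End LaurentZ (W →₀ LaurentZ) :=
  Finsupp.linearCombination LaurentZ fun w =>
    Finsupp.single (cs.simple s * w) 1 +
      if cs.length (cs.simple s * w) < cs.length w then Finsupp.single w (q - qInv) else 0

/-- Right multiplication by `T_t` in the regular representation. -/
noncomputable def rightOp (t : B) : Module.End LaurentZ (W →₀ LaurentZ) :=
  Finsupp.linearCombination LaurentZ fun w =>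
    Finsupp.single (w * cs.simple t) 1 +
      if cs.length (w * cs.simple t) < cs.length w then Finsupp.single w (q - qInv) else 0

theorem leftOp_single (s : B) (w : W) (a : LaurentZ) :
    leftOp cs s (Finsupp.single w a) = a • (Finsupp.single (cs.simple s * w) 1 +
      if cs.length (cs.simple s * w) < cs.length w then Finsupp.single w (q - qInv) else 0) := by
  simp [leftOp]

theorem rightOp_single (t : B) (w : W) (a : LaurentZ) :
    rightOp cs t (Finsupp.single w a) = a • (Finsupp.single (w * cs.simple t) 1 +
      if cs.length (w * cs.simple t) < cs.length w then Finsupp.single w (q - qInv) else 0) := by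
  simp [rightOp]

theorem commute_leftOp_rightOp (s t : B) : Commute (leftOp cs s) (rightOp cs t) := by
  refine Finsupp.lhom_ext' fun w => LinearMap.ext_ring ?_
  simp only [LinearMap.comp_apply, Finsupp.lsingle_apply, Module.End.mul_apply, leftOp_single,
    rightOp_single, one_smul, map_add, apply_ite (leftOp cs s), apply_ite (rightOp cs t), map_zero,
    ← mul_assoc]
  have h1 := cs.length_simple_mul w s
  have h2 := cs.length_mul_simple w t
  rcases simple_mul_eq_or_length cs w s t with h | h
  · rw [h]
  · have e1 : cs.length (cs.simple s * w * cs.simple t) < cs.length (w * cs.simple t) ↔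
        cs.length (cs.simple s * w) < cs.length w := by omega
    have e2 : cs.length (cs.simple s * w * cs.simple t) < cs.length (cs.simple s * w) ↔
        cs.length (w * cs.simple t) < cs.length w := by omega
    simp only [e1, e2]
    split_ifs <;> simp [add_assoc, add_left_comm, add_comm]

theorem leftOp_sq (s : B) :
    leftOp cs s * leftOp cs s =
      1 + algebraMap LaurentZ (Module.End LaurentZ (W →₀ LaurentZ)) (q - qInv) * leftOp cs s := by
  refine Finsupp.lhom_ext' fun w => LinearMap.ext_ring ?_
  have h1 := cs.length_simple_mul w s
  have e : cs.length w < cs.length (cs.simple s * w) ↔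
    ¬ cs.length (cs.simple s * w) < cs.length w := by omega
  simp only [LinearMap.comp_apply, Finsupp.lsingle_apply, Module.End.mul_apply, leftOp_single,
    one_smul, map_add, apply_ite (leftOp cs s), map_zero, LinearMap.add_apply,
    Module.End.one_apply, cs.simple_mul_simple_cancel_left, Module.algebraMap_end_apply, e]
  split_ifs <;> simp

theorem prod_leftOp_single_one {ω : List B} (hω : cs.IsReduced ω) :
    (ω.map (leftOp cs)).prod (Finsupp.single 1 1) = Finsupp.single (cs.wordProd ω) 1 := by
  induction ω with
  | nil => simp
  | cons i ω ih =>
    have h' : cs.IsReduced ω := isReduced_of_append_right cs (ω := [i]) hω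
    have h1 := hω.eq
    rw [cs.wordProd_cons, List.length_cons, ← h'.eq] at h1
    rw [List.map_cons, List.prod_cons, Module.End.mul_apply, ih h', leftOp_single,
      if_neg (by omega), cs.wordProd_cons]
    simp

/-- An operator that commutes with all right multiplications is determined by its value at `1`. -/
theorem eq_of_commute_rightOp {P Q : Module.End LaurentZ (W →₀ LaurentZ)}
    (hP : ∀ t, Commute P (rightOp cs t)) (hQ : ∀ t, Commute Q (rightOp cs t))
    (h : P (Finsupp.single 1 1) = Q (Finsupp.single 1 1)) : P = Q := by
  refine Finsupp.lhom_ext' fun w => LinearMap.ext_ring ?_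
  simp only [LinearMap.comp_apply, Finsupp.lsingle_apply]
  obtain ⟨n, hn⟩ : ∃ n, cs.length w = n := ⟨_, rfl⟩
  induction n generalizing w with
  | zero => rw [cs.length_eq_zero_iff.1 hn, h]
  | succ n ih =>
    have hw : w ≠ 1 := by rintro rfl; simp at hn
    obtain ⟨t, ht⟩ := cs.exists_rightDescent_of_ne_one hw
    have ht' := (cs.isRightDescent_iff).1 ht
    have e : Finsupp.single w (1 : LaurentZ) =
        rightOp cs t (Finsupp.single (w * cs.simple t) 1) := by
      rw [rightOp_single, cs.simple_mul_simple_cancel_right, if_neg (by omega)]; simp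
    have h1 := LinearMap.congr_fun (hP t) (Finsupp.single (w * cs.simple t) 1)
    have h2 := LinearMap.congr_fun (hQ t) (Finsupp.single (w * cs.simple t) 1)
    simp only [Module.End.mul_apply] at h1 h2
    rw [e, h1, h2, ih _ (by omega)]

/-- The braid relations hold for the left multiplications: these commute with the right ones, and
both sides send the vector `1` to the same basis vector. -/
theorem leftOp_braid (i j : B) :
    ((alternatingWord i j (M i j)).map (leftOp cs)).prod =
      ((alternatingWord j i (M i j)).map (leftOp cs)).prod := by
  have hc : ∀ (ω : List B) (t : B), Commute (ω.map (leftOp cs)).prod (rightOp cs t) := by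
    intro ω t
    apply Commute.list_prod_left
    intro x hx
    obtain ⟨i, -, rfl⟩ := List.mem_map.1 hx
    exact commute_leftOp_rightOp cs i t
  refine eq_of_commute_rightOp cs (hc _) (hc _) ?_
  rw [prod_leftOp_single_one cs (isReduced_alternatingWord cs i j (Or.inr le_rfl)),
    prod_leftOp_single_one cs (isReduced_alternatingWord cs j i (Or.inr (M.symmetric i j).le))]
  have := cs.wordProd_braidWord_eq i j
  rw [braidWord, braidWord, M.symmetric j i] at this
  rw [this]

end Regular

/-! ### The induced module on the free module with basis `D_J` -/

section InducedFree

variable {M : CoxeterMatrix B} (cs : CoxeterSystem M W) (J : Set B)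

/-- The distinguished representative of the coset `w W_J`. -/
noncomputable def minRep (w : W) : minReps cs J :=
  ⟨(exists_mem_minReps cs (J := J) w).choose, (exists_mem_minReps cs w).choose_spec.1⟩

theorem minRep_eq {w : W} (d : minReps cs J)
    (h : (d : W)⁻¹ * w ∈ Subgroup.closure (cs.simple '' J)) : minRep cs J w = d := by
  apply Subtype.ext
  have h' := (exists_mem_minReps cs (J := J) w).choose_spec.2
  refine eq_of_mem_minReps cs (minRep cs J w).2 d.2 ?_
  have := mul_mem h' (inv_mem h)
  simpa [mul_assoc, minRep] using this

theorem minRep_coe (d : minReps cs J) : minRep cs J d = d :=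
  minRep_eq cs J d (by simp)

theorem minRep_mul_simple {t : B} (ht : t ∈ J) (w : W) :
    minRep cs J (w * cs.simple t) = minRep cs J w := by
  apply minRep_eq
  have h' := (exists_mem_minReps cs (J := J) w).choose_spec.2
  rw [← mul_assoc]
  exact mul_mem h' (Subgroup.subset_closure (Set.mem_image_of_mem cs.simple ht))

theorem neg_qInv_mul_neg_q : (-qInv) * (-q) = 1 := by
  rw [neg_mul_neg, mul_comm, q_mul_qInv]

/-- The projection of the regular representation onto the free module with basis `D_J`, which sends
`d u` to `(-q)^{-l(u)} d` for `d ∈ D_J` and `u ∈ W_J`. -/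
noncomputable def minRepProj : (W →₀ LaurentZ) →ₗ[LaurentZ] (minReps cs J →₀ LaurentZ) :=
  Finsupp.linearCombination LaurentZ fun w =>
    Finsupp.single (minRep cs J w) ((-qInv) ^ cs.length w * (-q) ^ cs.length (minRep cs J w : W))

theorem minRepProj_single (w : W) (a : LaurentZ) :
    minRepProj cs J (Finsupp.single w a) = a • Finsupp.single (minRep cs J w)
      ((-qInv) ^ cs.length w * (-q) ^ cs.length (minRep cs J w : W)) := by
  simp [minRepProj]

/-- The inclusion of the basis `D_J` into the basis `W`. -/
noncomputable def minRepIncl : (minReps cs J →₀ LaurentZ) →ₗ[LaurentZ] (W →₀ LaurentZ) :=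
  Finsupp.lmapDomain LaurentZ LaurentZ Subtype.val

theorem minRepProj_coe (d : minReps cs J) (a : LaurentZ) :
    minRepProj cs J (Finsupp.single (d : W) a) = Finsupp.single d a := by
  rw [minRepProj_single, minRep_coe, ← mul_pow, neg_qInv_mul_neg_q]; simp

theorem minRepProj_comp_minRepIncl : minRepProj cs J ∘ₗ minRepIncl cs J = LinearMap.id := by
  refine Finsupp.lhom_ext' fun d => LinearMap.ext_ring ?_
  simp [minRepIncl, minRepProj_coe]

theorem minRepProj_comp_rightOp {t : B} (ht : t ∈ J) :
    minRepProj cs J ∘ₗ rightOp cs t = (-qInv) • minRepProj cs J := by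
  refine Finsupp.lhom_ext' fun w => LinearMap.ext_ring ?_
  have hq := neg_qInv_mul_neg_q
  simp only [LinearMap.comp_apply, Finsupp.lsingle_apply, rightOp_single, one_smul, map_add,
    LinearMap.smul_apply, apply_ite (minRepProj cs J), map_zero, minRepProj_single,
    minRep_mul_simple cs J ht]
  rcases cs.length_mul_simple w t with h | h
  · rw [if_neg (by omega), h, pow_succ]
    simp only [Finsupp.smul_single, smul_eq_mul, add_zero]
    congr 1; ring
  · rw [if_pos (by omega), ← h, pow_succ]
    simp only [Finsupp.smul_single, smul_eq_mul, ← Finsupp.single_add]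
    congr 1
    linear_combination (-(-qInv) ^ cs.length (w * cs.simple t) *
      (-q) ^ cs.length (minRep cs J w : W)) * hq

/-- The operator of `T_s` on the free module with basis `D_J`. -/
noncomputable def inducedOp (s : B) : Module.End LaurentZ (minReps cs J →₀ LaurentZ) :=
  minRepProj cs J ∘ₗ leftOp cs s ∘ₗ minRepIncl cs J

/-- The kernel of the projection is stable under the left multiplications, because these commute
with the right multiplications. -/
theorem inducedOp_comp_minRepProj (s : B) :
    inducedOp cs J s ∘ₗ minRepProj cs J = minRepProj cs J ∘ₗ leftOp cs s := by
  refine Finsupp.lhom_ext' fun w => LinearMap.ext_ring ?_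
  simp only [LinearMap.comp_apply, Finsupp.lsingle_apply]
  obtain ⟨n, hn⟩ : ∃ n, cs.length w = n := ⟨_, rfl⟩
  induction n using Nat.strong_induction_on generalizing w with
  | _ n ih =>
    by_cases hw : w ∈ minReps cs J
    · have := minRepProj_coe cs J ⟨w, hw⟩ 1
      rw [this]
      simp [inducedOp, minRepIncl]
    · obtain ⟨t, ht, h⟩ := exists_of_notMem_minReps cs hw
      have e : Finsupp.single w (1 : LaurentZ) =
          rightOp cs t (Finsupp.single (w * cs.simple t) 1) := by
        rw [rightOp_single, cs.simple_mul_simple_cancel_right, if_neg (by omega)]; simp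
      have h1 : ∀ x, minRepProj cs J (rightOp cs t x) = (-qInv) • minRepProj cs J x :=
        LinearMap.congr_fun (minRepProj_comp_rightOp cs J ht)
      have h2 : ∀ x, leftOp cs s (rightOp cs t x) = rightOp cs t (leftOp cs s x) :=
        LinearMap.congr_fun (commute_leftOp_rightOp cs s t)
      rw [e, h1, h2, h1, map_smul, ih _ (by omega) _ rfl]

theorem prod_inducedOp_comp_minRepProj (ω : List B) :
    (ω.map (inducedOp cs J)).prod ∘ₗ minRepProj cs J =
      minRepProj cs J ∘ₗ (ω.map (leftOp cs)).prod := by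
  induction ω with
  | nil => rfl
  | cons i ω ih =>
    rw [List.map_cons, List.prod_cons, List.map_cons, List.prod_cons, Module.End.mul_eq_comp,
      LinearMap.comp_assoc, ih, ← LinearMap.comp_assoc, inducedOp_comp_minRepProj]
    rfl

theorem eq_of_comp_minRepProj {P Q : Module.End LaurentZ (minReps cs J →₀ LaurentZ)}
    (h : P ∘ₗ minRepProj cs J = Q ∘ₗ minRepProj cs J) : P = Q := by
  have := congrArg (fun f => f ∘ₗ minRepIncl cs J) h
  simpa only [LinearMap.comp_assoc, minRepProj_comp_minRepIncl, LinearMap.comp_id] using this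

/-- The action of the Hecke algebra on the free module with basis `D_J`. -/
noncomputable def inducedRep :
    Hecke M →ₐ[LaurentZ] Module.End LaurentZ (minReps cs J →₀ LaurentZ) :=
  Hecke.lift M (inducedOp cs J)
    (by
      intro i
      apply eq_of_comp_minRepProj
      have h := prod_inducedOp_comp_minRepProj cs J [i, i]
      simp only [List.map_cons, List.map_nil, List.prod_cons, List.prod_nil, mul_one,
        leftOp_sq] at h
      rw [h, LinearMap.add_comp, LinearMap.comp_add]
      congr 1
      ext1 w
      apply LinearMap.ext_ring
      have h1 := LinearMap.congr_fun (inducedOp_comp_minRepProj cs J i) (Finsupp.single w 1)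
      simp only [LinearMap.comp_apply] at h1
      simp [h1])
    (by
      intro i j
      apply eq_of_comp_minRepProj
      rw [prod_inducedOp_comp_minRepProj, prod_inducedOp_comp_minRepProj, leftOp_braid])

theorem inducedRep_heckeGen (s : B) : inducedRep cs J (heckeGen M s) = inducedOp cs J s :=
  Hecke.lift_heckeGen M _ _ _ s

/-- The basis vector of `1 ∈ D_J`. -/
noncomputable def inducedOne : minReps cs J →₀ LaurentZ :=
  Finsupp.single ⟨1, one_mem_minReps cs⟩ 1

theorem minRepProj_one : minRepProj cs J (Finsupp.single 1 1) = inducedOne cs J :=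
  minRepProj_coe cs J ⟨1, one_mem_minReps cs⟩ 1

theorem inducedRep_heckeT (w : minReps cs J) :
    inducedRep cs J (heckeT cs (w : W)) (inducedOne cs J) = Finsupp.single w 1 := by
  obtain ⟨ω, hω, hw⟩ := cs.exists_isReduced (w : W)
  have h := LinearMap.congr_fun (prod_inducedOp_comp_minRepProj cs J ω) (Finsupp.single 1 1)
  rw [LinearMap.comp_apply, minRepProj_one, LinearMap.comp_apply,
    prod_leftOp_single_one cs hω, ← hw, minRepProj_coe] at h
  rw [← h, hw, heckeT_wordProd cs hω, map_list_prod, List.map_map]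
  congr 4
  funext i
  exact inducedRep_heckeGen cs J i

theorem inducedRep_heckeJ (k : HeckeJ M J) :
    inducedRep cs J k (inducedOne cs J) = phi M J k • inducedOne cs J := by
  change inducedRep cs J k (inducedOne cs J) = signHom M k • inducedOne cs J
  obtain ⟨k, hk⟩ := k
  induction hk using Algebra.adjoin_induction with
  | mem x hx =>
    obtain ⟨t, ht, rfl⟩ := hx
    have h1 := LinearMap.congr_fun (inducedOp_comp_minRepProj cs J t) (Finsupp.single 1 1)
    have h2 := LinearMap.congr_fun (minRepProj_comp_rightOp cs J ht) (Finsupp.single 1 1)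
    have h3 : leftOp cs t (Finsupp.single 1 1) = rightOp cs t (Finsupp.single 1 1) := by
      simp [leftOp_single, rightOp_single]
    simp only [LinearMap.comp_apply, LinearMap.smul_apply, minRepProj_one] at h1 h2
    rw [signHom_heckeGen, inducedRep_heckeGen, h1, h3, h2]
  | algebraMap r => simp
  | add x y _ _ hx hy => simp only [map_add, LinearMap.add_apply, add_smul] at *; rw [hx, hy]
  | mul x y _ _ hx hy =>
    simp only [map_mul, Module.End.mul_apply] at *
    rw [hy, map_smul, hx, smul_smul, mul_comm]

end InducedFree

/-! ### The basis `b_w` of the induced module -/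

section InducedModule

variable {M : CoxeterMatrix B} (cs : CoxeterSystem M W) (J : Set B)

theorem rid_smul (h : Hecke M) (x : Hecke M ⊗[LaurentZ] LaurentZ) :
    TensorProduct.rid LaurentZ (Hecke M) (h • x) = h * TensorProduct.rid LaurentZ (Hecke M) x := by
  induction x with
  | zero => simp
  | tmul a b => rw [TensorProduct.smul_tmul']; simp
  | add x y hx hy => simp only [smul_add, map_add, mul_add, hx, hy]

/-- The elements of the balancing submodule vanish in the model of the induced module. -/
theorem inducedRep_of_mem_balancing {x : Hecke M ⊗[LaurentZ] LaurentZ} (hx : x ∈ balancing M J) :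
    inducedRep cs J (TensorProduct.rid LaurentZ (Hecke M) x) (inducedOne cs J) = 0 := by
  induction hx using Submodule.span_induction with
  | mem x hx =>
    obtain ⟨h, k, a, rfl⟩ := hx
    simp only [map_sub, TensorProduct.rid_tmul, map_smul, map_mul, LinearMap.sub_apply,
      LinearMap.smul_apply, Module.End.mul_apply, inducedRep_heckeJ, smul_smul]
    rw [mul_comm, sub_self]
  | zero => simp
  | add x y _ _ hx hy => simp only [map_add, LinearMap.add_apply, hx, hy, add_zero]
  | smul h x _ hx => rw [rid_smul, map_mul, Module.End.mul_apply, hx, map_zero]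

theorem SPhi.smul_tmul (h k : Hecke M) (a : LaurentZ) :
    h • SPhi.tmul M J k a = SPhi.tmul M J (h * k) a := by
  rw [SPhi.tmul, ← map_smul, TensorProduct.smul_tmul']; rfl

theorem SPhi.tmul_mul_of_mem {t : B} (ht : t ∈ J) (h : Hecke M) :
    SPhi.tmul M J (h * heckeGen M t) 1 = -(qInv • SPhi.tmul M J h 1) := by
  have hmem : (h * heckeGen M t) ⊗ₜ[LaurentZ] (1 : LaurentZ) -
      h ⊗ₜ[LaurentZ] (signHom M (heckeGen M t) * 1) ∈ balancing M J :=
    Submodule.subset_span ⟨h, ⟨heckeGen M t, Algebra.subset_adjoin ⟨t, ht, rfl⟩⟩, 1, rfl⟩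
  have h1 := (Submodule.Quotient.eq (balancing M J)).2 hmem
  rw [signHom_heckeGen] at h1
  refine h1.trans ?_
  rw [← smul_eq_mul, TensorProduct.tmul_smul]
  exact neg_smul qInv (SPhi.tmul M J h 1)

end InducedModule

section InducedBasis

variable {M : CoxeterMatrix B} (cs : CoxeterSystem M W) (J : Set B)

/-- The vector `b_w = T_w ⊗ 1`. -/
noncomputable def inducedVec (w : W) : SPhi M J := SPhi.tmul M J (heckeT cs w) 1

theorem heckeGen_smul_inducedVec_of_lt {w : W} {s : B}
    (h : cs.length w < cs.length (cs.simple s * w)) :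
    heckeGen M s • inducedVec cs J w = inducedVec cs J (cs.simple s * w) := by
  rw [inducedVec, SPhi.smul_tmul, heckeGen_mul_heckeT_of_lt cs h, inducedVec]

theorem SPhi.tmul_add (h k : Hecke M) :
    SPhi.tmul M J (h + k) 1 = SPhi.tmul M J h 1 + SPhi.tmul M J k 1 := by
  rw [SPhi.tmul, TensorProduct.add_tmul, map_add]; rfl

theorem SPhi.tmul_smul (a : LaurentZ) (h : Hecke M) :
    SPhi.tmul M J (a • h) 1 = a • SPhi.tmul M J h 1 := rfl

theorem heckeGen_smul_inducedVec_of_gt {w : W} {s : B}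
    (h : cs.length (cs.simple s * w) < cs.length w) :
    heckeGen M s • inducedVec cs J w =
      inducedVec cs J (cs.simple s * w) + (q - qInv) • inducedVec cs J w := by
  rw [inducedVec, SPhi.smul_tmul, heckeGen_mul_heckeT_of_gt cs h, SPhi.tmul_add, SPhi.tmul_smul,
    inducedVec]

theorem heckeGen_smul_inducedVec_of_notMem {w : W} (hw : w ∈ minReps cs J) {s : B}
    (h : cs.simple s * w ∉ minReps cs J) :
    heckeGen M s • inducedVec cs J w = -(qInv • inducedVec cs J w) := by
  obtain ⟨t, ht, hst⟩ := exists_simple_mul_eq cs hw h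
  rw [heckeGen_smul_inducedVec_of_lt cs J (length_lt_of_notMem_minReps cs hw h), hst, inducedVec,
    ← heckeT_mul_heckeGen_of_lt cs (hw t ht), SPhi.tmul_mul_of_mem J ht, inducedVec]

theorem linearIndependent_inducedVec :
    LinearIndependent LaurentZ fun w : minReps cs J => inducedVec cs J (w : W) := by
  rw [linearIndependent_iff]
  intro l hl
  have hmem : (Finsupp.linearCombination LaurentZ
      fun w : minReps cs J => heckeT cs (w : W) ⊗ₜ[LaurentZ] (1 : LaurentZ)) l ∈ balancing M J := by
    rw [← Submodule.Quotient.mk_eq_zero, ← hl, Finsupp.linearCombination_apply,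
      Finsupp.linearCombination_apply, Finsupp.sum, Finsupp.sum]
    exact map_sum ((balancing M J).mkQ) _ _
  have h := inducedRep_of_mem_balancing cs J hmem
  rw [Finsupp.linearCombination_apply, Finsupp.sum, map_sum, map_sum, LinearMap.sum_apply] at h
  rw [← h]
  conv_lhs => rw [← Finsupp.sum_single l, Finsupp.sum]
  refine Finset.sum_congr rfl fun w _ => ?_
  simp [inducedRep_heckeT]

theorem span_inducedVec :
    ⊤ ≤ Submodule.span LaurentZ (Set.range fun w : minReps cs J => inducedVec cs J (w : W)) := by
  set N := Submodule.span LaurentZ (Set.range fun w : minReps cs J => inducedVec cs J (w : W))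
  have hmem : ∀ w ∈ minReps cs J, inducedVec cs J w ∈ N :=
    fun w hw => Submodule.subset_span ⟨⟨w, hw⟩, rfl⟩
  have hgen : ∀ (s : B) (x : SPhi M J), x ∈ N → heckeGen M s • x ∈ N := by
    intro s x hx
    induction hx using Submodule.span_induction with
    | mem x hx =>
      obtain ⟨⟨w, hw⟩, rfl⟩ := hx
      by_cases h1 : cs.simple s * w ∈ minReps cs J
      · rcases lt_or_gt_of_ne (cs.length_simple_mul_ne w s) with h2 | h2
        · simp only
          rw [heckeGen_smul_inducedVec_of_gt cs J h2]
          exact add_mem (hmem _ h1) (N.smul_mem _ (hmem _ hw))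
        · simp only
          rw [heckeGen_smul_inducedVec_of_lt cs J h2]
          exact hmem _ h1
      · simp only
        rw [heckeGen_smul_inducedVec_of_notMem cs J hw h1]
        exact neg_mem (N.smul_mem _ (hmem _ hw))
    | zero => rw [smul_zero]; exact zero_mem N
    | add x y _ _ hx hy => rw [smul_add]; exact add_mem hx hy
    | smul a x _ hx => rw [smul_comm]; exact N.smul_mem _ hx
  have hall : ∀ (h : Hecke M) (x : SPhi M J), x ∈ N → h • x ∈ N := by
    intro h
    induction h using Hecke.induction with
    | algebraMap a => intro x hx; rw [algebraMap_smul]; exact N.smul_mem _ hx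
    | gen s => exact hgen s
    | mul a b ha hb => intro x hx; rw [mul_smul]; exact ha _ (hb _ hx)
    | add a b ha hb => intro x hx; rw [add_smul]; exact add_mem (ha _ hx) (hb _ hx)
  rintro x -
  obtain ⟨y, rfl⟩ := (balancing M J).mkQ_surjective x
  induction y with
  | zero => rw [map_zero]; exact zero_mem N
  | tmul h a =>
    have h1 : (balancing M J).mkQ (h ⊗ₜ a) = (a • h) • inducedVec cs J 1 := by
      rw [inducedVec, heckeT_one, SPhi.smul_tmul, mul_one, SPhi.tmul, TensorProduct.smul_tmul,
        smul_eq_mul, mul_one]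
    rw [h1]
    exact hall _ _ (hmem _ (one_mem_minReps cs))
  | add x y hx hy => rw [map_add]; exact add_mem hx hy

/-- The basis `(b_w)` of the induced module. -/
noncomputable def inducedBasis : Module.Basis (minReps cs J) LaurentZ (SPhi M J) :=
  Module.Basis.mk (linearIndependent_inducedVec cs J) (span_inducedVec cs J)

theorem inducedBasis_apply (w : minReps cs J) :
    inducedBasis cs J w = inducedVec cs J (w : W) := by
  rw [inducedBasis, Module.Basis.mk_apply]

theorem inducedVec_eq_smul (w : W) : inducedVec cs J w = heckeT cs w • inducedVec cs J 1 := by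
  rw [inducedVec, inducedVec, SPhi.smul_tmul, heckeT_one, mul_one]

/-! ### The bar involution of the induced module -/

theorem barA_barA (a : LaurentZ) : barA (barA a) = a :=
  LaurentPolynomial.invert.symm_apply_apply a

theorem barH_barH (h : Hecke M) : barH M (barH M h) = h := by
  induction h using Hecke.induction with
  | algebraMap a => rw [barH_algebraMap, barH_algebraMap, barA_barA]
  | gen s =>
    rw [barH_heckeGen, map_sub, barH_heckeGen, barH_algebraMap, map_sub barA, barA_q, barA_qInv,
      sub_sub, ← map_add, sub_add_sub_cancel, sub_self, map_zero, sub_zero]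
  | mul x y hx hy => rw [map_mul, map_mul, hx, hy]
  | add x y hx hy => rw [map_add, map_add, hx, hy]

/-- The semilinear map with prescribed values on a basis. -/
noncomputable def semilinearConstr {V S : Type*} [AddCommGroup S] [Module LaurentZ S]
    (b : Module.Basis V LaurentZ S) (f : V → S) : S →ₛₗ[barA] S where
  toFun x := (b.repr x).sum fun w a => barA a • f w
  map_add' x y := by
    rw [map_add]
    exact Finsupp.sum_add_index' (by simp) (by simp [add_smul])
  map_smul' a x := by
    rw [map_smul, Finsupp.sum_smul_index' (by simp), Finsupp.smul_sum]
    simp [mul_smul]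

theorem semilinearConstr_basis {V S : Type*} [AddCommGroup S] [Module LaurentZ S]
    (b : Module.Basis V LaurentZ S) (f : V → S) (w : V) : semilinearConstr b f (b w) = f w := by
  simp [semilinearConstr]

/-- The bar involution of the induced module: `h ⊗ 1 ↦ (bar h) ⊗ 1`. -/
noncomputable def inducedBar : SPhi M J →ₛₗ[barA] SPhi M J :=
  semilinearConstr (inducedBasis cs J) fun w => barH M (heckeT cs (w : W)) • inducedVec cs J 1

theorem inducedBar_inducedVec {w : W} (hw : w ∈ minReps cs J) :
    inducedBar cs J (inducedVec cs J w) = barH M (heckeT cs w) • inducedVec cs J 1 := by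
  have := semilinearConstr_basis (inducedBasis cs J)
    (fun w => barH M (heckeT cs (w : W)) • inducedVec cs J 1) ⟨w, hw⟩
  rwa [inducedBasis_apply] at this

theorem inducedBar_heckeGen_smul (s : B) (x : SPhi M J) :
    inducedBar cs J (heckeGen M s • x) = barH M (heckeGen M s) • inducedBar cs J x := by
  have hx : x ∈ Submodule.span LaurentZ
    (Set.range fun w : minReps cs J => inducedVec cs J (w : W)) := span_inducedVec cs J trivial
  induction hx using Submodule.span_induction with
  | mem x hx =>
    obtain ⟨⟨w, hw⟩, rfl⟩ := hx
    simp only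
    rw [inducedBar_inducedVec cs J hw, ← mul_smul, ← map_mul]
    by_cases h1 : cs.simple s * w ∈ minReps cs J
    · rcases lt_or_gt_of_ne (cs.length_simple_mul_ne w s) with h2 | h2
      · rw [heckeGen_smul_inducedVec_of_gt cs J h2, map_add, map_smulₛₗ,
          inducedBar_inducedVec cs J hw, inducedBar_inducedVec cs J h1, heckeGen_mul_heckeT_of_gt cs h2, map_add, add_smul,
          Algebra.smul_def, map_mul, barH_algebraMap, mul_smul, algebraMap_smul]
      · rw [heckeGen_smul_inducedVec_of_lt cs J h2, inducedBar_inducedVec cs J h1,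
          heckeGen_mul_heckeT_of_lt cs h2]
    · obtain ⟨t, ht, hst⟩ := exists_simple_mul_eq cs hw h1
      have hbar : barH M (heckeGen M t) • inducedVec cs J 1 = -(q • inducedVec cs J 1) := by
        have ht1 : cs.simple t * 1 ∉ minReps cs J := by
          intro h
          have := h t ht
          simp at this
        rw [barH_heckeGen, sub_smul, algebraMap_smul,
          heckeGen_smul_inducedVec_of_notMem cs J (one_mem_minReps cs) ht1]
        module
      rw [heckeGen_smul_inducedVec_of_notMem cs J hw h1, map_neg, map_smulₛₗ, barA_qInv,
        inducedBar_inducedVec cs J hw,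
        heckeGen_mul_heckeT_of_lt cs (length_lt_of_notMem_minReps cs hw h1), hst,
        ← heckeT_mul_heckeGen_of_lt cs (hw t ht), map_mul, mul_smul, hbar, smul_neg,
        smul_comm q]
  | zero => simp
  | add x y _ _ hx hy => rw [smul_add, map_add, hx, hy, map_add, smul_add]
  | smul a x _ hx => rw [smul_comm, map_smulₛₗ, hx, map_smulₛₗ, smul_comm]

theorem inducedBar_smul (h : Hecke M) (x : SPhi M J) :
    inducedBar cs J (h • x) = barH M h • inducedBar cs J x := by
  induction h using Hecke.induction generalizing x with
  | algebraMap a => rw [algebraMap_smul, barH_algebraMap, algebraMap_smul, map_smulₛₗ]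
  | gen s => exact inducedBar_heckeGen_smul cs J s x
  | mul h k hh hk => rw [mul_smul, hh, hk, map_mul, mul_smul]
  | add h k hh hk => rw [add_smul, map_add, hh, hk, map_add, add_smul]

theorem inducedBar_one : inducedBar cs J (inducedVec cs J 1) = inducedVec cs J 1 := by
  rw [inducedBar_inducedVec cs J (one_mem_minReps cs), heckeT_one, map_one, one_smul]

theorem inducedBar_inducedBar (x : SPhi M J) : inducedBar cs J (inducedBar cs J x) = x := by
  have hx : x ∈ Submodule.span LaurentZ
    (Set.range fun w : minReps cs J => inducedVec cs J (w : W)) := span_inducedVec cs J trivial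
  induction hx using Submodule.span_induction with
  | mem x hx =>
    obtain ⟨⟨w, hw⟩, rfl⟩ := hx
    simp only
    rw [inducedBar_inducedVec cs J hw, inducedBar_smul, barH_barH, inducedBar_one,
      ← inducedVec_eq_smul]
  | zero => simp
  | add x y _ _ hx hy => rw [map_add, map_add, hx, hy]
  | smul a x _ hx => rw [map_smulₛₗ, map_smulₛₗ, hx, barA_barA]

theorem isIdealModule_inducedBasis :
    IsIdealModule cs (minReps cs J) J (inducedBasis cs J) (inducedBar cs J) where
  strongAscent s w x h hx := by
    rw [inducedBasis_apply, inducedBasis_apply, hx]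
    exact heckeGen_smul_inducedVec_of_lt cs J ((bruhatLT_simple_mul_iff cs).1 h.1)
  strongDescent s w x h hx := by
    rw [inducedBasis_apply, inducedBasis_apply, hx]
    exact heckeGen_smul_inducedVec_of_gt cs J ((simple_mul_bruhatLT_iff cs).1 h)
  weakDescent s w h := by
    rw [inducedBasis_apply]
    exact heckeGen_smul_inducedVec_of_notMem cs J w.2 h.2
  weakAscent := ⟨fun _ _ => 0, fun s w h => absurd h.2.1 h.2.2⟩
  bar_bar := inducedBar_inducedBar cs J
  bar_one := ⟨one_mem_minReps cs, by rw [inducedBasis_apply]; exact inducedBar_one cs J⟩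
  bar_smul := inducedBar_smul cs J

theorem isWGraphIdeal_minReps : IsWGraphIdeal cs (minReps cs J) J :=
  ⟨fun _ _ hw h => mem_minReps_of_weakLE cs hw h, fun s hs _ hw => hw s hs,
    SPhi M J, inferInstance, inferInstance, inferInstance, inferInstance,
    inducedBasis cs J, inducedBar cs J, isIdealModule_inducedBasis cs J⟩

end InducedBasis

/-! ### Subgroups of the ring of Laurent polynomials -/

section Laurent

theorem coeff_T_mul (m : ℤ) (a : LaurentZ) (k : ℤ) :
    (LaurentPolynomial.T m * a).coeff k = a.coeff (k - m) := by
  rw [LaurentPolynomial.T, AddMonoidAlgebra.coeff_single_mul_eq_mul_coeff (k - m), one_mul]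
  intro m' _
  omega

theorem coeff_q_mul (a : LaurentZ) (k : ℤ) : (q * a).coeff k = a.coeff (k - 1) := coeff_T_mul 1 a k

theorem coeff_toLaurent_natCast (f : Polynomial ℤ) (n : ℕ) :
    (Polynomial.toLaurent f).coeff (n : ℤ) = f.coeff n := by
  rw [LaurentPolynomial.coeff_toLaurent]
  exact Finsupp.mapDomain_apply (f := Nat.castEmbedding) Nat.cast_injective _ n

theorem coeff_toLaurent_of_neg (f : Polynomial ℤ) {k : ℤ} (hk : k < 0) :
    (Polynomial.toLaurent f).coeff k = 0 := by
  rw [LaurentPolynomial.coeff_toLaurent]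
  refine Finsupp.mapDomain_of_notMem_range _ _ ?_
  rintro ⟨n, rfl⟩
  simp at hk
  omega

theorem starP_eq (f : Polynomial ℤ) :
    starP f = barA (Polynomial.toLaurent (Polynomial.expand ℤ 2 f)) := by
  rw [starP]
  induction f using Polynomial.induction_on' with
  | add f g hf hg => simp only [map_add, hf, hg]
  | monomial n a =>
    rw [Polynomial.expand_monomial, Polynomial.aeval_monomial, Polynomial.toLaurent_C_mul_T,
      map_mul]
    change _ = LaurentPolynomial.invert _ * LaurentPolynomial.invert _
    rw [LaurentPolynomial.invert_T, LaurentPolynomial.invert_C, LaurentPolynomial.T_pow]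
    congr 2

theorem coeff_barA (a : LaurentZ) (k : ℤ) : (barA a).coeff k = a.coeff (-k) :=
  LaurentPolynomial.invert_apply a k

theorem barA_T (k : ℤ) : barA (LaurentPolynomial.T k) = LaurentPolynomial.T (-k) :=
  LaurentPolynomial.invert_T k

theorem coeff_starP (f : Polynomial ℤ) (n : ℕ) : (starP f).coeff (-(2 * n : ℤ)) = f.coeff n := by
  rw [starP_eq, coeff_barA, neg_neg]
  have := coeff_toLaurent_natCast (Polynomial.expand ℤ 2 f) (2 * n)
  push_cast at this
  rw [this, mul_comm, Polynomial.coeff_expand_mul two_pos]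

theorem coeff_starP_ne_zero {f : Polynomial ℤ} {k : ℤ} (h : (starP f).coeff k ≠ 0) :
    ∃ n : ℕ, k = -(2 * n : ℤ) := by
  rw [starP_eq, coeff_barA] at h
  rcases lt_or_ge (-k) 0 with hk | hk
  · exact absurd (coeff_toLaurent_of_neg _ hk) h
  · obtain ⟨m, hm⟩ := Int.eq_ofNat_of_zero_le hk
    rw [hm, coeff_toLaurent_natCast, Polynomial.coeff_expand two_pos] at h
    split_ifs at h with h2
    · obtain ⟨n, rfl⟩ := h2
      exact ⟨n, by push_cast at hm; omega⟩
    · simp at h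

theorem starP_injective : Function.Injective starP := by
  intro f g h
  ext n
  rw [← coeff_starP, h, coeff_starP]

theorem starP_add (f g : Polynomial ℤ) : starP (f + g) = starP f + starP g := map_add _ _ _
theorem starP_neg (f : Polynomial ℤ) : starP (-f) = -starP f := map_neg _ _
theorem starP_mul (f g : Polynomial ℤ) : starP (f * g) = starP f * starP g := map_mul _ _ _
theorem starP_X : starP Polynomial.X = LaurentPolynomial.T (-2) := Polynomial.aeval_X _

/-- The Laurent polynomials without terms of negative degree. -/
noncomputable def nonnegPart : AddSubgroup LaurentZ :=
  (Polynomial.toLaurent (R := ℤ)).toAddMonoidHom.range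

/-- The subgroup `q ℤ[q]`. -/
noncomputable def posPart : AddSubgroup LaurentZ where
  carrier := {a | ∃ f : Polynomial ℤ, a = q * Polynomial.toLaurent f}
  zero_mem' := ⟨0, by simp⟩
  add_mem' := by
    rintro _ _ ⟨f, rfl⟩ ⟨g, rfl⟩
    exact ⟨f + g, by rw [map_add, mul_add]⟩
  neg_mem' := by
    rintro _ ⟨f, rfl⟩
    exact ⟨-f, by rw [map_neg, mul_neg]⟩

/-- The subgroup `q^n ℤ[q⁻²]`. -/
noncomputable def starPart (n : ℤ) : AddSubgroup LaurentZ where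
  carrier := {a | ∃ f : Polynomial ℤ, a = LaurentPolynomial.T n * starP f}
  zero_mem' := ⟨0, by simp [starP]⟩
  add_mem' := by
    rintro _ _ ⟨f, rfl⟩ ⟨g, rfl⟩
    exact ⟨f + g, by rw [starP_add, mul_add]⟩
  neg_mem' := by
    rintro _ ⟨f, rfl⟩
    exact ⟨-f, by rw [starP_neg, mul_neg]⟩

theorem one_mem_nonnegPart : (1 : LaurentZ) ∈ nonnegPart :=
  ⟨1, map_one (Polynomial.toLaurent (R := ℤ))⟩

theorem q_mul_mem_posPart {a : LaurentZ} (h : a ∈ nonnegPart) : q * a ∈ posPart := by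
  obtain ⟨f, rfl⟩ := h; exact ⟨f, rfl⟩

theorem posPart_le_nonnegPart : posPart ≤ nonnegPart := by
  rintro _ ⟨f, rfl⟩
  exact ⟨Polynomial.X * f, by
    change Polynomial.toLaurent _ = _
    rw [map_mul, Polynomial.toLaurent_X, q]⟩

theorem qInv_mul_sub_mem_posPart {a : LaurentZ} (h : a ∈ posPart) :
    qInv * a - (a.coeff 1 : LaurentZ) ∈ posPart := by
  obtain ⟨f, rfl⟩ := h
  rw [← mul_assoc, mul_comm qInv, q_mul_qInv, one_mul, coeff_q_mul]
  have h0 := coeff_toLaurent_natCast f 0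
  rw [Nat.cast_zero] at h0
  rw [sub_self, h0]
  refine ⟨f.divX, ?_⟩
  conv_lhs => rw [← Polynomial.divX_mul_X_add f]
  rw [map_add, map_mul, Polynomial.toLaurent_X, mul_comm, q]
  simp

theorem coeff_of_mem_posPart {a : LaurentZ} (h : a ∈ posPart) {k : ℤ} (hk : k ≤ 0) :
    a.coeff k = 0 := by
  obtain ⟨f, rfl⟩ := h
  rw [coeff_q_mul]
  exact coeff_toLaurent_of_neg f (by omega)

theorem eq_zero_of_mem_posPart {a : LaurentZ} (h : a ∈ posPart) (hb : barA a = a) : a = 0 := by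
  ext k
  rw [AddMonoidAlgebra.coeff_zero, Finsupp.zero_apply]
  rcases le_or_gt k 0 with hk | hk
  · exact coeff_of_mem_posPart h hk
  · rw [← hb, coeff_barA]
    exact coeff_of_mem_posPart h (by omega)

theorem T_mul_mem_starPart {a : LaurentZ} {n : ℤ} (h : a ∈ starPart n) (k : ℤ) :
    LaurentPolynomial.T k * a ∈ starPart (k + n) := by
  obtain ⟨f, rfl⟩ := h
  exact ⟨f, by rw [← mul_assoc, ← LaurentPolynomial.T_add]⟩

theorem starPart_mono {a : LaurentZ} {n : ℤ} (h : a ∈ starPart n) (k : ℕ) :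
    a ∈ starPart (n + 2 * k) := by
  induction k with
  | zero => simpa using h
  | succ k ih =>
    obtain ⟨f, rfl⟩ := ih
    refine ⟨Polynomial.X * f, ?_⟩
    rw [starP_mul, starP_X, ← mul_assoc, ← LaurentPolynomial.T_add]
    congr 2
    push_cast; ring

theorem coeff_ne_zero_of_mem_starPart {a : LaurentZ} {n : ℤ} (h : a ∈ starPart n) {k : ℤ}
    (hk : a.coeff k ≠ 0) : ∃ j : ℕ, n = k + 2 * j := by
  obtain ⟨f, rfl⟩ := h
  rw [coeff_T_mul] at hk
  obtain ⟨j, hj⟩ := coeff_starP_ne_zero hk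
  exact ⟨j, by omega⟩

theorem intCast_mul_mem {H : AddSubgroup LaurentZ} {a : LaurentZ} (h : a ∈ H) (n : ℤ) :
    (n : LaurentZ) * a ∈ H := by
  rw [← zsmul_eq_mul]; exact H.zsmul_mem h n

end Laurent

/-! ### Coordinates with respect to the basis `b_w` -/

/-- The coordinates of the image of a semilinear map, in terms of its matrix. -/
theorem repr_semilinear_apply {V S : Type*} [AddCommGroup S] [Module LaurentZ S]
    (b : Module.Basis V LaurentZ S) (f : S →ₛₗ[barA] S) (x : S) (y : V) :
    b.repr (f x) y = (b.repr x).sum fun z a => barA a * b.repr (f (b z)) y := by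
  conv_lhs => rw [← b.linearCombination_repr x, Finsupp.linearCombination_apply, Finsupp.sum,
    map_sum, map_sum, Finsupp.finsetSum_apply]
  exact Finset.sum_congr rfl fun z _ => by
    rw [map_smulₛₗ, map_smul, Finsupp.smul_apply, smul_eq_mul]

namespace IsIdealModule

variable {M : CoxeterMatrix B} {cs : CoxeterSystem M W} {J : Set B} {S : Type*} [AddCommGroup S]
  [Module LaurentZ S] [Module (Hecke M) S]
  {b : Module.Basis (minReps cs J) LaurentZ S} {bar : S →ₛₗ[barA] S}

theorem gen_smul_of_lt (h : IsIdealModule cs (minReps cs J) J b bar) {s : B} {w x : minReps cs J}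
    (hx : (x : W) = cs.simple s * w) (hl : cs.length (w : W) < cs.length (x : W)) :
    heckeGen M s • b w = b x :=
  h.strongAscent s w x ⟨(bruhatLT_simple_mul_iff cs).2 (hx ▸ hl), hx ▸ x.2⟩ hx

theorem gen_smul_of_gt (h : IsIdealModule cs (minReps cs J) J b bar) {s : B} {w x : minReps cs J}
    (hx : (x : W) = cs.simple s * w) (hl : cs.length (x : W) < cs.length (w : W)) :
    heckeGen M s • b w = b x + (q - qInv) • b w :=
  h.strongDescent s w x ((simple_mul_bruhatLT_iff cs).2 (hx ▸ hl)) hx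

theorem gen_smul_of_notMem (h : IsIdealModule cs (minReps cs J) J b bar) {s : B} {w : minReps cs J}
    (hx : cs.simple s * (w : W) ∉ minReps cs J) : heckeGen M s • b w = -(qInv • b w) :=
  h.weakDescent s w
    ⟨(bruhatLT_simple_mul_iff cs).2 (length_lt_of_notMem_minReps cs w.2 hx), hx⟩

theorem eq_simple_mul_comm {s : B} {x y : W} (h : x = cs.simple s * y) : y = cs.simple s * x := by
  rw [h, cs.simple_mul_simple_cancel_left]

variable (cs J) in
/-- The three cases for the position of `s w` relative to `w` and `D_J`. -/
theorem cases_simple_mul (s : B) (w : minReps cs J) :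
    (cs.simple s * (w : W) ∉ minReps cs J) ∨
    (∃ x : minReps cs J, (x : W) = cs.simple s * w ∧ cs.length (w : W) < cs.length (x : W)) ∨
    (∃ x : minReps cs J, (x : W) = cs.simple s * w ∧ cs.length (x : W) < cs.length (w : W)) := by
  by_cases h : cs.simple s * (w : W) ∈ minReps cs J
  · right
    rcases lt_or_gt_of_ne (cs.length_simple_mul_ne (w : W) s) with h1 | h1
    · exact Or.inr ⟨⟨_, h⟩, rfl, h1⟩
    · exact Or.inl ⟨⟨_, h⟩, rfl, h1⟩
  · exact Or.inl h

variable [IsScalarTower LaurentZ (Hecke M) S]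

theorem repr_gen_smul_of_notMem (h : IsIdealModule cs (minReps cs J) J b bar) {s : B}
    {y : minReps cs J} (hy : cs.simple s * (y : W) ∉ minReps cs J) (x : S) :
    b.repr (heckeGen M s • x) y = -qInv * b.repr x y := by
  have key : b.coord y ∘ₗ Algebra.lsmul LaurentZ LaurentZ S (heckeGen M s) =
      (-qInv) • b.coord y := by
    refine b.ext fun z => ?_
    simp only [LinearMap.comp_apply, Algebra.lsmul_coe, LinearMap.smul_apply,
      Module.Basis.coord_apply, Module.Basis.repr_self, smul_eq_mul]
    rcases cases_simple_mul cs J s z with hz | ⟨z', hz, hl⟩ | ⟨z', hz, hl⟩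
    · rw [h.gen_smul_of_notMem hz, map_neg, map_smul, Module.Basis.repr_self, Finsupp.neg_apply,
        Finsupp.smul_apply, smul_eq_mul, neg_mul]
    all_goals
      have e1 : z ≠ y := by rintro rfl; exact hy (hz ▸ z'.2)
      have e2 : z' ≠ y := by rintro rfl; exact hy (eq_simple_mul_comm hz ▸ z.2)
    · rw [h.gen_smul_of_lt hz hl]
      simp [Finsupp.single_eq_of_ne e1.symm, Finsupp.single_eq_of_ne e2.symm]
    · rw [h.gen_smul_of_gt hz hl]
      simp [Finsupp.single_eq_of_ne e1.symm, Finsupp.single_eq_of_ne e2.symm]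
  exact LinearMap.congr_fun key x

theorem repr_gen_smul_of_lt (h : IsIdealModule cs (minReps cs J) J b bar) {s : B}
    {y y' : minReps cs J} (hy : (y' : W) = cs.simple s * y)
    (hl : cs.length (y : W) < cs.length (y' : W)) (x : S) :
    b.repr (heckeGen M s • x) y = b.repr x y' := by
  classical
  have key : b.coord y ∘ₗ Algebra.lsmul LaurentZ LaurentZ S (heckeGen M s) = b.coord y' := by
    refine b.ext fun z => ?_
    simp only [LinearMap.comp_apply, Algebra.lsmul_coe, Module.Basis.coord_apply,
      Module.Basis.repr_self]
    have hy' := eq_simple_mul_comm hy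
    rcases cases_simple_mul cs J s z with hz | ⟨z', hz, hlz⟩ | ⟨z', hz, hlz⟩
    · have e1 : z ≠ y := by rintro rfl; exact hz (hy ▸ y'.2)
      have e2 : z ≠ y' := by rintro rfl; exact hz (hy' ▸ y.2)
      rw [h.gen_smul_of_notMem hz]
      simp [Finsupp.single_eq_of_ne e1.symm, Finsupp.single_eq_of_ne e2.symm]
    · have e1 : z' ≠ y := by
        rintro rfl
        rw [← Subtype.ext (hy.trans (eq_simple_mul_comm hz).symm)] at hlz
        omega
      have e2 : z ≠ y' := by
        rintro rfl
        rw [Subtype.ext (hz.trans hy'.symm)] at hlz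
        omega
      rw [h.gen_smul_of_lt hz hlz]
      simp [Finsupp.single_eq_of_ne e1.symm, Finsupp.single_eq_of_ne e2.symm]
    · have e1 : z ≠ y := by
        rintro rfl
        rw [Subtype.ext (hz.trans hy.symm)] at hlz
        omega
      have e2 : z' = y ↔ z = y' := by
        constructor
        · rintro rfl; exact Subtype.ext ((eq_simple_mul_comm hz).trans hy.symm)
        · rintro rfl; exact Subtype.ext (hz.trans hy'.symm)
      rw [h.gen_smul_of_gt hz hlz]
      simp [Finsupp.single_eq_of_ne e1.symm, Finsupp.single_apply, e2]
  exact LinearMap.congr_fun key x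

theorem repr_gen_smul_of_gt (h : IsIdealModule cs (minReps cs J) J b bar) {s : B}
    {y y' : minReps cs J} (hy : (y' : W) = cs.simple s * y)
    (hl : cs.length (y' : W) < cs.length (y : W)) (x : S) :
    b.repr (heckeGen M s • x) y = b.repr x y' + (q - qInv) * b.repr x y := by
  classical
  -- Apply `T_s² = 1 + (q - q⁻¹) T_s` to the coordinate at `y'`.
  have h1 := h.repr_gen_smul_of_lt (eq_simple_mul_comm hy) hl (heckeGen M s • x)
  rw [← mul_smul, heckeGen_sq, add_smul, one_smul, mul_smul, algebraMap_smul, map_add, map_smul,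
    Finsupp.add_apply, Finsupp.smul_apply, h.repr_gen_smul_of_lt (eq_simple_mul_comm hy) hl] at h1
  exact h1.symm

/-! ### The matrix of the bar involution -/

theorem bar_basis_eq (h : IsIdealModule cs (minReps cs J) J b bar) {s : B}
    {w v : minReps cs J} (hw : (v : W) = cs.simple s * w)
    (hl : cs.length (v : W) < cs.length (w : W)) :
    bar (b w) = heckeGen M s • bar (b v) - (q - qInv) • bar (b v) := by
  rw [← h.gen_smul_of_lt (eq_simple_mul_comm hw) hl, h.bar_smul, barH_heckeGen, sub_smul,
    algebraMap_smul]

theorem repr_bar_of_gt (h : IsIdealModule cs (minReps cs J) J b bar) {s : B}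
    {w v y y' : minReps cs J} (hw : (v : W) = cs.simple s * w)
    (hl : cs.length (v : W) < cs.length (w : W)) (hy : (y' : W) = cs.simple s * y)
    (hly : cs.length (y' : W) < cs.length (y : W)) :
    b.repr (bar (b w)) y = b.repr (bar (b v)) y' := by
  rw [h.bar_basis_eq hw hl, map_sub, map_smul b.repr (q - qInv), Finsupp.sub_apply,
    Finsupp.smul_apply, h.repr_gen_smul_of_gt hy hly, smul_eq_mul]
  ring

theorem repr_bar_of_lt (h : IsIdealModule cs (minReps cs J) J b bar) {s : B}
    {w v y y' : minReps cs J} (hw : (v : W) = cs.simple s * w)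
    (hl : cs.length (v : W) < cs.length (w : W)) (hy : (y' : W) = cs.simple s * y)
    (hly : cs.length (y : W) < cs.length (y' : W)) :
    b.repr (bar (b w)) y = b.repr (bar (b v)) y' - (q - qInv) * b.repr (bar (b v)) y := by
  rw [h.bar_basis_eq hw hl, map_sub, map_smul b.repr (q - qInv), Finsupp.sub_apply,
    Finsupp.smul_apply, h.repr_gen_smul_of_lt hy hly, smul_eq_mul]

theorem repr_bar_of_notMem (h : IsIdealModule cs (minReps cs J) J b bar) {s : B}
    {w v y : minReps cs J} (hw : (v : W) = cs.simple s * w)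
    (hl : cs.length (v : W) < cs.length (w : W)) (hy : cs.simple s * (y : W) ∉ minReps cs J) :
    b.repr (bar (b w)) y = -q * b.repr (bar (b v)) y := by
  rw [h.bar_basis_eq hw hl, map_sub, map_smul b.repr (q - qInv), Finsupp.sub_apply,
    Finsupp.smul_apply, h.repr_gen_smul_of_notMem hy, smul_eq_mul]
  ring

variable (cs J) in
theorem exists_descent {w : minReps cs J} (hw : (w : W) ≠ 1) :
    ∃ (s : B) (v : minReps cs J), (v : W) = cs.simple s * w ∧
      cs.length (w : W) = cs.length (v : W) + 1 := by
  obtain ⟨s, hs⟩ := cs.exists_leftDescent_of_ne_one hw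
  have h1 := (cs.isLeftDescent_iff).1 hs
  exact ⟨s, ⟨_, simple_mul_mem_minReps cs w.2 hs⟩, rfl, h1.symm⟩

variable (cs J) in
/-- Induction along left descents inside `D_J`. -/
@[elab_as_elim]
theorem descent_induction {motive : minReps cs J → Prop}
    (one : motive ⟨1, one_mem_minReps cs⟩)
    (step : ∀ (s : B) (w v : minReps cs J), (v : W) = cs.simple s * w →
      cs.length (w : W) = cs.length (v : W) + 1 →
      (∀ x : minReps cs J, cs.length (x : W) < cs.length (w : W) → motive x) → motive w)
    (w : minReps cs J) : motive w := by
  obtain ⟨n, hn⟩ : ∃ n, cs.length (w : W) = n := ⟨_, rfl⟩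
  induction n using Nat.strong_induction_on generalizing w with
  | _ n ih =>
    by_cases hw : (w : W) = 1
    · have : w = ⟨1, one_mem_minReps cs⟩ := Subtype.ext hw
      rw [this]; exact one
    · obtain ⟨s, v, h1, h2⟩ := exists_descent cs J hw
      exact step s w v h1 h2 fun x hx => ih _ (by omega) x rfl

/-- If `x` or `s x` lies below `v` and `v < sv = w`, then `x` lies below `w`. -/
theorem bruhatLE_of_simple_mul {s : B} {v w y y' : W} (hw : v = cs.simple s * w)
    (hl : cs.length v < cs.length w) (hy : y' = cs.simple s * y) (h : BruhatLE cs y' v) :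
    BruhatLE cs y w := by
  have := simple_mul_bruhatLE_of_lt cs (s := s) h
  rw [← eq_simple_mul_comm hw, ← eq_simple_mul_comm hy] at this
  exact this hl

theorem bruhatLE_of_descent {s : B} {v w : W} (hw : v = cs.simple s * w)
    (hl : cs.length v < cs.length w) : BruhatLE cs v w := by
  subst hw; exact simple_mul_bruhatLE cs hl

/-- The matrix of the bar involution is triangular with respect to the Bruhat order. -/
theorem bruhatLE_of_repr_bar_ne_zero (h : IsIdealModule cs (minReps cs J) J b bar)
    {y w : minReps cs J} (hr : b.repr (bar (b w)) y ≠ 0) : BruhatLE cs (y : W) w := by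
  induction w using descent_induction cs J generalizing y with
  | one =>
    obtain ⟨h1, h2⟩ := h.bar_one
    rw [h2, Module.Basis.repr_self] at hr
    have := Finsupp.single_apply_ne_zero.1 hr
    rw [this.1]
    exact bruhatLE_refl cs _
  | step s w v hw hl ih =>
    have hl' : cs.length (v : W) < cs.length (w : W) := by omega
    have hvw := bruhatLE_of_descent hw hl'
    by_cases hz : b.repr (bar (b v)) y = 0
    · rcases cases_simple_mul cs J s y with hy | ⟨y', hy, hly⟩ | ⟨y', hy, hly⟩
      · rw [h.repr_bar_of_notMem hw hl' hy, hz, mul_zero] at hr; exact absurd rfl hr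
      · rw [h.repr_bar_of_lt hw hl' hy hly, hz, mul_zero, sub_zero] at hr
        exact bruhatLE_of_simple_mul hw hl' hy (ih v hl' hr)
      · rw [h.repr_bar_of_gt hw hl' hy hly] at hr
        exact bruhatLE_of_simple_mul hw hl' hy (ih v hl' hr)
    · exact (ih v hl' hz).trans hvw

theorem repr_bar_self (h : IsIdealModule cs (minReps cs J) J b bar) (w : minReps cs J) :
    b.repr (bar (b w)) w = 1 := by
  induction w using descent_induction cs J with
  | one =>
    obtain ⟨h1, h2⟩ := h.bar_one
    rw [h2]; simp
  | step s w v hw hl ih =>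
    rw [h.repr_bar_of_gt hw (by omega) hw (by omega), ih v (by omega)]

/-- A coordinate of maximal length of a bar invariant vector is bar invariant. -/
theorem exists_maximal_coord (h : IsIdealModule cs (minReps cs J) J b bar) {x : S}
    (hx : bar x = x) (h0 : x ≠ 0) : ∃ y, b.repr x y ≠ 0 ∧ barA (b.repr x y) = b.repr x y ∧
      ∀ z, b.repr x z ≠ 0 → cs.length (z : W) ≤ cs.length (y : W) := by
  have hs : (b.repr x).support.Nonempty := by
    rw [Finsupp.support_nonempty_iff]
    simpa using h0
  obtain ⟨y, hy, hmax⟩ := Finset.exists_max_image _ (fun z : minReps cs J => cs.length (z : W)) hs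
  have hmax' : ∀ z, b.repr x z ≠ 0 → cs.length (z : W) ≤ cs.length (y : W) :=
    fun z hz => hmax z (Finsupp.mem_support_iff.2 hz)
  refine ⟨y, Finsupp.mem_support_iff.1 hy, ?_, hmax'⟩
  have h1 := repr_semilinear_apply b bar x y
  rw [hx, Finsupp.sum, Finset.sum_eq_single y, h.repr_bar_self, mul_one] at h1
  · exact h1.symm
  · intro z hz hne
    by_contra h2
    have h3 := h.bruhatLE_of_repr_bar_ne_zero (right_ne_zero_of_mul h2)
    exact hne (Subtype.ext (h3.eq_of_length_le (hmax z hz))).symm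
  · intro h2; exact absurd hy h2

/-- A bar invariant vector with all coordinates in `q ℤ[q]` vanishes. -/
theorem eq_zero_of_repr_mem_posPart (h : IsIdealModule cs (minReps cs J) J b bar) {x : S}
    (hx : bar x = x) (hp : ∀ y, b.repr x y ∈ posPart) : x = 0 := by
  by_contra h0
  obtain ⟨y, h1, h2, -⟩ := h.exists_maximal_coord hx h0
  exact h1 (eq_zero_of_mem_posPart (hp y) h2)

end IsIdealModule

/-! ### The canonical basis -/

section Descents

variable {M : CoxeterMatrix B} {cs : CoxeterSystem M W} {J : Set B} {s : B} {y y' : minReps cs J}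

theorem mem_descents_of_notMem (hy : cs.simple s * (y : W) ∉ minReps cs J) :
    s ∈ descents cs J (y : W) :=
  Or.inr ⟨(bruhatLT_simple_mul_iff cs).2 (length_lt_of_notMem_minReps cs y.2 hy), hy⟩

theorem mem_descents_of_gt (hy : (y' : W) = cs.simple s * y)
    (hl : cs.length (y' : W) < cs.length (y : W)) : s ∈ descents cs J (y : W) :=
  Or.inl ((simple_mul_bruhatLT_iff cs).2 (hy ▸ hl))

theorem notMem_descents_of_lt (hy : (y' : W) = cs.simple s * y)
    (hl : cs.length (y : W) < cs.length (y' : W)) : s ∉ descents cs J (y : W) := by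
  rintro (h | h)
  · have := (simple_mul_bruhatLT_iff cs).1 h
    rw [← hy] at this
    omega
  · exact h.2 (hy ▸ y'.2)

end Descents

section Canonical

variable {M : CoxeterMatrix B} {cs : CoxeterSystem M W} {J : Set B} {S : Type*} [AddCommGroup S]
  [Module LaurentZ S]

/-- `c` is the canonical basis element `c_w`: it is bar invariant, its coordinate at `b_w` is `1`,
its other coordinates lie in `q ℤ[q]`, vanish unless `y ≤ w`, and lie in
`q^{l(w) - l(y)} ℤ[q⁻²]`. -/
structure IsCanonical (b : Module.Basis (minReps cs J) LaurentZ S) (bar : S →ₛₗ[barA] S)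
    (w : minReps cs J) (c : S) : Prop where
  bar_eq : bar c = c
  self : b.repr c w = 1
  le : ∀ y, b.repr c y ≠ 0 → BruhatLE cs (y : W) w
  pos : ∀ y, y ≠ w → b.repr c y ∈ posPart
  star : ∀ y : minReps cs J, b.repr c y ∈ starPart (cs.length (w : W) - cs.length (y : W))

variable {b : Module.Basis (minReps cs J) LaurentZ S} {bar : S →ₛₗ[barA] S}

theorem IsCanonical.nonneg {w : minReps cs J} {c : S} (hc : IsCanonical b bar w c)
    (y : minReps cs J) : b.repr c y ∈ nonnegPart := by
  by_cases hy : y = w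
  · rw [hy, hc.self]; exact one_mem_nonnegPart
  · exact posPart_le_nonnegPart (hc.pos y hy)

theorem IsCanonical.eq_zero_of_length_le {w : minReps cs J} {c : S} (hc : IsCanonical b bar w c)
    {y : minReps cs J} (hy : y ≠ w) (hl : cs.length (w : W) ≤ cs.length (y : W)) :
    b.repr c y = 0 := by
  by_contra h
  exact hy (Subtype.ext ((hc.le y h).eq_of_length_le hl))

open Classical in
/-- The set of the `x` that have the descent `s` and at which `c` has a nonzero coordinate. -/
noncomputable def descentSupport (b : Module.Basis (minReps cs J) LaurentZ S) (s : B) (c : S) :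
    Finset (minReps cs J) :=
  (b.repr c).support.filter fun x => s ∈ descents cs J (x : W)

theorem mem_descentSupport {s : B} {c : S} {x : minReps cs J} :
    x ∈ descentSupport b s c ↔ b.repr c x ≠ 0 ∧ s ∈ descents cs J (x : W) := by
  simp [descentSupport]

theorem IsCanonical.le_of_mem_descentSupport {s : B} {v w x : minReps cs J} {c : S}
    (hc : IsCanonical b bar v c) (hw : (w : W) = cs.simple s * v)
    (hl : cs.length (v : W) < cs.length (w : W)) (hx : x ∈ descentSupport b s c) :
    BruhatLE cs (x : W) v ∧ cs.length (x : W) < cs.length (v : W) := by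
  rw [mem_descentSupport] at hx
  have h1 := hc.le x hx.1
  refine ⟨h1, ?_⟩
  by_contra h2
  have h3 : x = v := Subtype.ext (h1.eq_of_length_le (by omega))
  exact notMem_descents_of_lt hw hl (h3 ▸ hx.2)

open Classical in
/-- The correction term `∑ n_x c_x`, with `n_x` the coefficient of `q` in the coordinate of `c_v`
at `x`, has the coordinates `n_y` modulo `q ℤ[q]`. -/
theorem sum_descentSupport_sub_mem_posPart {s : B} {c : S} {C : minReps cs J → S}
    (hC : ∀ x ∈ descentSupport b s c, IsCanonical b bar x (C x)) (y : minReps cs J) :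
    b.repr (∑ x ∈ descentSupport b s c, (b.repr c x).coeff 1 • C x) y -
      (if s ∈ descents cs J (y : W) then (((b.repr c y).coeff 1 : ℤ) : LaurentZ) else 0) ∈
      posPart := by
  rw [map_sum, Finsupp.finsetSum_apply]
  simp only [map_zsmul, Finsupp.smul_apply, zsmul_eq_mul]
  by_cases hy : y ∈ descentSupport b s c
  · rw [← Finset.add_sum_erase _ _ hy, (hC y hy).self, if_pos (mem_descentSupport.1 hy).2, mul_one,
      add_sub_cancel_left]
    refine sum_mem fun x hx => intCast_mul_mem ((hC x (Finset.mem_of_mem_erase hx)).pos y ?_) _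
    exact (Finset.ne_of_mem_erase hx).symm
  · have h0 : (if s ∈ descents cs J (y : W) then (((b.repr c y).coeff 1 : ℤ) : LaurentZ) else 0) =
        0 := by
      split_ifs with h
      · have : b.repr c y = 0 := by
          by_contra h'
          exact hy (mem_descentSupport.2 ⟨h', h⟩)
        simp [this]
      · rfl
    rw [h0, sub_zero]
    refine sum_mem fun x hx => intCast_mul_mem ((hC x hx).pos y ?_) _
    rintro rfl
    exact hy hx

namespace IsIdealModule

variable [Module (Hecke M) S]

theorem isCanonical_one (h : IsIdealModule cs (minReps cs J) J b bar) :
    IsCanonical b bar ⟨1, one_mem_minReps cs⟩ (b ⟨1, one_mem_minReps cs⟩) := by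
  classical
  obtain ⟨h1, h2⟩ := h.bar_one
  refine ⟨h2, by simp, fun y hy => ?_, fun y hy => ?_, fun y => ?_⟩
  · rw [Module.Basis.repr_self] at hy
    rw [(Finsupp.single_apply_ne_zero.1 hy).1]
    exact bruhatLE_refl cs _
  · rw [Module.Basis.repr_self, Finsupp.single_eq_of_ne hy]
    exact zero_mem _
  · rw [Module.Basis.repr_self, Finsupp.single_apply]
    split_ifs with hy
    · rw [← hy, sub_self]
      exact ⟨1, by simp [starP]⟩
    · exact zero_mem _

variable [IsScalarTower LaurentZ (Hecke M) S]

theorem bar_gen_smul_sub (h : IsIdealModule cs (minReps cs J) J b bar) {c : S} (hc : bar c = c)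
    (s : B) : bar (heckeGen M s • c - q • c) = heckeGen M s • c - q • c := by
  rw [map_sub, h.bar_smul, map_smulₛₗ, hc, barH_heckeGen, barA_q, sub_smul, algebraMap_smul]
  generalize heckeGen M s • c = x
  module

theorem bar_gen_smul_add (h : IsIdealModule cs (minReps cs J) J b bar) {c : S} (hc : bar c = c)
    (s : B) : bar (heckeGen M s • c + qInv • c) = heckeGen M s • c + qInv • c := by
  rw [map_add, h.bar_smul, map_smulₛₗ, hc, barH_heckeGen, barA_qInv, sub_smul, algebraMap_smul]
  generalize heckeGen M s • c = x
  module

/-- The inductive construction `c_{sv} = (T_s - q) c_v + ∑ n_x c_x` of the canonical basis. -/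
theorem isCanonical_step (h : IsIdealModule cs (minReps cs J) J b bar) {s : B}
    {v w : minReps cs J} (hw : (w : W) = cs.simple s * v)
    (hl : cs.length (v : W) < cs.length (w : W)) {c : S} (hc : IsCanonical b bar v c)
    {C : minReps cs J → S} (hC : ∀ x ∈ descentSupport b s c, IsCanonical b bar x (C x)) :
    IsCanonical b bar w (heckeGen M s • c - q • c +
      ∑ x ∈ descentSupport b s c, (b.repr c x).coeff 1 • C x) := by
  classical
  have hv := eq_simple_mul_comm hw
  have hlw : cs.length (w : W) = cs.length (v : W) + 1 := by
    have := cs.length_simple_mul (v : W) s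
    rw [← hw] at this
    omega
  have hvw : BruhatLE cs (v : W) w := bruhatLE_of_descent hv hl
  have hF : ∀ x ∈ descentSupport b s c, BruhatLE cs (x : W) v ∧
    cs.length (x : W) < cs.length (v : W) := fun x hx => hc.le_of_mem_descentSupport hw hl hx
  have coordS : ∀ y, b.repr (∑ x ∈ descentSupport b s c, (b.repr c x).coeff 1 • C x) y =
      ∑ x ∈ descentSupport b s c, (((b.repr c x).coeff 1 : ℤ) : LaurentZ) * b.repr (C x) y := by
    intro y
    rw [map_sum, Finsupp.finsetSum_apply]
    simp only [map_zsmul, Finsupp.smul_apply, zsmul_eq_mul]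
  have coord : ∀ y, b.repr (heckeGen M s • c - q • c +
      ∑ x ∈ descentSupport b s c, (b.repr c x).coeff 1 • C x) y =
      (b.repr (heckeGen M s • c) y - q * b.repr c y) +
      b.repr (∑ x ∈ descentSupport b s c, (b.repr c x).coeff 1 • C x) y := by
    intro y
    rw [map_add, map_sub, map_smul b.repr q, Finsupp.add_apply, Finsupp.sub_apply,
      Finsupp.smul_apply, smul_eq_mul]
  refine ⟨?_, ?_, ?_, ?_, ?_⟩
  · rw [map_add, h.bar_gen_smul_sub hc.bar_eq, map_sum]
    congr 1
    exact Finset.sum_congr rfl fun x hx => by rw [map_zsmul, (hC x hx).bar_eq]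
  · have hw0 : b.repr c w = 0 :=
      hc.eq_zero_of_length_le (by rintro rfl; omega) hl.le
    rw [coord, coordS, h.repr_gen_smul_of_gt hv hl, hc.self, hw0, Finset.sum_eq_zero]
    · ring
    · intro x hx
      have := (hF x hx).2
      rw [(hC x hx).eq_zero_of_length_le (by rintro rfl; omega) (by omega), mul_zero]
  · intro y hy
    by_contra hyw
    apply hy
    have hyv : b.repr c y = 0 := by
      by_contra h'
      exact hyw ((hc.le y h').trans hvw)
    have hsum : ∑ x ∈ descentSupport b s c,
        (((b.repr c x).coeff 1 : ℤ) : LaurentZ) * b.repr (C x) y = 0 := by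
      refine Finset.sum_eq_zero fun x hx => ?_
      have : b.repr (C x) y = 0 := by
        by_contra h'
        exact hyw ((((hC x hx).le y h').trans (hF x hx).1).trans hvw)
      rw [this, mul_zero]
    have hsy : ∀ y' : minReps cs J, (y' : W) = cs.simple s * y → b.repr c y' = 0 := by
      intro y' hy'
      by_contra h'
      exact hyw (bruhatLE_of_simple_mul hv hl hy' (hc.le y' h'))
    rw [coord, coordS, hsum, hyv]
    rcases cases_simple_mul cs J s y with hys | ⟨y', hys, hly⟩ | ⟨y', hys, hly⟩
    · rw [h.repr_gen_smul_of_notMem hys, hyv]; ring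
    · rw [h.repr_gen_smul_of_lt hys hly, hsy y' hys]; ring
    · rw [h.repr_gen_smul_of_gt hys hly, hyv, hsy y' hys]; ring
  · intro y hyw
    have h1 := sum_descentSupport_sub_mem_posPart hC y
    rw [coord]
    suffices h2 : b.repr (heckeGen M s • c) y - q * b.repr c y +
        (if s ∈ descents cs J (y : W) then (((b.repr c y).coeff 1 : ℤ) : LaurentZ) else 0) ∈
        posPart by
      have := add_mem h2 h1
      rwa [add_add_sub_cancel] at this
    have hq : q * b.repr c y ∈ posPart := q_mul_mem_posPart (hc.nonneg y)
    rcases cases_simple_mul cs J s y with hys | ⟨y', hys, hly⟩ | ⟨y', hys, hly⟩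
    · have hyv : y ≠ v := by rintro rfl; exact hys (hw ▸ w.2)
      rw [h.repr_gen_smul_of_notMem hys, if_pos (mem_descents_of_notMem hys)]
      have := neg_mem (add_mem (qInv_mul_sub_mem_posPart (hc.pos y hyv)) hq)
      convert this using 1
      ring
    · have hyv : y' ≠ v := by
        rintro rfl
        have h3 : y = w := Subtype.ext ((eq_simple_mul_comm hys).trans hw.symm)
        exact hyw h3
      rw [h.repr_gen_smul_of_lt hys hly, if_neg (notMem_descents_of_lt hys hly), add_zero]
      exact sub_mem (hc.pos y' hyv) hq
    · have hyv : y ≠ v := by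
        rintro rfl
        rw [Subtype.ext (hys.trans hw.symm)] at hly
        omega
      have hyv' : y' ≠ v := by
        rintro rfl
        exact hyw (Subtype.ext ((eq_simple_mul_comm hys).trans hw.symm))
      rw [h.repr_gen_smul_of_gt hys hly, if_pos (mem_descents_of_gt hys hly)]
      have := sub_mem (hc.pos y' hyv') (qInv_mul_sub_mem_posPart (hc.pos y hyv))
      convert this using 1
      ring
  · intro y
    rw [coord, coordS]
    have hqs : q * b.repr c y ∈ starPart (cs.length (w : W) - cs.length (y : W)) := by
      have := T_mul_mem_starPart (hc.star y) 1
      convert this using 1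
      · rw [hlw]; push_cast; ring_nf
      · rfl
    have hqi : qInv * b.repr c y ∈ starPart (cs.length (w : W) - cs.length (y : W)) := by
      have := starPart_mono (T_mul_mem_starPart (hc.star y) (-1)) 1
      convert this using 1
      · rw [hlw]; push_cast; ring_nf
      · rfl
    refine add_mem (sub_mem ?_ hqs) (sum_mem fun x hx => ?_)
    · rcases cases_simple_mul cs J s y with hys | ⟨y', hys, hly⟩ | ⟨y', hys, hly⟩
      · rw [h.repr_gen_smul_of_notMem hys, neg_mul]
        exact neg_mem hqi
      · rw [h.repr_gen_smul_of_lt hys hly]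
        have hly' : cs.length (y' : W) = cs.length (y : W) + 1 := by
          have := cs.length_simple_mul (y : W) s
          rw [← hys] at this
          omega
        have := starPart_mono (hc.star y') 1
        convert this using 1
        rw [hlw, hly']; push_cast; ring_nf
      · rw [h.repr_gen_smul_of_gt hys hly, sub_mul]
        have hly' : cs.length (y : W) = cs.length (y' : W) + 1 := by
          have := cs.length_simple_mul (y : W) s
          rw [← hys] at this
          omega
        refine add_mem ?_ (sub_mem hqs hqi)
        have := hc.star y'
        convert this using 1
        rw [hlw, hly']; push_cast; ring_nf
    · -- A nonzero coefficient of `q` at `x` forces `l(v) - l(x)` to be odd.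
      by_cases hn : (b.repr c x).coeff 1 = 0
      · rw [hn]; simp
      · obtain ⟨j, hj⟩ := coeff_ne_zero_of_mem_starPart (hc.star x) hn
        apply intCast_mul_mem
        have := starPart_mono ((hC x hx).star y) (j + 1)
        convert this using 1
        rw [hlw]; push_cast; congr 1; omega

theorem exists_isCanonical (h : IsIdealModule cs (minReps cs J) J b bar) (w : minReps cs J) :
    ∃ c, IsCanonical b bar w c := by
  classical
  induction w using descent_induction cs J with
  | one => exact ⟨_, h.isCanonical_one⟩
  | step s w v hv hl ih =>
    obtain ⟨c, hc⟩ := ih v (by omega)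
    choose! C hC using ih
    have hw := eq_simple_mul_comm hv
    refine ⟨_, h.isCanonical_step hw (by omega) hc (C := C) fun x hx => hC x ?_⟩
    have := (hc.le_of_mem_descentSupport hw (by omega) hx).2
    omega

/-- The difference of two candidates for `c_w` is bar invariant with coordinates in `q ℤ[q]`. -/
theorem isCanonical_unique (h : IsIdealModule cs (minReps cs J) J b bar) {w : minReps cs J}
    {c c' : S} (hc : IsCanonical b bar w c) (hc' : IsCanonical b bar w c') : c = c' := by
  refine sub_eq_zero.1 (h.eq_zero_of_repr_mem_posPart (by rw [map_sub, hc.bar_eq, hc'.bar_eq]) ?_)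
  intro y
  rw [map_sub, Finsupp.sub_apply]
  by_cases hy : y = w
  · rw [hy, hc.self, hc'.self, sub_self]; exact zero_mem _
  · exact sub_mem (hc.pos y hy) (hc'.pos y hy)

/-- The vector `(T_s + q⁻¹) c_v`, for a descent `s` of `v`, is bar invariant with coordinates in
`ℤ[q]`. Since `T_s` multiplies it by `q`, its coordinates of maximal length lie in `q ℤ[q]`, and so it
vanishes. -/
theorem gen_smul_of_mem_descents (h : IsIdealModule cs (minReps cs J) J b bar) {s : B}
    {v : minReps cs J} {c : S} (hc : IsCanonical b bar v c) (hs : s ∈ descents cs J (v : W)) :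
    heckeGen M s • c = -(qInv • c) := by
  rw [eq_neg_iff_add_eq_zero]
  by_contra h0
  obtain ⟨y, h1, h2, h3⟩ := h.exists_maximal_coord (h.bar_gen_smul_add hc.bar_eq s) h0
  have coord : ∀ y, b.repr (heckeGen M s • c + qInv • c) y =
      b.repr (heckeGen M s • c) y + qInv * b.repr c y := by
    intro y
    rw [map_add, map_smul b.repr qInv, Finsupp.add_apply, Finsupp.smul_apply, smul_eq_mul]
  rcases cases_simple_mul cs J s y with hys | ⟨y', hys, hly⟩ | ⟨y', hys, hly⟩
  · apply h1
    rw [coord, h.repr_gen_smul_of_notMem hys]; ring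
  · refine absurd (h3 y' fun h4 => h1 ?_) (by omega)
    rw [coord, h.repr_gen_smul_of_gt (eq_simple_mul_comm hys) hly] at h4
    rw [coord, h.repr_gen_smul_of_lt hys hly]
    have hq := q_mul_qInv
    linear_combination qInv * h4 + (-(b.repr c y')) * hq
  · apply h1
    refine eq_zero_of_mem_posPart ?_ h2
    rw [coord, h.repr_gen_smul_of_gt hys hly]
    have hyv : y' ≠ v := by
      rintro rfl
      exact notMem_descents_of_lt (eq_simple_mul_comm hys) hly hs
    have := add_mem (hc.pos y' hyv) (q_mul_mem_posPart (hc.nonneg y))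
    convert this using 1
    ring

end IsIdealModule

end Canonical

/-! ### The `W`-graph of the canonical basis -/

open Classical in
/-- The polynomial `f` with `a = -q f` if `a ∈ q ℤ[q]`, and `0` otherwise. -/
noncomputable def negDivQ (a : LaurentZ) : Polynomial ℤ :=
  if h : a ∈ posPart then -(Classical.choose h) else 0

theorem eq_neg_q_mul_negDivQ {a : LaurentZ} (h : a ∈ posPart) :
    a = -(q * Polynomial.toLaurent (negDivQ a)) := by
  rw [negDivQ, dif_pos h, map_neg, mul_neg, neg_neg]
  exact Classical.choose_spec h

theorem coeff_negDivQ {a : LaurentZ} (h : a ∈ posPart) (n : ℕ) :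
    (negDivQ a).coeff n = -(a.coeff (n + 1)) := by
  conv_rhs => rw [eq_neg_q_mul_negDivQ h]
  rw [AddMonoidAlgebra.coeff_neg, Finsupp.neg_apply, coeff_q_mul, add_sub_cancel_right,
    coeff_toLaurent_natCast, neg_neg]

theorem negDivQ_zero : negDivQ 0 = 0 := by
  ext n
  rw [coeff_negDivQ (zero_mem _)]
  simp

theorem coeff_one_zero : (1 : LaurentZ).coeff 0 = 1 := by
  have := coeff_toLaurent_natCast 1 0
  rwa [map_one, Polynomial.coeff_one_zero] at this

theorem negDivQ_one : negDivQ 1 = 0 := by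
  rw [negDivQ, dif_neg]
  intro h
  exact one_ne_zero (coeff_one_zero.symm.trans (coeff_of_mem_posPart h le_rfl))

section WGraph

variable {M : CoxeterMatrix B} {cs : CoxeterSystem M W} {J : Set B} {S : Type*} [AddCommGroup S]
  [Module LaurentZ S]

/-- The polynomials `p_{y,w}` with `c = b_w - ∑_{y ≠ w} q p_{y,w} b_y`, for `c` of the shape of a
canonical basis element `c_w`; the value at `y = w` is `0`. -/
noncomputable def klPoly (b : Module.Basis (minReps cs J) LaurentZ S) (c : S) :
    minReps cs J →₀ Polynomial ℤ :=
  (b.repr c).mapRange negDivQ negDivQ_zero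

variable {b : Module.Basis (minReps cs J) LaurentZ S} {bar : S →ₛₗ[barA] S}

theorem klPoly_apply (c : S) (y : minReps cs J) : klPoly b c y = negDivQ (b.repr c y) := rfl

namespace IsCanonical

variable {w y : minReps cs J} {c : S}

theorem klPoly_self (hc : IsCanonical b bar w c) : klPoly b c w = 0 := by
  rw [klPoly_apply, hc.self, negDivQ_one]

theorem repr_eq (hc : IsCanonical b bar w c) (hy : y ≠ w) :
    b.repr c y = -(q * Polynomial.toLaurent (klPoly b c y)) :=
  eq_neg_q_mul_negDivQ (hc.pos y hy)

theorem coeff_klPoly (hc : IsCanonical b bar w c) (hy : y ≠ w) (n : ℕ) :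
    (klPoly b c y).coeff n = -((b.repr c y).coeff (n + 1)) :=
  coeff_negDivQ (hc.pos y hy) n

theorem bruhatLT_of_klPoly_ne_zero (hc : IsCanonical b bar w c) (h : klPoly b c y ≠ 0) :
    BruhatLT cs (y : W) w := by
  refine ⟨hc.le y fun h0 => h ?_, fun h0 => h ?_⟩
  · rw [klPoly_apply, h0, negDivQ_zero]
  · rw [Subtype.ext h0, hc.klPoly_self]

theorem eq_sub_sum (hc : IsCanonical b bar w c) :
    c = b w - (klPoly b c).sum fun y f => (q * Polynomial.toLaurent f) • b y := by
  classical
  apply b.repr.injective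
  ext1 y
  have h1 : b.repr ((klPoly b c).sum fun y f => (q * Polynomial.toLaurent f) • b y) y =
      q * Polynomial.toLaurent (klPoly b c y) := by
    rw [Finsupp.sum, map_sum, Finsupp.finsetSum_apply]
    simp only [map_smul, Module.Basis.repr_self, Finsupp.smul_apply, smul_eq_mul,
      Finsupp.single_apply, mul_ite, mul_one, mul_zero, Finset.sum_ite_eq', Finsupp.mem_support_iff]
    split_ifs with h
    · rfl
    · rw [not_not.1 h, map_zero, mul_zero]
  rw [map_sub, Finsupp.sub_apply, h1, Module.Basis.repr_self]
  by_cases hy : y = w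
  · rw [hy, hc.self, hc.klPoly_self]; simp
  · rw [hc.repr_eq hy, Finsupp.single_eq_of_ne hy, zero_sub]

theorem natDegree_klPoly (hc : IsCanonical b bar w c) (hy : BruhatLT cs (y : W) w) :
    (klPoly b c y).natDegree + cs.length (y : W) + 1 ≤ cs.length (w : W) := by
  by_cases h0 : klPoly b c y = 0
  · have := hy.length_lt
    rw [h0, Polynomial.natDegree_zero]
    omega
  · have h1 := Polynomial.leadingCoeff_ne_zero.2 h0
    rw [Polynomial.leadingCoeff, hc.coeff_klPoly (fun h => hy.2 (congrArg _ h)), neg_ne_zero] at h1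
    obtain ⟨j, hj⟩ := coeff_ne_zero_of_mem_starPart (hc.star y) h1
    omega

end IsCanonical

theorem linearIndependent_of_isCanonical {c : minReps cs J → S}
    (hc : ∀ w, IsCanonical b bar w (c w)) : LinearIndependent LaurentZ c := by
  rw [linearIndependent_iff]
  intro l hl
  by_contra h0
  obtain ⟨y, hy, hmax⟩ := Finset.exists_max_image l.support (fun z => cs.length (z : W))
    (Finsupp.support_nonempty_iff.2 h0)
  have h1 := congrArg (fun x => b.repr x y) hl
  simp only [Finsupp.linearCombination_apply, Finsupp.sum, map_sum, Finsupp.finsetSum_apply,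
    map_smul, Finsupp.smul_apply, smul_eq_mul, map_zero, Finsupp.zero_apply] at h1
  rw [Finset.sum_eq_single y, (hc y).self, mul_one] at h1
  · exact Finsupp.mem_support_iff.1 hy h1
  · intro z hz hzy
    rw [(hc z).eq_zero_of_length_le hzy.symm (hmax z hz), mul_zero]
  · intro h; exact absurd hy h

theorem basis_mem_span_of_isCanonical {c : minReps cs J → S}
    (hc : ∀ w, IsCanonical b bar w (c w)) (w : minReps cs J) :
    b w ∈ Submodule.span LaurentZ (Set.range c) := by
  obtain ⟨n, hn⟩ : ∃ n, cs.length (w : W) = n := ⟨_, rfl⟩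
  induction n using Nat.strong_induction_on generalizing w with
  | _ n ih =>
    have h1 := eq_add_of_sub_eq (hc w).eq_sub_sum.symm
    rw [h1]
    refine add_mem (Submodule.subset_span ⟨w, rfl⟩) (Submodule.sum_mem _ fun y hy => ?_)
    have h2 := ((hc w).bruhatLT_of_klPoly_ne_zero (Finsupp.mem_support_iff.1 hy)).length_lt
    exact Submodule.smul_mem _ _ (ih _ (hn ▸ h2) y rfl)

/-- The canonical basis, from a choice of its elements. -/
noncomputable def canonicalBasis {c : minReps cs J → S}
    (hc : ∀ w, IsCanonical b bar w (c w)) : Module.Basis (minReps cs J) LaurentZ S :=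
  Module.Basis.mk (linearIndependent_of_isCanonical hc) (by
    rw [← b.span_eq, Submodule.span_le]
    rintro _ ⟨w, rfl⟩
    exact basis_mem_span_of_isCanonical hc w)

theorem canonicalBasis_apply {c : minReps cs J → S} (hc : ∀ w, IsCanonical b bar w (c w))
    (w : minReps cs J) : canonicalBasis hc w = c w :=
  Module.Basis.mk_apply _ _ _

namespace IsIdealModule

variable [Module (Hecke M) S] [IsScalarTower LaurentZ (Hecke M) S]

/-- If `s` is a descent of `u` but not of `v`, then the coordinates of `c_u` at `v` and at `sv`
determine each other, since `T_s c_u = -q⁻¹ c_u`. -/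
theorem coeff_one_repr_of_mem_descents (h : IsIdealModule cs (minReps cs J) J b bar) {s : B}
    {u v w : minReps cs J} {c : S} (hc : IsCanonical b bar u c)
    (hu : s ∈ descents cs J (u : W)) (hw : (w : W) = cs.simple s * v)
    (hl : cs.length (v : W) < cs.length (w : W)) :
    (b.repr c v).coeff 1 = -((b.repr c w).coeff 0) := by
  have h1 := h.repr_gen_smul_of_lt hw hl c
  rw [h.gen_smul_of_mem_descents hc hu, map_neg, map_smul, Finsupp.neg_apply, Finsupp.smul_apply,
    smul_eq_mul] at h1
  have h2 : b.repr c v = -(q * b.repr c w) := by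
    rw [← h1, mul_neg, ← mul_assoc, q_mul_qInv, one_mul, neg_neg]
  rw [h2, AddMonoidAlgebra.coeff_neg, Finsupp.neg_apply, coeff_q_mul, sub_self]

theorem gen_smul_of_notMem_descents (h : IsIdealModule cs (minReps cs J) J b bar)
    {c : minReps cs J → S} (hc : ∀ w, IsCanonical b bar w (c w)) {s : B} {v w : minReps cs J}
    (hw : (w : W) = cs.simple s * v) (hl : cs.length (v : W) < cs.length (w : W)) :
    heckeGen M s • c v = q • c v +
      (c w - ∑ x ∈ descentSupport b s (c v), (b.repr (c v) x).coeff 1 • c x) := by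
  rw [h.isCanonical_unique (hc w) (h.isCanonical_step hw hl (hc v) fun x _ => hc x)]
  abel

theorem isWGraphBasis_of_isCanonical (h : IsIdealModule cs (minReps cs J) J b bar)
    (c : Module.Basis (minReps cs J) LaurentZ S) (hc : ∀ w, IsCanonical b bar w (c w)) :
    IsWGraphBasis M c (edgeWeight cs (minReps cs J) fun w => klPoly b (c w))
      (fun w => descents cs J (w : W)) := by
  classical
  intro s v
  refine ⟨h.gen_smul_of_mem_descents (hc v), fun hs => ?_⟩
  obtain ⟨w, hw, hl⟩ : ∃ w : minReps cs J, (w : W) = cs.simple s * v ∧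
      cs.length (v : W) < cs.length (w : W) := by
    rcases cases_simple_mul cs J s v with hv | hv | ⟨y, hy, hly⟩
    · exact absurd (mem_descents_of_notMem hv) hs
    · exact hv
    · exact absurd (mem_descents_of_gt hy hly) hs
  have hvw : BruhatLT cs (v : W) w :=
    (bruhatLT_iff cs).2 ⟨bruhatLE_of_descent (eq_simple_mul_comm hw) hl, hl⟩
  have hsw : s ∈ descents cs J (w : W) := mem_descents_of_gt (eq_simple_mul_comm hw) hl
  set F := descentSupport b s (c v) with hF
  set μ := edgeWeight cs (minReps cs J) fun w => klPoly b (c w) with hμ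
  have weight_lt : ∀ u : minReps cs J, BruhatLT cs (u : W) v →
      μ u v = -((b.repr (c v) u).coeff 1) := by
    intro u hu
    rw [hμ, edgeWeight, if_pos hu, (hc v).coeff_klPoly (fun e => hu.2 (congrArg _ e))]
    simp
  have weight_gt : ∀ u : minReps cs J, s ∈ descents cs J (u : W) → BruhatLT cs (v : W) u →
      μ u v = (b.repr (c u) w).coeff 0 := by
    intro u hsu hu
    have h1 : ¬ BruhatLT cs (u : W) v := fun h1 => lt_asymm h1.length_lt hu.length_lt
    rw [hμ, edgeWeight, if_neg h1, if_pos hu, (hc u).coeff_klPoly (fun e => hu.2 (congrArg _ e)),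
      Nat.cast_zero, zero_add, h.coeff_one_repr_of_mem_descents (hc u) hsu hw hl, neg_neg]
  have weight_w : μ w v = 1 := by
    rw [weight_gt w hsw hvw, (hc w).self, coeff_one_zero]
  have hFv : ∀ x ∈ F, BruhatLT cs (x : W) v := fun x hx =>
    (bruhatLT_iff cs).2 ((hc v).le_of_mem_descentSupport hw hl hx)
  have mem_of_ne : ∀ u : minReps cs J, s ∈ descents cs J (u : W) → μ u v ≠ 0 → u ∈ insert w F := by
    intro u hsu hu
    rw [Finset.mem_insert]
    by_cases h1 : BruhatLT cs (u : W) v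
    · rw [weight_lt u h1] at hu
      refine Or.inr (mem_descentSupport.2 ⟨fun h0 => hu ?_, hsu⟩)
      rw [h0]; simp
    · by_cases h2 : BruhatLT cs (v : W) u
      · left
        by_contra h3
        rw [weight_gt u hsu h2, coeff_of_mem_posPart ((hc u).pos w (Ne.symm h3)) le_rfl] at hu
        exact hu rfl
      · rw [hμ, edgeWeight, if_neg h1, if_neg h2] at hu
        exact absurd rfl hu
  have hwF : w ∉ F := fun hw' => lt_asymm (hFv w hw').length_lt hl
  refine ⟨(insert w F).finite_toSet.subset fun u hu => mem_of_ne u hu.1 hu.2, ?_⟩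
  have hsum : ∑ᶠ (u : minReps cs J) (_ : s ∈ descents cs J (u : W)), μ u v • c u =
      ∑ u ∈ insert w F, μ u v • c u := by
    refine finsum_mem_eq_sum_of_inter_support_eq (fun u => μ u v • c u)
      (s := {u : minReps cs J | s ∈ descents cs J (u : W)}) ?_
    ext u
    simp only [Set.mem_inter_iff, Function.mem_support, Finset.mem_coe, Set.mem_ofPred_eq]
    refine and_congr_left fun hu => ⟨fun hsu => mem_of_ne u hsu (left_ne_zero_of_smul hu), ?_⟩
    rw [Finset.mem_insert]
    rintro (rfl | hu')
    · exact hsw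
    · exact (mem_descentSupport.1 hu').2
  rw [h.gen_smul_of_notMem_descents hc hw hl]
  change _ = q • c v + ∑ᶠ (u : minReps cs J) (_ : s ∈ descents cs J (u : W)), μ u v • c u
  rw [hsum, Finset.sum_insert hwF, weight_w, one_smul, sub_eq_add_neg, ← Finset.sum_neg_distrib]
  congr 2
  refine Finset.sum_congr rfl fun x hx => ?_
  rw [weight_lt x (hFv x hx), neg_smul]

end IsIdealModule

end WGraph

/-! ### Uniqueness of Deodhar's polynomials -/

section Uniqueness

variable {M : CoxeterMatrix B} {cs : CoxeterSystem M W} {J : Set B} {u : Polynomial ℤ}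

theorem IsParabolicR.eq {R R' : minReps cs J → minReps cs J → Polynomial ℤ}
    (hR : IsParabolicR cs J u R) (hR' : IsParabolicR cs J u R') : R = R' := by
  funext y w
  induction w using IsIdealModule.descent_induction cs J generalizing y with
  | one =>
    by_cases hy : BruhatLE cs (y : W) 1
    · have : y = ⟨1, one_mem_minReps cs⟩ := Subtype.ext (hy.eq_of_length_le (by simp))
      rw [this, hR.self, hR'.self]
    · rw [hR.zero _ _ hy, hR'.zero _ _ hy]
  | step s w v hv hl ih =>
    by_cases hyw : y = w
    · rw [hyw, hR.self, hR'.self]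
    by_cases hy : BruhatLE cs (y : W) w
    · have hlt : BruhatLT cs (y : W) w := ⟨hy, fun e => hyw (Subtype.ext e)⟩
      have hl' : cs.length (v : W) < cs.length (w : W) := by omega
      rcases IsIdealModule.cases_simple_mul cs J s y with hz | ⟨z, hz, hlz⟩ | ⟨z, hz, hlz⟩
      · rw [hR.asc_not_mem s y w v hlt hv hl' hz, hR'.asc_not_mem s y w v hlt hv hl' hz, ih v hl']
      · rw [hR.asc s y w z v hlt hv hl' hz hlz, hR'.asc s y w z v hlt hv hl' hz hlz, ih v hl',
          ih v hl']
      · rw [hR.desc s y w z v hlt hv hl' hz hlz, hR'.desc s y w z v hlt hv hl' hz hlz, ih v hl']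
    · rw [hR.zero _ _ hy, hR'.zero _ _ hy]

theorem finite_setOf_between (y w : minReps cs J) :
    {z : minReps cs J | BruhatLE cs (y : W) z ∧ BruhatLE cs (z : W) w}.Finite :=
  Set.Finite.subset ((finite_setOf_bruhatLE cs (w : W)).preimage Subtype.val_injective.injOn)
    fun _ hz => hz.2

/-- Two polynomials of degree less than `n / 2` are equal if their difference `d` satisfies
`q^n d(q⁻¹) = d`. -/
theorem eq_of_T_mul_barA_sub {n : ℕ} {f g : Polynomial ℤ} (hf : 2 * f.natDegree + 1 ≤ n)
    (hg : 2 * g.natDegree + 1 ≤ n)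
    (h : LaurentPolynomial.T (n : ℤ) * barA (Polynomial.toLaurent (f - g)) =
      Polynomial.toLaurent (f - g)) : f = g := by
  have hd : ∀ k : ℕ, n ≤ 2 * k → (f - g).coeff k = 0 := by
    intro k hk
    rw [Polynomial.coeff_sub, Polynomial.coeff_eq_zero_of_natDegree_lt (by omega),
      Polynomial.coeff_eq_zero_of_natDegree_lt (by omega), sub_zero]
  rw [← sub_eq_zero]
  ext k
  rcases le_or_gt n (2 * k) with hk | hk
  · exact hd k hk
  · have h1 := hd (n - k) (by omega)
    have h2 := congrArg (fun a : LaurentZ => a.coeff (k : ℤ)) h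
    simp only [coeff_T_mul, coeff_barA, coeff_toLaurent_natCast] at h2
    have e : -((k : ℤ) - n) = ((n - k : ℕ) : ℤ) := by omega
    rw [e, coeff_toLaurent_natCast, h1] at h2
    exact h2.symm

theorem IsDeodharP.eq {P P' : minReps cs J → minReps cs J → Polynomial ℤ}
    (hP : IsDeodharP cs J u P) (hP' : IsDeodharP cs J u P') : P = P' := by
  obtain ⟨h1, h2, h3, R, hR, h4⟩ := hP
  obtain ⟨h1', h2', h3', R', hR', h4'⟩ := hP'
  obtain rfl := hR.eq hR'
  funext y w
  obtain ⟨n, hn⟩ : ∃ n, cs.length (w : W) - cs.length (y : W) = n := ⟨_, rfl⟩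
  induction n using Nat.strong_induction_on generalizing y with
  | _ n ih =>
    by_cases hyw : y = w
    · rw [hyw, h1, h1']
    by_cases hy : BruhatLE cs (y : W) w
    swap
    · rw [h2 _ _ hy, h2' _ _ hy]
    have hlt : BruhatLT cs (y : W) w := ⟨hy, fun e => hyw (Subtype.ext e)⟩
    have hl := hlt.length_lt
    have d1 := h3 y w hlt
    have d2 := h3' y w hlt
    -- Split off the summand for `z = y`; by induction the others agree.
    set I := {z : minReps cs J | BruhatLE cs (y : W) z ∧ BruhatLE cs (z : W) w}
    have split : ∀ Q : minReps cs J → minReps cs J → Polynomial ℤ,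
        (∑ᶠ (z : minReps cs J) (_ : BruhatLE cs (y : W) z ∧ BruhatLE cs (z : W) w),
          R y z * Q z w) = Q y w + ∑ᶠ (z : minReps cs J) (_ : z ∈ I \ {y}), R y z * Q z w := by
      intro Q
      have hI : insert y (I \ {y}) = I :=
        Set.insert_sdiff_self_of_mem ⟨bruhatLE_refl cs _, hy⟩
      have h5 := finsum_mem_insert (a := y) (s := I \ {y}) (fun z => R y z * Q z w) (by simp)
        ((finite_setOf_between y w).subset Set.sdiff_subset)
      rw [hI, hR.self, one_mul] at h5
      exact h5
    have e1 := h4 y w hy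
    have e2 := h4' y w hy
    rw [split] at e1 e2
    have e3 : (∑ᶠ (z : minReps cs J) (_ : z ∈ I \ {y}), R y z * P z w) =
        ∑ᶠ (z : minReps cs J) (_ : z ∈ I \ {y}), R y z * P' z w := by
      refine finsum_mem_congr rfl fun z hz => ?_
      have hyz : BruhatLT cs (y : W) z := ⟨hz.1.1, fun e => hz.2 (Subtype.ext e.symm)⟩
      rw [ih _ (by have := hyz.length_lt; omega) z rfl]
    rw [e3, map_add] at e1
    rw [map_add] at e2
    refine eq_of_T_mul_barA_sub (n := n) (by omega) (by omega) ?_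
    have en : (n : ℤ) = (cs.length (w : W) : ℤ) - cs.length (y : W) := by omega
    rw [en, map_sub, map_sub, mul_sub, e1, e2]
    ring

end Uniqueness

/-! ### Existence of Deodhar's polynomials -/

/-- The substitution `q ↦ q²` on Laurent polynomials. It passes from the indeterminate of
Deodhar's polynomials to the `q` of the Hecke algebra with `T_s² = 1 + (q - q⁻¹) T_s`. -/
noncomputable def sqSubst : LaurentZ →+* LaurentZ :=
  AddMonoidAlgebra.mapDomainRingHom ℤ (AddMonoidHom.mulLeft (2 : ℤ))

theorem sqSubst_C_mul_T (a n : ℤ) :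
    sqSubst (LaurentPolynomial.C a * LaurentPolynomial.T n) =
      LaurentPolynomial.C a * LaurentPolynomial.T (2 * n) := by
  rw [← LaurentPolynomial.single_eq_C_mul_T, ← LaurentPolynomial.single_eq_C_mul_T, sqSubst,
    AddMonoidAlgebra.mapDomainRingHom_apply, AddMonoidAlgebra.mapDomain_single]
  rfl

theorem sqSubst_T (n : ℤ) :
    sqSubst (LaurentPolynomial.T n) = LaurentPolynomial.T (2 * n) := by
  have := sqSubst_C_mul_T 1 n
  rwa [map_one, one_mul, one_mul] at this

theorem sqSubst_injective : Function.Injective sqSubst := by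
  intro a b h
  rw [sqSubst, AddMonoidAlgebra.mapDomainRingHom_apply,
    AddMonoidAlgebra.mapDomainRingHom_apply] at h
  exact AddMonoidAlgebra.mapDomain_injective (mul_right_injective₀ two_ne_zero) h

theorem sqSubst_barA (a : LaurentZ) : sqSubst (barA a) = barA (sqSubst a) := by
  induction a using LaurentPolynomial.induction_on' with
  | add a b ha hb => simp only [map_add, ha, hb]
  | C_mul_T n a =>
    have hC : barA (LaurentPolynomial.C a) = LaurentPolynomial.C a :=
      LaurentPolynomial.invert_C a
    rw [map_mul barA, barA_T, hC, sqSubst_C_mul_T, sqSubst_C_mul_T, map_mul, barA_T, hC, mul_neg]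

theorem starP_eq_barA_sqSubst (f : Polynomial ℤ) :
    starP f = barA (sqSubst (Polynomial.toLaurent f)) := by
  rw [starP]
  induction f using Polynomial.induction_on' with
  | add f g hf hg => simp only [map_add, hf, hg]
  | monomial n a =>
    rw [Polynomial.aeval_monomial, Polynomial.toLaurent_C_mul_T, sqSubst_C_mul_T, map_mul, barA_T,
      LaurentPolynomial.T_pow]
    change _ = LaurentPolynomial.invert _ * _
    rw [LaurentPolynomial.invert_C]
    congr 2
    ring

theorem sqSubst_toLaurent_X :
    sqSubst (Polynomial.toLaurent Polynomial.X) = LaurentPolynomial.T 2 := by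
  rw [Polynomial.toLaurent_X, sqSubst_T, mul_one]

section Existence

variable {M : CoxeterMatrix B} {cs : CoxeterSystem M W} {J : Set B}

/-- The factor `(-q)^{l(w) - l(y)}`, which relates the normalization of the basis `b_w` to that of
Deodhar's polynomials. -/
noncomputable def signedT (cs : CoxeterSystem M W) (y w : W) : LaurentZ :=
  (-1) ^ (cs.length w + cs.length y) * LaurentPolynomial.T ((cs.length w : ℤ) - cs.length y)

theorem signedT_self (w : W) : signedT cs w w = 1 := by
  rw [signedT, sub_self, LaurentPolynomial.T_zero, mul_one, ← two_mul, pow_mul]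
  simp

theorem signedT_mul_signedT (x y z : W) : signedT cs x y * signedT cs y z = signedT cs x z := by
  have e1 : ((cs.length z : ℤ) - cs.length x) =
      ((cs.length y : ℤ) - cs.length x) + (cs.length z - cs.length y) := by ring
  have e2 : ((-1 : LaurentZ)) ^ (cs.length y + cs.length x) * (-1) ^ (cs.length z + cs.length y) =
      (-1) ^ (cs.length z + cs.length x) := by
    have : cs.length y + cs.length x + (cs.length z + cs.length y) =
        cs.length z + cs.length x + 2 * cs.length y := by ring
    rw [← pow_add, this, pow_add, pow_mul]
    simp
  rw [signedT, signedT, signedT, e1, LaurentPolynomial.T_add, ← e2]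
  ring

theorem signedT_of_length_eq {x y : W} (h : cs.length y = cs.length x + 1) :
    signedT cs x y = -q := by
  have e : ((cs.length y : ℤ) - cs.length x) = 1 := by omega
  rw [signedT, e, h, q, (by ring : cs.length x + 1 + cs.length x = 2 * cs.length x + 1), pow_succ,
    pow_mul]
  simp

theorem barA_signedT (x y : W) : barA (signedT cs x y) = signedT cs y x := by
  rw [signedT, signedT, map_mul, barA_T, map_pow, map_neg, map_one, neg_sub, add_comm]

theorem signedT_eq_neg_q_pow {x y : W} (h : cs.length x ≤ cs.length y) :
    signedT cs x y = (-q) ^ (cs.length y - cs.length x) := by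
  obtain ⟨k, hk⟩ := Nat.exists_eq_add_of_le h
  have e1 : ((cs.length x + k : ℕ) : ℤ) - cs.length x = k * 1 := by push_cast; ring
  have e2 : cs.length x + k + cs.length x = 2 * cs.length x + k := by ring
  rw [signedT, hk, Nat.add_sub_cancel_left, neg_pow q, q, LaurentPolynomial.T_pow, e1, e2, pow_add,
    pow_mul]
  simp

theorem T_mul_signedT (x y : W) :
    LaurentPolynomial.T (2 * ((cs.length x : ℤ) - cs.length y)) * signedT cs x y =
      signedT cs y x := by
  rw [signedT, signedT, mul_left_comm, ← LaurentPolynomial.T_add, add_comm (cs.length x)]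
  congr 2
  ring

theorem coeff_ne_zero_of_signedT_mul {x y : W} {a : LaurentZ} {k : ℤ}
    (h : (signedT cs x y * a).coeff k ≠ 0) :
    a.coeff (k - ((cs.length y : ℤ) - cs.length x)) ≠ 0 := by
  rw [← coeff_T_mul]
  rcases neg_one_pow_eq_or LaurentZ (cs.length y + cs.length x) with h1 | h1
  · rwa [signedT, h1, one_mul] at h
  · rwa [signedT, h1, neg_mul, one_mul, neg_mul, AddMonoidAlgebra.coeff_neg, Finsupp.neg_apply,
      neg_ne_zero] at h

variable {S : Type*} [AddCommGroup S] [Module LaurentZ S]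
  {b : Module.Basis (minReps cs J) LaurentZ S} {bar : S →ₛₗ[barA] S}

theorem exists_repr_eq_signedT_mul {c : minReps cs J → S} (hc : ∀ w, IsCanonical b bar w (c w)) :
    ∃ P : minReps cs J → minReps cs J → Polynomial ℤ,
      ∀ y w, b.repr (c w) y = signedT cs (y : W) w * starP (P y w) := by
  have key : ∀ y w : minReps cs J, ∃ f : Polynomial ℤ,
      b.repr (c w) y = signedT cs (y : W) w * starP f := by
    intro y w
    obtain ⟨f, hf⟩ := (hc w).star y
    rcases neg_one_pow_eq_or LaurentZ (cs.length (w : W) + cs.length (y : W)) with h1 | h1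
    · exact ⟨f, by rw [signedT, h1, one_mul, hf]⟩
    · exact ⟨-f, by rw [signedT, h1, starP_neg, hf]; ring⟩
  choose P hP using key
  exact ⟨P, hP⟩

theorem IsCanonical.toLaurent_klPoly_eq {y w : minReps cs J} {c : S} (hc : IsCanonical b bar w c)
    (hy : BruhatLT cs (y : W) w) {f : Polynomial ℤ}
    (hf : b.repr c y = signedT cs (y : W) w * starP f) :
    Polynomial.toLaurent (klPoly b c y) =
      (-q) ^ (cs.length (w : W) - cs.length (y : W) - 1) * starP f := by
  have hl := hy.length_lt
  obtain ⟨k, hk⟩ : ∃ k, cs.length (w : W) - cs.length (y : W) = k + 1 :=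
    ⟨cs.length (w : W) - cs.length (y : W) - 1, by omega⟩
  rw [hc.repr_eq (fun e => hy.2 (congrArg _ e)), signedT_eq_neg_q_pow hl.le, hk, pow_succ] at hf
  rw [hk, Nat.add_sub_cancel]
  have hq := q_mul_qInv
  linear_combination (-qInv) * hf + ((-q) ^ k * starP f - Polynomial.toLaurent (klPoly b c y)) * hq

namespace IsIdealModule

/-- The normalized coefficients of the bar involution; these are the `R^J_{y,w}(q²)`. -/
noncomputable def barCoeff (b : Module.Basis (minReps cs J) LaurentZ S) (bar : S →ₛₗ[barA] S)
    (y w : minReps cs J) : LaurentZ :=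
  signedT cs (y : W) w * b.repr (bar (b w)) y

variable [Module (Hecke M) S] [IsScalarTower LaurentZ (Hecke M) S]

theorem barCoeff_self (h : IsIdealModule cs (minReps cs J) J b bar) (w : minReps cs J) :
    barCoeff b bar w w = 1 := by
  rw [barCoeff, signedT_self, h.repr_bar_self, mul_one]

theorem barCoeff_eq_zero (h : IsIdealModule cs (minReps cs J) J b bar) {y w : minReps cs J}
    (hy : ¬ BruhatLE cs (y : W) w) : barCoeff b bar y w = 0 := by
  by_contra h0
  exact hy (h.bruhatLE_of_repr_bar_ne_zero (right_ne_zero_of_mul h0))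

theorem length_eq_of_simple_mul {s : B} {w v : W} (hw : v = cs.simple s * w)
    (hl : cs.length v < cs.length w) : cs.length w = cs.length v + 1 := by
  have := cs.length_simple_mul w s
  rw [← hw] at this
  omega

theorem barCoeff_of_gt (h : IsIdealModule cs (minReps cs J) J b bar) {s : B}
    {w v y y' : minReps cs J} (hw : (v : W) = cs.simple s * w)
    (hl : cs.length (v : W) < cs.length (w : W)) (hy : (y' : W) = cs.simple s * y)
    (hly : cs.length (y' : W) < cs.length (y : W)) :
    barCoeff b bar y w = barCoeff b bar y' v := by
  rw [barCoeff, barCoeff, h.repr_bar_of_gt hw hl hy hly, signedT, signedT,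
    length_eq_of_simple_mul hw hl, length_eq_of_simple_mul hy hly,
    (by ring : cs.length (v : W) + 1 + (cs.length (y' : W) + 1) =
      cs.length (v : W) + cs.length (y' : W) + 2), pow_add]
  congr 2
  · simp
  · congr 1; push_cast; ring

theorem barCoeff_of_lt (h : IsIdealModule cs (minReps cs J) J b bar) {s : B}
    {w v y y' : minReps cs J} (hw : (v : W) = cs.simple s * w)
    (hl : cs.length (v : W) < cs.length (w : W)) (hy : (y' : W) = cs.simple s * y)
    (hly : cs.length (y : W) < cs.length (y' : W)) :
    barCoeff b bar y w = (LaurentPolynomial.T 2 - 1) * barCoeff b bar y v +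
      LaurentPolynomial.T 2 * barCoeff b bar y' v := by
  have h1 := signedT_of_length_eq (length_eq_of_simple_mul hw hl)
  have h2 := signedT_of_length_eq (length_eq_of_simple_mul (eq_simple_mul_comm hy) hly)
  have hq : (LaurentPolynomial.T 2 : LaurentZ) = q * q := by
    rw [q, ← LaurentPolynomial.T_add]; rfl
  rw [barCoeff, barCoeff, barCoeff, h.repr_bar_of_lt hw hl hy hly,
    ← signedT_mul_signedT (y : W) v w, h1, ← signedT_mul_signedT (y : W) y' v, h2, hq]
  have h3 := q_mul_qInv
  linear_combination (q * signedT cs (y' : W) v * b.repr (bar (b v)) y) * h3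

theorem barCoeff_of_notMem (h : IsIdealModule cs (minReps cs J) J b bar) {s : B}
    {w v y : minReps cs J} (hw : (v : W) = cs.simple s * w)
    (hl : cs.length (v : W) < cs.length (w : W)) (hy : cs.simple s * (y : W) ∉ minReps cs J) :
    barCoeff b bar y w = LaurentPolynomial.T 2 * barCoeff b bar y v := by
  have h1 := signedT_of_length_eq (length_eq_of_simple_mul hw hl)
  have hq : (LaurentPolynomial.T 2 : LaurentZ) = q * q := by
    rw [q, ← LaurentPolynomial.T_add]; rfl
  rw [barCoeff, barCoeff, h.repr_bar_of_notMem hw hl hy, ← signedT_mul_signedT (y : W) v w, h1, hq]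
  ring

theorem exists_sqSubst_eq_barCoeff (h : IsIdealModule cs (minReps cs J) J b bar)
    (y w : minReps cs J) :
    ∃ f : Polynomial ℤ, sqSubst (Polynomial.toLaurent f) = barCoeff b bar y w := by
  induction w using descent_induction cs J generalizing y with
  | one =>
    by_cases hy : y = ⟨1, one_mem_minReps cs⟩
    · exact ⟨1, by rw [hy, h.barCoeff_self, map_one, map_one]⟩
    · refine ⟨0, ?_⟩
      rw [map_zero, map_zero, h.barCoeff_eq_zero]
      intro h1
      exact hy (Subtype.ext (h1.eq_of_length_le (by simp)))
  | step s w v hv hl ih =>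
    have hl' : cs.length (v : W) < cs.length (w : W) := by omega
    rcases cases_simple_mul cs J s y with hz | ⟨z, hz, hlz⟩ | ⟨z, hz, hlz⟩
    · obtain ⟨f, hf⟩ := ih v hl' y
      exact ⟨Polynomial.X * f, by
        rw [h.barCoeff_of_notMem hv hl' hz, map_mul, map_mul, sqSubst_toLaurent_X, hf]⟩
    · obtain ⟨f, hf⟩ := ih v hl' y
      obtain ⟨g, hg⟩ := ih v hl' z
      exact ⟨(Polynomial.X - 1) * f + Polynomial.X * g, by
        rw [h.barCoeff_of_lt hv hl' hz hlz]
        simp only [map_mul, map_add, map_sub, map_one, sqSubst_toLaurent_X, hf, hg]⟩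
    · obtain ⟨f, hf⟩ := ih v hl' z
      exact ⟨f, by rw [h.barCoeff_of_gt hv hl' hz hlz, hf]⟩

/-- The polynomials `R` with `R_{y,w}(q²)` the normalized coefficients of the bar involution are
Deodhar's, since both satisfy the same recursion. -/
theorem isParabolicR_of_sqSubst_eq (h : IsIdealModule cs (minReps cs J) J b bar)
    {R : minReps cs J → minReps cs J → Polynomial ℤ}
    (hR : ∀ y w, sqSubst (Polynomial.toLaurent (R y w)) = barCoeff b bar y w) :
    IsParabolicR cs J (-1) R := by
  have inj : Function.Injective fun f : Polynomial ℤ => sqSubst (Polynomial.toLaurent f) :=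
    sqSubst_injective.comp Polynomial.toLaurent_injective
  refine ⟨fun w => inj ?_, fun y w hy => inj ?_, fun s y w y' w' _ hw hl hy hly => inj ?_,
    fun s y w y' w' _ hw hl hy hly => inj ?_, fun s y w w' _ hw hl hy => inj ?_⟩
  · simp only [hR, map_one, h.barCoeff_self]
  · simp only [hR, map_zero, h.barCoeff_eq_zero hy]
  · simp only [hR, h.barCoeff_of_gt hw hl hy hly]
  · simp only [map_mul, map_add, map_sub, map_one, sqSubst_toLaurent_X, hR,
      h.barCoeff_of_lt hw hl hy hly]
  · simp only [map_mul, sqSubst_toLaurent_X, hR, h.barCoeff_of_notMem hw hl hy, sub_neg_eq_add,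
      sub_add_cancel]

/-- The polynomials `P` given by the coordinates `(-q)^{l(w) - l(y)} P_{y,w}(q⁻²)` of the canonical
basis are Deodhar's; the functional equation says that `c_w` is bar invariant. -/
theorem isDeodharP_of_repr_eq (h : IsIdealModule cs (minReps cs J) J b bar)
    {c : minReps cs J → S} (hc : ∀ w, IsCanonical b bar w (c w))
    {P : minReps cs J → minReps cs J → Polynomial ℤ}
    (hP : ∀ y w, b.repr (c w) y = signedT cs (y : W) w * starP (P y w)) :
    IsDeodharP cs J (-1) P := by
  have hP' : ∀ y w, starP (P y w) = signedT cs (w : W) y * b.repr (c w) y := by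
    intro y w
    rw [hP, ← mul_assoc, signedT_mul_signedT, signedT_self, one_mul]
  have starP_zero : starP 0 = 0 := map_zero _
  have hP0 : ∀ y w, b.repr (c w) y = 0 → P y w = 0 := fun y w h0 =>
    starP_injective (by rw [hP', h0, mul_zero, starP_zero])
  have hPle : ∀ y w : minReps cs J, ¬ BruhatLE cs (y : W) w → P y w = 0 := fun y w hy =>
    hP0 y w (by by_contra h0; exact hy ((hc w).le y h0))
  choose R hR using h.exists_sqSubst_eq_barCoeff
  have hRJ := h.isParabolicR_of_sqSubst_eq hR
  refine ⟨fun w => starP_injective ?_, hPle, fun y w hy => ?_, R, hRJ, fun y w hy => ?_⟩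
  · rw [hP', (hc w).self, signedT_self, one_mul]
    exact (map_one _).symm
  · have hl := hy.length_lt
    by_cases h0 : P y w = 0
    · rw [h0, Polynomial.natDegree_zero]; omega
    · -- The leading term of `P` gives the term of lowest degree of the coordinate.
      have h1 := Polynomial.leadingCoeff_ne_zero.2 h0
      rw [Polynomial.leadingCoeff, ← coeff_starP, hP'] at h1
      by_contra h2
      exact coeff_ne_zero_of_signedT_mul h1
        (coeff_of_mem_posPart ((hc w).pos y fun e => hy.2 (congrArg _ e)) (by omega))
  · have hsum : (∑ᶠ (z : minReps cs J) (_ : BruhatLE cs (y : W) z ∧ BruhatLE cs (z : W) w),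
        R y z * P z w) = ∑ z ∈ (b.repr (c w)).support, R y z * P z w := by
      refine finsum_mem_eq_sum_of_inter_support_eq (fun z => R y z * P z w)
        (s := {z : minReps cs J | BruhatLE cs (y : W) z ∧ BruhatLE cs (z : W) w}) ?_
      ext z
      refine and_congr_left fun hz => ⟨fun _ => ?_, fun _ => ⟨?_, ?_⟩⟩
      · exact Finsupp.mem_support_iff.2 fun h0 => hz (by simp only [hP0 z w h0, mul_zero])
      · by_contra h0; exact hz (by simp only [hRJ.zero y z h0, zero_mul])
      · by_contra h0; exact hz (by simp only [hPle z w h0, mul_zero])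
    have hbar := repr_semilinear_apply b bar (c w) y
    rw [(hc w).bar_eq] at hbar
    apply sqSubst_injective
    rw [hsum, map_mul, sqSubst_T, sqSubst_barA, ← starP_eq_barA_sqSubst, hP', ← mul_assoc,
      T_mul_signedT, hbar, map_sum, map_sum, Finsupp.sum, Finset.mul_sum]
    refine Finset.sum_congr rfl fun z _ => ?_
    have hPz : sqSubst (Polynomial.toLaurent (P z w)) =
        signedT cs (z : W) w * barA (b.repr (c w) z) := by
      rw [← barA_signedT, ← map_mul, ← hP', starP_eq_barA_sqSubst, barA_barA]
    rw [map_mul, map_mul, hR, hPz, barCoeff, ← signedT_mul_signedT (y : W) z w]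
    ring

end IsIdealModule

end Existence

end HeckeWGraph

theorem mainTheorem9 {B : Type*} {W : Type*} [Group W] {M : CoxeterMatrix B}
    (cs : CoxeterSystem M W) (J : Set B) :
    IsWGraphIdeal cs (minReps cs J) J ∧
    ∃ (b : Module.Basis (minReps cs J) LaurentZ (SPhi M J))
      (bar : SPhi M J →ₛₗ[barA] SPhi M J),
      (∀ w : minReps cs J, b w = SPhi.tmul M J (heckeT cs (w : W)) 1) ∧
      IsIdealModule cs (minReps cs J) J b bar ∧
      ∃ (c : Module.Basis (minReps cs J) LaurentZ (SPhi M J))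
        (p : minReps cs J → minReps cs J →₀ Polynomial ℤ),
        (∀ w, bar (c w) = c w) ∧
        (∀ w, ∀ y ∈ (p w).support, BruhatLT cs (y : W) w) ∧
        (∀ w, c w = b w - (p w).sum fun y f => (q * Polynomial.toLaurent f) • b y) ∧
        (∀ y w : minReps cs J, BruhatLT cs (y : W) w →
          (p w y).natDegree + cs.length (y : W) + 1 ≤ cs.length (w : W)) ∧
        IsWGraphBasis M c (edgeWeight cs (minReps cs J) p) (fun w => descents cs J (w : W)) ∧
        ∃ P : minReps cs J → minReps cs J → Polynomial ℤ,
          IsDeodharP cs J (-1) P ∧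
          (∀ P', IsDeodharP cs J (-1) P' → P' = P) ∧
          ∀ y w : minReps cs J, BruhatLT cs (y : W) w →
            Polynomial.toLaurent (p w y) =
              (-q) ^ (cs.length (w : W) - cs.length (y : W) - 1) * starP (P y w) := by
  have h := isIdealModule_inducedBasis cs J
  choose c₀ hc₀ using h.exists_isCanonical
  set c := canonicalBasis hc₀
  have hc : ∀ w, IsCanonical (inducedBasis cs J) (inducedBar cs J) w (c w) := fun w => by
    rw [canonicalBasis_apply]; exact hc₀ w
  obtain ⟨P, hP⟩ := exists_repr_eq_signedT_mul hc
  have hD := h.isDeodharP_of_repr_eq hc hP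
  exact ⟨isWGraphIdeal_minReps cs J, inducedBasis cs J, inducedBar cs J,
    fun w => inducedBasis_apply cs J w, h, c, fun w => klPoly (inducedBasis cs J) (c w),
    fun w => (hc w).bar_eq,
    fun w y hy => (hc w).bruhatLT_of_klPoly_ne_zero (Finsupp.mem_support_iff.1 hy),
    fun w => (hc w).eq_sub_sum, fun y w hy => (hc w).natDegree_klPoly hy,
    h.isWGraphBasis_of_isCanonical c hc, P, hD, fun P' hP' => hP'.eq hD,
    fun y w hy => (hc w).toLaurent_klPoly_eq hy (hP y w)⟩
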